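/- Let $d\ge 1$, $\beta>0$, and let $U:\mathbb R^d\to[0,\infty]$ be measurable, radial, and of finite range, i.e. $U(x)=0$ for $|x|>R_0$ (the value $+\infty$ is allowed, so $U$ may have a hard core). Let $H=-2\Delta+U$ be the self-adjoint operator associated with the closed quadratic form $\int_{\mathbb R^d}(2|\nabla u|^2+U|u|^2)\,dx$ with domain $\{u\in H^1(\mathbb R^d):\int U|u|^2<\infty\}$, acting in the closure of this domain in $L^2(\mathbb R^d)$. A function $g(H)$ with $g$ continuous on $[0,\infty)$ and convergent at $\infty$ is understood as $g(\infty)$ on the orthogonal complement of that closure; in particular $e^{-\beta H}=0$ there. Then the operator $e^{2\beta\Delta}-e^{\beta(2\Delta-U)}=e^{2\beta\Delta}-e^{-\beta H}$ on $L^2(\mathbb R^d)$ has an integral kernel $K(x,y)$, which is non-negative almost everywhere and integrable on $\mathbb R^d\times\mathbb R^d$, and the quantity $$a(\beta)=\frac{1}{8\pi\beta}\int_{\mathbb R^d\times\mathbb R^d}K(x,y)\,dx\,dy$$ satisfies $$a(\beta)=\frac1{8\pi}\inf_{\psi\in H^1(\mathbb R^d)}\mathcal E_\beta(\psi),$$ where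 $$\mathcal E_\beta(\psi)=\int_{\mathbb R^d}\bigl(2|\nabla\psi(x)|^2+U(x)|1-\psi(x)|^2\bigr)\,dx+\frac1\beta\bigl\langle\psi\,\big|\,f(\beta(-2\Delta+U))\,\big|\,\psi\bigr\rangle\in[0,\infty]$$ and $f(t)=t\,\dfrac{1-e^{-t}}{t-1+e^{-t}}$ for $t>0$, with $f(0)=2$ and $f(\infty)=1$ by continuity. -/

import Mathlib

open MeasureTheory
open scoped ENNReal NNReal LineDeriv SchwartzMap InnerProductSpace

noncomputable section

/-- Euclidean space `ℝ^d`. -/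
abbrev Rd (d : ℕ) : Type := EuclideanSpace ℝ (Fin d)

/-- The complex Hilbert space `L²(ℝ^d)`. -/
abbrev L2 (d : ℕ) : Type := Lp ℂ 2 (volume : Measure (Rd d))

/-- `g = (g_1, …, g_d)` is the weak (distributional) gradient of `u`, with components in `L²`. -/
def IsWeakGradient {d : ℕ} (u : L2 d) (g : Fin d → L2 d) : Prop :=
  ∀ i, ∂_{(EuclideanSpace.single i (1 : ℝ) : Rd d)} (u : 𝓢'(Rd d, ℂ)) = (g i : 𝓢'(Rd d, ℂ))

/-- `u ∈ H¹(ℝ^d)`: `u` is in `L²` and has a weak gradient in `L²`. -/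
def MemH1 {d : ℕ} (u : L2 d) : Prop := ∃ g, IsWeakGradient u g

open Classical in
/-- The weak gradient of `u ∈ H¹(ℝ^d)` (and `0` if `u ∉ H¹(ℝ^d)`). -/
def weakGradient {d : ℕ} (u : L2 d) : Fin d → L2 d :=
  if h : MemH1 u then h.choose else 0

/-- The domain of the quadratic form of `-2Δ + U`: all `u ∈ H¹(ℝ^d)` with `∫ U |u|² < ∞`.
Here `volume.withDensity U` is the measure `U(x) dx`; where `U = ∞`, `u` has to vanish a.e. -/
def MemFormDomain {d : ℕ} (U : Rd d → ℝ≥0∞) (u : L2 d) : Prop :=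
  MemH1 u ∧ MemLp u 2 (volume.withDensity U)

/-- The sesquilinear form `∫ (2 conj(∇v) · ∇u + U conj(v) u)` of `-2Δ + U`. -/
def schrodingerForm {d : ℕ} (U : Rd d → ℝ≥0∞) (v u : L2 d) : ℂ :=
  2 * ∑ i, ⟪weakGradient v i, weakGradient u i⟫_ℂ
    + ∫ x, (starRingEnd ℂ) (v x) * u x ∂(volume.withDensity U)

/-- `R` is the resolvent `(H + 1)⁻¹` of the self-adjoint operator `H = -2Δ + U` given by the
quadratic form: `u = R φ` is the weak solution of `(-2Δ + U + 1) u = φ` in the form domain.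
If `U = ∞` on a set of positive measure, the form domain need not be dense in `L²`; then `H`
acts in the closure of the form domain, and `R` vanishes on its orthogonal complement. -/
def IsFormResolvent {d : ℕ} (U : Rd d → ℝ≥0∞) (R : L2 d →L[ℂ] L2 d) : Prop :=
  ∀ φ : L2 d, MemFormDomain U (R φ) ∧
    ∀ v : L2 d, MemFormDomain U v → schrodingerForm U v (R φ) + ⟪v, R φ⟫_ℂ = ⟪v, φ⟫_ℂ

lemma toTempered_inj {d : ℕ} {u v : L2 d} (h : (u : 𝓢'(Rd d, ℂ)) = (v : 𝓢'(Rd d, ℂ))) :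
    u = v := by
  have hk := Lp.ker_toTemperedDistributionCLM_eq_bot (F := ℂ) (μ := (volume : Measure (Rd d)))
    (p := 2)
  exact LinearMap.ker_eq_bot.mp hk h

lemma weakGradient_eq {d : ℕ} {u : L2 d} {g : Fin d → L2 d} (h : IsWeakGradient u g) :
    weakGradient u = g := by
  have hu : MemH1 u := ⟨g, h⟩
  rw [weakGradient, dif_pos hu]
  funext i
  exact toTempered_inj ((hu.choose_spec i).symm.trans (h i))

/-- The space in which the closed form domain is embedded as `u ↦ (u, √2 ∇u, u)`. -/
abbrev FormSpace (d : ℕ) (U : Rd d → ℝ≥0∞) : Type :=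
  WithLp 2 (L2 d × WithLp 2 (PiLp 2 (fun _ : Fin d => L2 d) × Lp ℂ 2 (volume.withDensity U)))

/-- The form domain of `-2Δ + U`, with its form inner product, as a subspace of `FormSpace`. -/
def formGraph {d : ℕ} (U : Rd d → ℝ≥0∞) : Submodule ℂ (FormSpace d U) where
  carrier := {w | (∀ i, ((Real.sqrt 2 : ℝ) : ℂ) •
      ∂_{(EuclideanSpace.single i (1 : ℝ) : Rd d)} (Lp.toTemperedDistributionCLM ℂ volume 2 w.fst)
        = Lp.toTemperedDistributionCLM ℂ volume 2 (w.snd.fst i)) ∧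
      w.fst =ᵐ[volume.withDensity U] w.snd.snd}
  add_mem' := by
    rintro a b ⟨ha, ha'⟩ ⟨hb, hb'⟩
    refine ⟨fun i => ?_, ?_⟩
    · simp only [WithLp.add_fst, WithLp.add_snd, PiLp.add_apply, map_add,
        LineDeriv.lineDerivOp_add, smul_add, ha i, hb i]
    · have h1 := (withDensity_absolutelyContinuous volume U).ae_eq (Lp.coeFn_add a.fst b.fst)
      have h2 := Lp.coeFn_add a.snd.snd b.snd.snd
      filter_upwards [h1, h2, ha', hb'] with x h1 h2 h3 h4
      simp only [WithLp.add_fst, WithLp.add_snd, h1, h2, Pi.add_apply, h3, h4]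
  zero_mem' := by
    refine ⟨fun i => ?_, ?_⟩
    · have h0 : ∂_{(EuclideanSpace.single i (1 : ℝ) : Rd d)} (0 : 𝓢'(Rd d, ℂ)) = 0 :=
        map_zero (LineDeriv.lineDerivOpCLM ℂ 𝓢'(Rd d, ℂ) (EuclideanSpace.single i (1 : ℝ) : Rd d))
      simp only [WithLp.zero_fst, WithLp.zero_snd, PiLp.zero_apply, map_zero, h0, smul_zero]
    · have h1 := (withDensity_absolutelyContinuous volume U).ae_eq
        (Lp.coeFn_zero ℂ 2 (volume : Measure (Rd d)))
      have h2 := Lp.coeFn_zero ℂ 2 (volume.withDensity U)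
      filter_upwards [h1, h2] with x h1 h2
      simp only [WithLp.zero_fst, WithLp.zero_snd, h1, h2, Pi.zero_apply]
  smul_mem' := by
    rintro c a ⟨ha, ha'⟩
    refine ⟨fun i => ?_, ?_⟩
    · simp only [WithLp.smul_fst, WithLp.smul_snd, PiLp.smul_apply, map_smul,
        LineDeriv.lineDerivOp_smul, ← ha i]
      rw [smul_comm]
    · have h1 := (withDensity_absolutelyContinuous volume U).ae_eq (Lp.coeFn_smul c a.fst)
      have h2 := Lp.coeFn_smul c a.snd.snd
      filter_upwards [h1, h2, ha'] with x h1 h2 h3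
      simp only [WithLp.smul_fst, WithLp.smul_snd, h1, h2, Pi.smul_apply, h3]

lemma isClosed_formGraph {d : ℕ} (U : Rd d → ℝ≥0∞) :
    IsClosed (formGraph U : Set (FormSpace d U)) := by
  refine IsSeqClosed.isClosed ?_
  intro w a hw ha
  have h1 : Filter.Tendsto (fun n => (w n).fst) Filter.atTop (nhds a.fst) :=
    ((WithLp.fstL 2 ℂ _ _).continuous.tendsto a).comp ha
  have h2 : Filter.Tendsto (fun n => (w n).snd) Filter.atTop (nhds a.snd) :=
    ((WithLp.sndL 2 ℂ _ _).continuous.tendsto a).comp ha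
  have h3 : Filter.Tendsto (fun n => (w n).snd.fst) Filter.atTop (nhds a.snd.fst) :=
    ((WithLp.fstL 2 ℂ _ _).continuous.tendsto a.snd).comp h2
  have h4 : Filter.Tendsto (fun n => (w n).snd.snd) Filter.atTop (nhds a.snd.snd) :=
    ((WithLp.sndL 2 ℂ _ _).continuous.tendsto a.snd).comp h2
  refine ⟨fun i => ?_, ?_⟩
  · have h5 : Filter.Tendsto (fun n => (w n).snd.fst i) Filter.atTop (nhds (a.snd.fst i)) :=
      ((PiLp.proj 2 (𝕜 := ℂ) (fun _ : Fin d => L2 d) i).continuous.tendsto a.snd.fst).comp h3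
    have h6 := ((Lp.toTemperedDistributionCLM ℂ (volume : Measure (Rd d)) 2).continuous.tendsto
      _).comp h5
    have h7 := (((LineDeriv.lineDerivOpCLM ℂ 𝓢'(Rd d, ℂ)
      (EuclideanSpace.single i (1 : ℝ) : Rd d)).continuous.tendsto _).comp
      (((Lp.toTemperedDistributionCLM ℂ (volume : Measure (Rd d)) 2).continuous.tendsto
      _).comp h1)).const_smul ((Real.sqrt 2 : ℝ) : ℂ)
    refine tendsto_nhds_unique h7 (h6.congr fun n => ?_)
    exact ((hw n).1 i).symm
  · have m1 := tendstoInMeasure_of_tendsto_Lp h1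
    obtain ⟨ns, hns, hn⟩ := m1.exists_seq_tendsto_ae
    have m2 := tendstoInMeasure_of_tendsto_Lp (h4.comp hns.tendsto_atTop)
    obtain ⟨ms, hms, hm⟩ := m2.exists_seq_tendsto_ae
    have hn' := (withDensity_absolutelyContinuous volume U).ae_le hn
    have hall : ∀ᵐ x ∂(volume.withDensity U), ∀ n, (w n).fst x = (w n).snd.snd x :=
      ae_all_iff.2 fun n => (hw n).2
    filter_upwards [hn', hm, hall] with x k1 k2 k3
    refine tendsto_nhds_unique (k1.comp hms.tendsto_atTop) (k2.congr fun n => ?_)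
    exact (k3 _).symm

lemma formGraph_lift {d : ℕ} {U : Rd d → ℝ≥0∞} {u : L2 d} (hu : MemFormDomain U u) :
    ∃ w ∈ formGraph U, w.fst = u := by
  refine ⟨WithLp.toLp 2 (u, WithLp.toLp 2 (WithLp.toLp 2 (fun i =>
    ((Real.sqrt 2 : ℝ) : ℂ) • weakGradient u i), hu.2.toLp u)), ⟨fun i => ?_, ?_⟩, rfl⟩
  · obtain ⟨g, hg⟩ := hu.1
    have h := hg i
    rw [← weakGradient_eq hg] at h
    simp only [WithLp.fst, WithLp.snd, map_smul]
    exact congrArg _ h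
  · exact hu.2.coeFn_toLp.symm

lemma formGraph_weakGradient {d : ℕ} {U : Rd d → ℝ≥0∞} {w : FormSpace d U}
    (hw : w ∈ formGraph U) :
    IsWeakGradient w.fst (fun i => ((Real.sqrt 2 : ℝ) : ℂ)⁻¹ • w.snd.fst i) := by
  intro i
  have hs : ((Real.sqrt 2 : ℝ) : ℂ) ≠ 0 := by simp
  change _ = Lp.toTemperedDistributionCLM ℂ volume 2 _
  rw [map_smul, ← hw.1 i, smul_smul, inv_mul_cancel₀ hs, one_smul]
  rfl

lemma formGraph_memFormDomain {d : ℕ} {U : Rd d → ℝ≥0∞} {w : FormSpace d U}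
    (hw : w ∈ formGraph U) : MemFormDomain U w.fst :=
  ⟨⟨_, formGraph_weakGradient hw⟩, (memLp_congr_ae hw.2).2 (Lp.memLp _)⟩

lemma formGraph_inner {d : ℕ} {U : Rd d → ℝ≥0∞} {v w : FormSpace d U}
    (hv : v ∈ formGraph U) (hw : w ∈ formGraph U) :
    ⟪v, w⟫_ℂ = schrodingerForm U v.fst w.fst + ⟪v.fst, w.fst⟫_ℂ := by
  have hs : ((Real.sqrt 2 : ℝ) : ℂ) ≠ 0 := by simp
  have hss : ((Real.sqrt 2 : ℝ) : ℂ) * ((Real.sqrt 2 : ℝ) : ℂ) = 2 := by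
    rw [← Complex.ofReal_mul, Real.mul_self_sqrt (by norm_num)]; norm_num
  have hint : ∫ x, (starRingEnd ℂ) (v.fst x) * w.fst x ∂(volume.withDensity U)
      = ⟪v.snd.snd, w.snd.snd⟫_ℂ := by
    rw [L2.inner_def]
    refine integral_congr_ae ?_
    filter_upwards [hv.2, hw.2] with x h1 h2
    rw [h1, h2, RCLike.inner_apply, mul_comm]
  have hgrad : 2 * ∑ i, ⟪weakGradient v.fst i, weakGradient w.fst i⟫_ℂ
      = ∑ i, ⟪v.snd.fst i, w.snd.fst i⟫_ℂ := by
    rw [weakGradient_eq (formGraph_weakGradient hv), weakGradient_eq (formGraph_weakGradient hw),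
      Finset.mul_sum]
    refine Finset.sum_congr rfl fun i _ => ?_
    rw [inner_smul_left, inner_smul_right, map_inv₀, Complex.conj_ofReal, ← mul_assoc, ← mul_assoc,
      ← hss]
    field_simp
  rw [schrodingerForm, hint, hgrad, WithLp.prod_inner_apply, WithLp.prod_inner_apply,
    PiLp.inner_apply]
  exact add_comm _ _

lemma exists_adjoint {V H : Type*} [NormedAddCommGroup V] [InnerProductSpace ℂ V] [CompleteSpace V]
    [NormedAddCommGroup H] [InnerProductSpace ℂ H] [CompleteSpace H] (J : V →L[ℂ] H) :
    ∃ A : H →L[ℂ] V, ∀ v φ, ⟪v, A φ⟫_ℂ = ⟪J v, φ⟫_ℂ :=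
  ⟨ContinuousLinearMap.adjoint J, fun v φ => ContinuousLinearMap.adjoint_inner_right J v φ⟩

/-- The resolvent exists and is unique. -/
theorem existsUnique_isFormResolvent {d : ℕ} (U : Rd d → ℝ≥0∞) :
    ∃! R : L2 d →L[ℂ] L2 d, IsFormResolvent U R := by
  have : CompleteSpace (formGraph U) := (isClosed_formGraph U).completeSpace_coe
  let J : formGraph U →L[ℂ] L2 d := (WithLp.fstL 2 ℂ _ _) ∘L (formGraph U).subtypeL
  have hJ : ∀ w : formGraph U, J w = (w : FormSpace d U).fst := fun _ => rfl
  obtain ⟨A, hA⟩ := exists_adjoint (V := formGraph U) (H := L2 d) J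
  refine ⟨J ∘L A, fun φ => ⟨?_, fun v hv => ?_⟩, fun R' hR' => ?_⟩
  · exact formGraph_memFormDomain (A φ).2
  · obtain ⟨w, hw, rfl⟩ := formGraph_lift hv
    have h := hA ⟨w, hw⟩ φ
    rw [Submodule.coe_inner, formGraph_inner hw (A φ).2] at h
    exact h
  · ext1 φ
    obtain ⟨hd, hR⟩ := hR' φ
    obtain ⟨w, hw, hwR⟩ := formGraph_lift hd
    have key : (⟨w, hw⟩ : formGraph U) = A φ := by
      refine ext_inner_left ℂ fun v => ?_
      rw [hA, Submodule.coe_inner, formGraph_inner v.2 hw, hwR]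
      exact hR _ (formGraph_memFormDomain v.2)
    rw [ContinuousLinearMap.comp_apply, ← key, hJ, ← hwR]

/-- The function `g(R)` of a bounded self-adjoint operator `R` on a Hilbert space, by the continuous
functional calculus. -/
def operatorFunction {H : Type*} [NormedAddCommGroup H] [InnerProductSpace ℂ H] [CompleteSpace H]
    (g : ℝ → ℝ) (R : H →L[ℂ] H) : H →L[ℂ] H :=
  cfc g R

/-- The resolvent `(H + 1)⁻¹` of `H = -2Δ + U`. -/
def schrodingerResolvent {d : ℕ} (U : Rd d → ℝ≥0∞) : L2 d →L[ℂ] L2 d :=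
  (existsUnique_isFormResolvent U).choose

/-- The function `g(H)` of the self-adjoint operator `H = -2Δ + U`, for `g` continuous on `[0, ∞)`
with limit `gInf` at `∞`. It is the continuous functional calculus of the bounded operator
`r = (H + 1)⁻¹`, as `H = r⁻¹ - 1`. On the orthogonal complement of the closure of the form domain,
where `H = ∞`, the operator is `gInf`. -/
def functionOfH {d : ℕ} (g : ℝ → ℝ) (gInf : ℝ) (U : Rd d → ℝ≥0∞) : L2 d →L[ℂ] L2 d :=
  operatorFunction (fun r : ℝ => if r = 0 then gInf else g (r⁻¹ - 1)) (schrodingerResolvent U)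

/-- The heat semigroup `exp(-β(-2Δ + U)) = exp(β(2Δ - U))`. -/
def heatSemigroup {d : ℕ} (U : Rd d → ℝ≥0∞) (β : ℝ) : L2 d →L[ℂ] L2 d :=
  functionOfH (fun t => Real.exp (-(β * t))) 0 U

/-- The operator `exp(2βΔ) - exp(β(2Δ - U))`. -/
def heatDifference {d : ℕ} (U : Rd d → ℝ≥0∞) (β : ℝ) : L2 d →L[ℂ] L2 d :=
  heatSemigroup 0 β - heatSemigroup U β

/-- `K` is the integral kernel of the operator `T` on `L²(ℝ^d)`: `(T φ)(x) = ∫ K(x, y) φ(y) dy`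
for every `φ ∈ L²(ℝ^d)` and almost every `x`, the integral being absolutely convergent. -/
def IsIntegralKernel {d : ℕ} (T : L2 d →L[ℂ] L2 d) (K : Rd d × Rd d → ℝ) : Prop :=
  AEStronglyMeasurable K (volume.prod volume) ∧
    ∀ φ : L2 d, ∀ᵐ x : Rd d, Integrable (fun y => (K (x, y) : ℂ) * φ y) ∧
      T φ x = ∫ y, (K (x, y) : ℂ) * φ y

/-- `a(β) = (8πβ)⁻¹ ∫ K(x, y) dx dy`. -/
def aBeta {d : ℕ} (β : ℝ) (K : Rd d × Rd d → ℝ) : ℝ :=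
  1 / (8 * Real.pi * β) * ∫ p, K p ∂(volume.prod volume)

/-- `f(t) = t (1 - e^{-t}) / (t - 1 + e^{-t})` for `t > 0`, extended continuously by `f(0) = 2`. -/
def fFun (t : ℝ) : ℝ :=
  if t = 0 then 2 else t * (1 - Real.exp (-t)) / (t - 1 + Real.exp (-t))

/-- The operator `f(β(-2Δ + U))`; note that `f(t) → 1` as `t → ∞`. -/
def fOperator {d : ℕ} (U : Rd d → ℝ≥0∞) (β : ℝ) : L2 d →L[ℂ] L2 d :=
  functionOfH (fun t => fFun (β * t)) 1 U

/-- The functional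
`E_β(ψ) = ∫ (2 |∇ψ|² + U |1 - ψ|²) dx + β⁻¹ ⟨ψ, f(β(-2Δ + U)) ψ⟩`, with values in `[0, ∞]`. -/
def energy {d : ℕ} (U : Rd d → ℝ≥0∞) (β : ℝ) (ψ : L2 d) : ℝ≥0∞ :=
  (∫⁻ x, (2 * ∑ i, ‖weakGradient ψ i x‖ₑ ^ 2 + U x * ‖1 - ψ x‖ₑ ^ 2))
    + ENNReal.ofReal (1 / β * (⟪ψ, fOperator U β ψ⟫_ℂ).re)

end

/-!
Write `H = -2Δ + U` and `H₀ = -2Δ`. Everything is derived from the bounded functional calculus of the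
resolvent `(H + 1)⁻¹`; no explicit heat kernel and no Feynman-Kac formula is used.

*Positivity.* For `u ∈ H¹` one has `|u| ∈ H¹` with `‖∂ᵢ|u|‖ ≤ ‖∂ᵢu‖`, by comparing difference quotients.
Testing the weak resolvent equation with `|u| - u` shows that `(H + l)⁻¹` preserves nonnegative
functions, and a similar test gives `(H + l)⁻¹ φ ≤ (H₀ + l)⁻¹ φ` for `φ ≥ 0`. As `exp (-βH)` is the
limit of `(1 + βH/n)⁻ⁿ`, both `exp (-βH)` and `exp (-βH₀) - exp (-βH)` preserve nonnegative
functions (`preservesNonneg_heatDifference`).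

*The kernel.* Powers of the free resolvent map `L²` to Sobolev spaces, hence to bounded functions, so
`exp (-βH₀)` maps `L²` to `L^∞`, and by positivity so does the difference. An operator from `L²` to
`L^∞` is `φ ↦ ⟪k x, φ⟫` for a measurable family `k x ∈ L²`, by the pointwise Bessel inequality, and
this gives a jointly measurable kernel (`exists_isIntegralKernel`). Any kernel of a positivity
preserving operator is nonnegative (`IsIntegralKernel.nonneg`).

*The minimum of the energy.* Let `P₀ t = exp (-βt)` and `P_{k+1} t = (P_k 0 - P_k t) / t`
(`expSlope`); then `f (βt) P₂ t = β P₁ t`. Let `χ` be a smooth cutoff equal to `1` on the support of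
`U`, and `g = 2Δχ`. The Euler-Lagrange equation of the energy is solved explicitly by
`ψ = χ + β⁻¹ (-P₁(H) χ + P₂(H) g)`, for which `f(βH) ψ = χ - exp (-βH) χ + P₁(H) g`, and completing
the square gives the minimum (`iInf_energy`).

*The integral of the kernel.* Let `φ_n` be the cutoff at scale `n`. Since `φ_n - χ` vanishes where `U`
does not, it is in the domain of `H`, and `exp (-βH₀) φ_n - exp (-βH) φ_n` equals `f(βH) ψ` plus a
boundary term supported, before functions of `H` are applied, at distance `n`. Away from the support
of `U` the operators `H` and `H₀` agree, so that identities like `P_k(H) v = P_k(0) v - P_{k+1}(H) H v`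
can be iterated; each step gains a factor `n⁻²`, which beats the growth `‖φ_n‖ ~ n^{d/2}`. The
quadratic form of the difference at `φ_n` therefore tends to `β` times the minimum of the energy
(`tendsto_inner_heatDifference`), and by Fatou's lemma it also tends to the integral of the
nonnegative kernel (`lintegral_kernel_eq`).
-/

noncomputable section

/-! ### The functional calculus of the Schrödinger operator -/

open Filter Topology Set

section operatorFunction

variable {H : Type*} [NormedAddCommGroup H] [InnerProductSpace ℂ H] [CompleteSpace H]
  {R : H →L[ℂ] H} {g k : ℝ → ℝ}

lemma operatorFunction_congr (h : EqOn g k (spectrum ℝ R)) :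
    operatorFunction g R = operatorFunction k R := cfc_congr h

lemma operatorFunction_mul (hg : ContinuousOn g (spectrum ℝ R))
    (hk : ContinuousOn k (spectrum ℝ R)) :
    operatorFunction (fun r => g r * k r) R = operatorFunction g R * operatorFunction k R :=
  cfc_mul g k R hg hk

lemma operatorFunction_add (hg : ContinuousOn g (spectrum ℝ R))
    (hk : ContinuousOn k (spectrum ℝ R)) :
    operatorFunction (fun r => g r + k r) R = operatorFunction g R + operatorFunction k R :=
  cfc_add R g k hg hk

lemma operatorFunction_sub (hg : ContinuousOn g (spectrum ℝ R))
    (hk : ContinuousOn k (spectrum ℝ R)) :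
    operatorFunction (fun r => g r - k r) R = operatorFunction g R - operatorFunction k R :=
  cfc_sub g k R hg hk

lemma operatorFunction_const (hR : IsSelfAdjoint R) (c : ℝ) :
    operatorFunction (fun _ => c) R = (c : ℂ) • 1 := by
  rw [operatorFunction, cfc_const c R hR, Algebra.algebraMap_eq_smul_one]
  ext φ
  simp

lemma operatorFunction_id (hR : IsSelfAdjoint R) : operatorFunction (fun r => r) R = R :=
  cfc_id' ℝ R hR

lemma operatorFunction_pow (hR : IsSelfAdjoint R) (hg : ContinuousOn g (spectrum ℝ R)) (n : ℕ) :
    operatorFunction (fun r => g r ^ n) R = operatorFunction g R ^ n :=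
  cfc_pow g n R hg hR

lemma operatorFunction_isSelfAdjoint (g : ℝ → ℝ) (R : H →L[ℂ] H) :
    IsSelfAdjoint (operatorFunction g R) := cfc_predicate g R

lemma operatorFunction_isPositive (hg : ∀ r ∈ spectrum ℝ R, 0 ≤ g r) :
    (operatorFunction g R).IsPositive :=
  (ContinuousLinearMap.nonneg_iff_isPositive _).1 (cfc_nonneg hg)

lemma tendsto_operatorFunction {G : ℕ → ℝ → ℝ}
    (h : TendstoUniformlyOn G g atTop (spectrum ℝ R))
    (hG : ∀ n, ContinuousOn (G n) (spectrum ℝ R)) :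
    Tendsto (fun n => operatorFunction (G n) R) atTop (𝓝 (operatorFunction g R)) :=
  tendsto_cfc_fun h (Eventually.of_forall hG)

lemma spectrum_subset_of_isPositive (hR : R.IsPositive) (h1 : ‖R‖ ≤ 1) :
    spectrum ℝ R ⊆ Icc 0 1 := by
  intro r hr
  refine ⟨spectrum_nonneg_of_nonneg ((ContinuousLinearMap.nonneg_iff_isPositive _).2 hR) hr, ?_⟩
  have h2 := (spectrum.norm_le_norm_mul_of_mem hr).trans
    (mul_le_of_le_one_right (norm_nonneg _) ContinuousLinearMap.norm_id_le)
  rw [Real.norm_eq_abs] at h2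
  exact (le_abs_self r).trans (h2.trans h1)

end operatorFunction

lemma schrodingerResolvent_spec {d : ℕ} (U : Rd d → ℝ≥0∞) :
    IsFormResolvent U (schrodingerResolvent U) :=
  (existsUnique_isFormResolvent U).choose_spec.1

/-- The form of `-2Δ + U` plus the inner product is definite, so that weak solutions of
`(-2Δ + U + 1) u = φ` are unique. -/
lemma eq_schrodingerResolvent {d : ℕ} {U : Rd d → ℝ≥0∞} {u φ : L2 d} (hu : MemFormDomain U u)
    (h : ∀ v : L2 d, MemFormDomain U v → schrodingerForm U v u + ⟪v, u⟫_ℂ = ⟪v, φ⟫_ℂ) :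
    u = schrodingerResolvent U φ := by
  obtain ⟨hd, hR⟩ := schrodingerResolvent_spec U φ
  obtain ⟨w, hw, rfl⟩ := formGraph_lift hu
  obtain ⟨w', hw', hww⟩ := formGraph_lift hd
  have key : (⟨w, hw⟩ : formGraph U) = ⟨w', hw'⟩ := by
    refine ext_inner_left ℂ fun v => ?_
    rw [Submodule.coe_inner, Submodule.coe_inner, formGraph_inner v.2 hw, formGraph_inner v.2 hw',
      h _ (formGraph_memFormDomain v.2), hww, hR _ (formGraph_memFormDomain v.2)]
  rw [← hww]
  exact congrArg (fun z : formGraph U => (z : FormSpace d U).fst) key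

/-- `⟪R φ, φ⟫` is the squared form norm of `R φ`, hence real and at least `‖R φ‖²`. -/
lemma inner_schrodingerResolvent {d : ℕ} (U : Rd d → ℝ≥0∞) (φ : L2 d) :
    ∃ r : ℝ, ‖schrodingerResolvent U φ‖ ^ 2 ≤ r ∧
      ⟪schrodingerResolvent U φ, φ⟫_ℂ = (r : ℂ) := by
  obtain ⟨hd, hR⟩ := schrodingerResolvent_spec U φ
  obtain ⟨w, hw, hww⟩ := formGraph_lift hd
  refine ⟨‖w‖ ^ 2, ?_, ?_⟩
  · have : ‖w.fst‖ ≤ ‖w‖ := WithLp.norm_fst_le _ w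
    rw [← hww]
    gcongr
  · rw [← hR _ hd, ← hww, ← formGraph_inner hw hw, inner_self_eq_norm_sq_to_K]
    norm_cast

lemma schrodingerResolvent_isPositive {d : ℕ} (U : Rd d → ℝ≥0∞) :
    (schrodingerResolvent U).IsPositive := by
  rw [ContinuousLinearMap.isPositive_iff_complex]
  intro φ
  obtain ⟨r, hr, h⟩ := inner_schrodingerResolvent U φ
  rw [h]
  exact ⟨by simp, by simpa using le_trans (sq_nonneg _) hr⟩

lemma schrodingerResolvent_isSelfAdjoint {d : ℕ} (U : Rd d → ℝ≥0∞) :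
    IsSelfAdjoint (schrodingerResolvent U) :=
  (schrodingerResolvent_isPositive U).isSelfAdjoint

lemma spectrum_schrodingerResolvent {d : ℕ} (U : Rd d → ℝ≥0∞) :
    spectrum ℝ (schrodingerResolvent U) ⊆ Icc 0 1 := by
  have h1 : ‖schrodingerResolvent U‖ ≤ 1 := by
    refine ContinuousLinearMap.opNorm_le_bound _ zero_le_one fun φ => ?_
    obtain ⟨r, hr, h⟩ := inner_schrodingerResolvent U φ
    have h2 := norm_inner_le_norm (𝕜 := ℂ) (schrodingerResolvent U φ) φ
    rw [h, Complex.norm_real, Real.norm_eq_abs] at h2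
    have h3 := hr.trans ((le_abs_self r).trans h2)
    rw [one_mul]
    by_contra! hlt
    have : 0 < ‖schrodingerResolvent U φ‖ := (norm_nonneg _).trans_lt hlt
    nlinarith
  exact spectrum_subset_of_isPositive (schrodingerResolvent_isPositive U) h1

/-- `g` is a continuous function on `[0, ∞]`, with value `gInf` at `∞`. -/
def IsSymbol (g : ℝ → ℝ) (gInf : ℝ) : Prop :=
  ContinuousOn g (Ici 0) ∧ Tendsto g atTop (𝓝 gInf)

/-- The symbol `g` as a function of `r = (t + 1)⁻¹ ∈ [0, 1]`. -/
def symbolPullback (g : ℝ → ℝ) (gInf : ℝ) (r : ℝ) : ℝ := if r = 0 then gInf else g (r⁻¹ - 1)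

lemma functionOfH_eq {d : ℕ} (g : ℝ → ℝ) (gInf : ℝ) (U : Rd d → ℝ≥0∞) :
    functionOfH g gInf U
      = operatorFunction (symbolPullback g gInf) (schrodingerResolvent U) := rfl

namespace IsSymbol

variable {g k : ℝ → ℝ} {gInf kInf : ℝ}

lemma continuousOn (hg : IsSymbol g gInf) : ContinuousOn (symbolPullback g gInf) (Icc 0 1) := by
  intro r hr
  have hmap : MapsTo (fun r : ℝ => r⁻¹ - 1) (Icc 0 1 \ {0}) (Ici 0) := by
    intro x hx
    have : 0 < x := lt_of_le_of_ne hx.1.1 (Ne.symm hx.2)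
    simpa using (one_le_inv₀ this).2 hx.1.2
  by_cases h0 : r = 0
  · subst h0
    rw [← continuousWithinAt_sdiff_self]
    have h1 : Tendsto (fun r : ℝ => r⁻¹ - 1) (𝓝[Icc 0 1 \ {0}] 0) atTop := by
      refine tendsto_atTop_add_const_right _ _ (tendsto_inv_nhdsGT_zero.mono_left ?_)
      exact nhdsWithin_mono _ fun x hx => lt_of_le_of_ne hx.1.1 (Ne.symm hx.2)
    have h2 : Tendsto (symbolPullback g gInf) (𝓝[Icc 0 1 \ {0}] 0) (𝓝 gInf) := by
      refine (hg.2.comp h1).congr' ?_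
      filter_upwards [self_mem_nhdsWithin] with x hx
      exact (if_neg hx.2).symm
    simpa [ContinuousWithinAt, symbolPullback] using h2
  · have h1 : ContinuousWithinAt (fun r => g (r⁻¹ - 1)) (Icc 0 1 \ {0}) r := by
      refine ContinuousWithinAt.comp (t := Ici 0) (hg.1 _ (hmap ⟨hr, h0⟩)) ?_ hmap
      exact ((continuousAt_inv₀ h0).sub continuousAt_const).continuousWithinAt
    have h2 : ContinuousWithinAt (symbolPullback g gInf) (Icc 0 1 \ {0}) r := by
      refine h1.congr (fun x hx => if_neg hx.2) (if_neg h0)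
    refine h2.mono_of_mem_nhdsWithin ?_
    exact inter_mem self_mem_nhdsWithin
      (mem_nhdsWithin_of_mem_nhds (isOpen_compl_singleton.mem_nhds h0))

lemma continuousOn_spectrum {d : ℕ} (hg : IsSymbol g gInf) (U : Rd d → ℝ≥0∞) :
    ContinuousOn (symbolPullback g gInf) (spectrum ℝ (schrodingerResolvent U)) :=
  hg.continuousOn.mono (spectrum_schrodingerResolvent U)

lemma const (c : ℝ) : IsSymbol (fun _ => c) c := ⟨continuousOn_const, tendsto_const_nhds⟩

lemma mul (hg : IsSymbol g gInf) (hk : IsSymbol k kInf) :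
    IsSymbol (fun t => g t * k t) (gInf * kInf) := ⟨hg.1.mul hk.1, hg.2.mul hk.2⟩

lemma sub (hg : IsSymbol g gInf) (hk : IsSymbol k kInf) :
    IsSymbol (fun t => g t - k t) (gInf - kInf) := ⟨hg.1.sub hk.1, hg.2.sub hk.2⟩

lemma add (hg : IsSymbol g gInf) (hk : IsSymbol k kInf) :
    IsSymbol (fun t => g t + k t) (gInf + kInf) := ⟨hg.1.add hk.1, hg.2.add hk.2⟩

lemma inv_one_add : IsSymbol (fun t => (1 + t)⁻¹) 0 :=
  ⟨(continuousOn_const.add continuousOn_id).inv₀ fun t (ht : 0 ≤ t) => by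
      have : 0 < 1 + t := by positivity
      exact this.ne',
    (tendsto_atTop_add_const_left _ _ tendsto_id).inv_tendsto_atTop⟩

end IsSymbol

section functionOfH

variable {d : ℕ} {U : Rd d → ℝ≥0∞} {g k : ℝ → ℝ} {gInf kInf : ℝ}

lemma functionOfH_congr (h : ∀ t, 0 ≤ t → g t = k t) :
    functionOfH g gInf U = functionOfH k gInf U := by
  refine operatorFunction_congr fun r hr => ?_
  have hr' := spectrum_schrodingerResolvent U hr
  by_cases h0 : r = 0
  · simp [h0]
  · have : 0 < r := lt_of_le_of_ne hr'.1 (Ne.symm h0)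
    simp only [h0, if_false]
    exact h _ (by simpa using (one_le_inv₀ this).2 hr'.2)

lemma functionOfH_mul (hg : IsSymbol g gInf) (hk : IsSymbol k kInf) :
    functionOfH (fun t => g t * k t) (gInf * kInf) U
      = functionOfH g gInf U * functionOfH k kInf U := by
  simp only [functionOfH_eq]
  rw [← operatorFunction_mul (hg.continuousOn_spectrum U) (hk.continuousOn_spectrum U)]
  refine operatorFunction_congr fun r _ => ?_
  simp only [symbolPullback]
  split_ifs <;> rfl

lemma functionOfH_add (hg : IsSymbol g gInf) (hk : IsSymbol k kInf) :
    functionOfH (fun t => g t + k t) (gInf + kInf) U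
      = functionOfH g gInf U + functionOfH k kInf U := by
  simp only [functionOfH_eq]
  rw [← operatorFunction_add (hg.continuousOn_spectrum U) (hk.continuousOn_spectrum U)]
  refine operatorFunction_congr fun r _ => ?_
  simp only [symbolPullback]
  split_ifs <;> rfl

lemma functionOfH_sub (hg : IsSymbol g gInf) (hk : IsSymbol k kInf) :
    functionOfH (fun t => g t - k t) (gInf - kInf) U
      = functionOfH g gInf U - functionOfH k kInf U := by
  simp only [functionOfH_eq]
  rw [← operatorFunction_sub (hg.continuousOn_spectrum U) (hk.continuousOn_spectrum U)]
  refine operatorFunction_congr fun r _ => ?_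
  simp only [symbolPullback]
  split_ifs <;> rfl

lemma functionOfH_const (c : ℝ) : functionOfH (fun _ => c) c U = (c : ℂ) • 1 := by
  rw [← operatorFunction_const (schrodingerResolvent_isSelfAdjoint U)]
  exact operatorFunction_congr fun r _ => by simp

lemma functionOfH_inv_one_add :
    functionOfH (fun t => (1 + t)⁻¹) 0 U = schrodingerResolvent U := by
  refine Eq.trans (operatorFunction_congr fun r _ => ?_)
    (operatorFunction_id (schrodingerResolvent_isSelfAdjoint U))
  by_cases h0 : r = 0 <;> simp [h0]

lemma functionOfH_pow (hg : IsSymbol g gInf) (n : ℕ) :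
    functionOfH (fun t => g t ^ n) (gInf ^ n) U = functionOfH g gInf U ^ n := by
  simp only [functionOfH_eq]
  rw [← operatorFunction_pow (schrodingerResolvent_isSelfAdjoint U) (hg.continuousOn_spectrum U)]
  refine operatorFunction_congr fun r _ => ?_
  simp only [symbolPullback]
  split_ifs <;> rfl

lemma functionOfH_isSelfAdjoint (g : ℝ → ℝ) (gInf : ℝ) (U : Rd d → ℝ≥0∞) :
    IsSelfAdjoint (functionOfH g gInf U) := operatorFunction_isSelfAdjoint _ _

lemma functionOfH_inner (g : ℝ → ℝ) (gInf : ℝ) (U : Rd d → ℝ≥0∞) (x y : L2 d) :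
    ⟪functionOfH g gInf U x, y⟫_ℂ = ⟪x, functionOfH g gInf U y⟫_ℂ :=
  (functionOfH_isSelfAdjoint g gInf U).isSymmetric x y

lemma functionOfH_nonneg (hg : ∀ t, 0 ≤ t → 0 ≤ g t) (h0 : 0 ≤ gInf) (x : L2 d) :
    0 ≤ (⟪x, functionOfH g gInf U x⟫_ℂ).re := by
  have h : (functionOfH g gInf U).IsPositive := by
    refine operatorFunction_isPositive fun r hr => ?_
    have hr' := spectrum_schrodingerResolvent U hr
    by_cases h0' : r = 0
    · simpa [h0'] using h0
    · have : 0 < r := lt_of_le_of_ne hr'.1 (Ne.symm h0')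
      simp only [h0', if_false]
      exact hg _ (by simpa using (one_le_inv₀ this).2 hr'.2)
  exact h.re_inner_nonneg_right x

/-- `κ` lies in the domain of `H = -2Δ + U`, and `H κ = ζ`. -/
def IsHamiltonian (U : Rd d → ℝ≥0∞) (κ ζ : L2 d) : Prop := κ = schrodingerResolvent U (κ + ζ)

/-- If `h(t) = c + t k(t)` then `h(H) κ = c κ + k(H) H κ`. -/
lemma functionOfH_apply_of_isHamiltonian {h : ℝ → ℝ} {hInf c : ℝ} (hh : IsSymbol h hInf)
    (hk : IsSymbol k 0) (hhk : ∀ t, 0 ≤ t → h t = c + t * k t) {κ ζ : L2 d}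
    (hκ : IsHamiltonian U κ ζ) :
    functionOfH h hInf U κ = (c : ℂ) • κ + functionOfH k 0 U ζ := by
  have hi := IsSymbol.inv_one_add
  have key : functionOfH h hInf U * schrodingerResolvent U
      = functionOfH (fun _ => c) c U * schrodingerResolvent U + functionOfH k 0 U
        - functionOfH k 0 U * schrodingerResolvent U := by
    rw [← functionOfH_inv_one_add, ← functionOfH_mul hh hi, ← functionOfH_mul (.const c) hi,
      ← functionOfH_mul hk hi, ← functionOfH_add ((IsSymbol.const c).mul hi) hk,
      ← functionOfH_sub (((IsSymbol.const c).mul hi).add hk) (hk.mul hi)]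
    simp only [mul_zero, add_zero, sub_zero]
    refine functionOfH_congr fun t ht => ?_
    have : 1 + t ≠ 0 := by positivity
    rw [hhk t ht]
    field_simp
    ring
  have h1 : schrodingerResolvent U (κ + ζ) = κ := Eq.symm hκ
  have h2 : functionOfH h hInf U (schrodingerResolvent U (κ + ζ))
      = functionOfH (fun _ => c) c U (schrodingerResolvent U (κ + ζ))
        + functionOfH k 0 U (κ + ζ) - functionOfH k 0 U (schrodingerResolvent U (κ + ζ)) :=
    congrArg (fun T : L2 d →L[ℂ] L2 d => T (κ + ζ)) key
  rw [h1, map_add, functionOfH_const] at h2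
  rw [h2, add_sub_assoc, add_sub_cancel_left]
  rfl

/-- `h(H) φ` lies in the domain of `H` if `t h(t)` is bounded at infinity. -/
lemma isHamiltonian_functionOfH {h k : ℝ → ℝ} {kInf : ℝ} (hh : IsSymbol h 0)
    (hk : IsSymbol k kInf) (hhk : ∀ t, 0 ≤ t → k t = t * h t) (φ : L2 d) :
    IsHamiltonian U (functionOfH h 0 U φ) (functionOfH k kInf U φ) := by
  have hi := IsSymbol.inv_one_add
  have key : functionOfH h 0 U
      = schrodingerResolvent U * (functionOfH h 0 U + functionOfH k kInf U) := by
    rw [← functionOfH_inv_one_add, ← functionOfH_add hh hk, ← functionOfH_mul hi (hh.add hk)]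
    simp only [zero_mul]
    refine functionOfH_congr fun t ht => ?_
    have : 1 + t ≠ 0 := by positivity
    rw [hhk t ht]
    field_simp
  exact congrArg (fun T : L2 d →L[ℂ] L2 d => T φ) key

lemma IsHamiltonian.add {κ ζ κ' ζ' : L2 d} (h : IsHamiltonian U κ ζ)
    (h' : IsHamiltonian U κ' ζ') : IsHamiltonian U (κ + κ') (ζ + ζ') := by
  rw [IsHamiltonian, add_add_add_comm, map_add, ← show κ = _ from h, ← show κ' = _ from h']

lemma IsHamiltonian.smul {κ ζ : L2 d} (h : IsHamiltonian U κ ζ) (c : ℂ) :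
    IsHamiltonian U (c • κ) (c • ζ) := by
  rw [IsHamiltonian, ← smul_add, map_smul, ← show κ = _ from h]

lemma IsHamiltonian.memFormDomain {κ ζ : L2 d} (h : IsHamiltonian U κ ζ) : MemFormDomain U κ := by
  rw [show κ = _ from h]
  exact (schrodingerResolvent_spec U _).1

lemma IsHamiltonian.form_eq {κ ζ : L2 d} (h : IsHamiltonian U κ ζ) {v : L2 d}
    (hv : MemFormDomain U v) : schrodingerForm U v κ = ⟪v, ζ⟫_ℂ := by
  have := (schrodingerResolvent_spec U (κ + ζ)).2 v hv
  rw [← show κ = _ from h, inner_add_right, add_comm] at this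
  exact add_left_cancel this

lemma isHamiltonian_of_form {κ ζ : L2 d} (hκ : MemFormDomain U κ)
    (h : ∀ v, MemFormDomain U v → schrodingerForm U v κ = ⟪v, ζ⟫_ℂ) : IsHamiltonian U κ ζ := by
  refine eq_schrodingerResolvent hκ fun v hv => ?_
  rw [h v hv, inner_add_right, add_comm]

end functionOfH

/-! ### Iterated slopes of the exponential -/

/-- The remainders of the Taylor expansion of `e^{-βt}` at `0`: `P 0 t = e^{-βt}` and
`P (k+1) t = (P k 0 - P k t) / t`, extended continuously to `t = 0`. -/
def expSlope (β : ℝ) : ℕ → ℝ → ℝ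
  | 0 => fun t => Real.exp (-(β * t))
  | k + 1 => fun t => -dslope (expSlope β k) 0 t

lemma expSlope_succ (β : ℝ) (k : ℕ) (t : ℝ) :
    expSlope β k t = expSlope β k 0 + t * -expSlope β (k + 1) t := by
  have h := sub_smul_dslope (expSlope β k) 0 t
  simp only [sub_zero, smul_eq_mul] at h
  simp only [expSlope, neg_neg, h]
  ring

lemma analyticAt_expSlope (β : ℝ) (k : ℕ) : AnalyticAt ℝ (expSlope β k) 0 := by
  induction k with
  | zero => simp only [expSlope]; fun_prop
  | succ k ih =>
    obtain ⟨p, hp⟩ := ih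
    have : AnalyticAt ℝ (dslope (expSlope β k) 0) 0 := ⟨_, hp.has_fpower_series_dslope_fslope⟩
    exact this.neg

lemma continuous_expSlope (β : ℝ) (k : ℕ) : Continuous (expSlope β k) := by
  induction k with
  | zero => simp only [expSlope]; fun_prop
  | succ k ih =>
    have h : ContinuousOn (dslope (expSlope β k) 0) univ :=
      (continuousOn_dslope univ_mem).2
        ⟨ih.continuousOn, (analyticAt_expSlope β k).differentiableAt⟩
    exact (continuousOn_univ.1 h).neg

lemma expSlope_of_ne (β : ℝ) (k : ℕ) {t : ℝ} (ht : t ≠ 0) :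
    expSlope β (k + 1) t = (expSlope β k 0 - expSlope β k t) / t := by
  have := expSlope_succ β k t
  field_simp
  linarith

lemma tendsto_expSlope {β : ℝ} (hβ : 0 < β) (k : ℕ) :
    Tendsto (expSlope β k) atTop (𝓝 0) := by
  induction k with
  | zero =>
    exact Real.tendsto_exp_atBot.comp
      (tendsto_neg_atTop_atBot.comp (tendsto_id.const_mul_atTop hβ))
  | succ k ih =>
    have h := (tendsto_const_nhds.sub ih (a := expSlope β k 0)).mul tendsto_inv_atTop_zero
    rw [mul_zero] at h
    refine h.congr' ?_
    filter_upwards [eventually_gt_atTop 0] with t ht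
    rw [expSlope_of_ne β k ht.ne', div_eq_mul_inv]

lemma isSymbol_expSlope {β : ℝ} (hβ : 0 < β) (k : ℕ) : IsSymbol (expSlope β k) 0 :=
  ⟨(continuous_expSlope β k).continuousOn, tendsto_expSlope hβ k⟩

lemma expSlope_zero_zero (β : ℝ) : expSlope β 0 0 = 1 := by simp [expSlope]

lemma expSlope_one_zero (β : ℝ) : expSlope β 1 0 = β := by
  have h : HasDerivAt (fun t : ℝ => Real.exp (-(β * t))) (Real.exp (-(β * 0)) * -(β * 1)) 0 :=
    (((hasDerivAt_id 0).const_mul β).neg).exp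
  simp [expSlope, dslope_same, h.deriv]

lemma expSlope_one (β t : ℝ) : t * expSlope β 1 t = 1 - Real.exp (-(β * t)) := by
  have := expSlope_succ β 0 t
  rw [expSlope_zero_zero] at this
  simp only [expSlope] at this ⊢
  linarith

lemma expSlope_two (β t : ℝ) : t * expSlope β 2 t = β - expSlope β 1 t := by
  have := expSlope_succ β 1 t
  rw [expSlope_one_zero] at this
  linarith

lemma sq_mul_expSlope_two (β t : ℝ) :
    t ^ 2 * expSlope β 2 t = β * t - 1 + Real.exp (-(β * t)) := by
  linear_combination t * expSlope_two β t - expSlope_one β t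

lemma expSlope_two_zero (β : ℝ) : expSlope β 2 0 = β ^ 2 / 2 := by
  have h1 : Tendsto (expSlope β 2) (𝓝[≠] 0) (𝓝 (expSlope β 2 0)) :=
    ((continuous_expSlope β 2).tendsto 0).mono_left nhdsWithin_le_nhds
  have h2 : Tendsto (expSlope β 2) (𝓝[≠] 0) (𝓝 (β ^ 2 / 2)) := by
    rw [tendsto_iff_norm_sub_tendsto_zero]
    have h3 : Tendsto (fun t : ℝ => |β| ^ 3 * |t|) (𝓝[≠] 0) (𝓝 0) := by
      have : Continuous fun t : ℝ => |β| ^ 3 * |t| := by fun_prop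
      simpa using (this.tendsto 0).mono_left nhdsWithin_le_nhds
    have h4 : ∀ᶠ t : ℝ in 𝓝[≠] 0, |-(β * t)| ≤ 1 := by
      have : Continuous fun t : ℝ => |-(β * t)| := by fun_prop
      have h := ((this.tendsto 0).mono_left (nhdsWithin_le_nhds (s := {0}ᶜ)))
      exact h.eventually_le_const (by simp)
    refine squeeze_zero' (Eventually.of_forall fun _ => norm_nonneg _) ?_ h3
    filter_upwards [h4, self_mem_nhdsWithin] with t ht ht0
    have ht0' : t ≠ 0 := ht0
    have h5 := Real.exp_bound ht (n := 3) (by norm_num)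
    have h6 : expSlope β 2 t - β ^ 2 / 2
        = (Real.exp (-(β * t)) - ∑ m ∈ Finset.range 3, (-(β * t)) ^ m / m.factorial) / t ^ 2 := by
      rw [eq_div_iff (by positivity)]
      simp only [Finset.sum_range_succ, Finset.sum_range_zero, Nat.factorial]
      push_cast
      linear_combination sq_mul_expSlope_two β t
    rw [h6, norm_div, Real.norm_eq_abs, Real.norm_eq_abs, abs_of_nonneg (sq_nonneg t),
      div_le_iff₀ (by positivity)]
    refine h5.trans ?_
    have h7 : |-(β * t)| ^ 3 = |β| ^ 3 * |t| * t ^ 2 := by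
      rw [abs_neg, abs_mul, mul_pow, pow_succ |t| 2, sq_abs]; ring
    rw [h7]
    refine mul_le_of_le_one_right (by positivity) ?_
    norm_num [Nat.factorial]
  exact tendsto_nhds_unique h1 h2

lemma expSlope_two_pos {β : ℝ} (hβ : 0 < β) {t : ℝ} (ht : 0 ≤ t) : 0 < expSlope β 2 t := by
  rcases ht.eq_or_lt with rfl | ht
  · rw [expSlope_two_zero]; positivity
  · have h1 := Real.add_one_lt_exp (x := -(β * t)) (by simp [hβ.ne', ht.ne'])
    have h2 := sq_mul_expSlope_two β t
    have h3 : 0 < t ^ 2 * expSlope β 2 t := by linarith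
    exact pos_of_mul_pos_right h3 (by positivity)

lemma expSlope_one_nonneg {β : ℝ} (hβ : 0 < β) {t : ℝ} (ht : 0 ≤ t) : 0 ≤ expSlope β 1 t := by
  rcases ht.eq_or_lt with rfl | ht
  · rw [expSlope_one_zero]; exact hβ.le
  · have h1 : Real.exp (-(β * t)) ≤ 1 := Real.exp_le_one_iff.2 (by
      have := mul_pos hβ ht; linarith)
    have h2 := expSlope_one β t
    have h3 : 0 ≤ t * expSlope β 1 t := by linarith
    exact nonneg_of_mul_nonneg_right h3 ht

lemma fFun_mul_expSlope_two {β : ℝ} (hβ : 0 < β) {t : ℝ} (ht : 0 ≤ t) :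
    fFun (β * t) * expSlope β 2 t = β * expSlope β 1 t := by
  rcases ht.eq_or_lt with rfl | ht
  · rw [expSlope_two_zero, expSlope_one_zero]
    simp [fFun]
    ring
  · have h2 := expSlope_two_pos hβ ht.le
    have hd : β * t - 1 + Real.exp (-(β * t)) ≠ 0 := by
      rw [← sq_mul_expSlope_two]; positivity
    rw [fFun, if_neg (by positivity), div_mul_eq_mul_div, div_eq_iff hd, ← sq_mul_expSlope_two,
      ← expSlope_one]
    ring

lemma fFun_eq {β : ℝ} (hβ : 0 < β) {t : ℝ} (ht : 0 ≤ t) :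
    fFun (β * t) = β * expSlope β 1 t / expSlope β 2 t := by
  rw [eq_div_iff (expSlope_two_pos hβ ht).ne', fFun_mul_expSlope_two hβ ht]

lemma fFun_nonneg {β : ℝ} (hβ : 0 < β) {t : ℝ} (ht : 0 ≤ t) : 0 ≤ fFun (β * t) := by
  rw [fFun_eq hβ ht]
  have := expSlope_one_nonneg hβ ht
  have := expSlope_two_pos hβ ht
  positivity

lemma isSymbol_fFun {β : ℝ} (hβ : 0 < β) : IsSymbol (fun t => fFun (β * t)) 1 := by
  constructor
  · refine ContinuousOn.congr (f := fun t => β * expSlope β 1 t / expSlope β 2 t) ?_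
      fun t ht => fFun_eq hβ ht
    exact ((continuous_expSlope β 1).const_mul β |>.continuousOn).div
      (continuous_expSlope β 2).continuousOn fun t ht => (expSlope_two_pos hβ ht).ne'
  · have h0 := tendsto_expSlope hβ 0
    have h1 := tendsto_expSlope hβ 1
    have h := ((h0.const_sub 1).const_mul β).div (h1.const_sub β) (by simpa using hβ.ne')
    rw [sub_zero, sub_zero, mul_one, div_self hβ.ne'] at h
    refine h.congr' ?_
    filter_upwards [eventually_gt_atTop 0] with t ht
    simp only [Pi.div_apply]
    rw [fFun_eq hβ ht.le, ← expSlope_two, expSlope, ← expSlope_one, mul_left_comm,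
      mul_div_mul_left _ _ ht.ne']

/-! ### Difference quotients and weak gradients -/

lemma norm_star_L2 {d : ℕ} (u : L2 d) : ‖star u‖ = ‖u‖ := by
  rw [Lp.norm_def, Lp.norm_def]
  congr 1
  refine eLpNorm_congr_norm_ae ?_
  filter_upwards [Lp.coeFn_star u] with x h1
  simp [h1]

/-- The pairing of `u ∈ L²` with a Schwartz function, as an inner product. -/
lemma toTempered_apply_eq_inner {d : ℕ} (u : L2 d) (ψ : 𝓢(Rd d, ℂ)) :
    (u : 𝓢'(Rd d, ℂ)) ψ = ⟪star u, ψ.toLp 2⟫_ℂ := by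
  rw [Lp.toTemperedDistribution_apply, L2.inner_def]
  refine integral_congr_ae ?_
  filter_upwards [Lp.coeFn_star u, ψ.coeFn_toLp 2] with x h1 h2
  simp [h1, h2]

lemma norm_toTempered_apply_le {d : ℕ} (u : L2 d) (ψ : 𝓢(Rd d, ℂ)) :
    ‖(u : 𝓢'(Rd d, ℂ)) ψ‖ ≤ ‖u‖ * ‖ψ.toLp 2‖ := by
  rw [toTempered_apply_eq_inner, ← norm_star_L2 u]
  exact norm_inner_le_norm _ _

lemma denseRange_schwartz (d : ℕ) :
    DenseRange (fun ψ : 𝓢(Rd d, ℂ) => (ψ.toLp 2 : L2 d)) :=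
  SchwartzMap.denseRange_toLpCLM (F := ℂ) (μ := (volume : Measure (Rd d))) (p := 2)
      ENNReal.ofNat_ne_top

/-- The `L²` norm is the dual norm on Schwartz functions. -/
lemma norm_le_of_toTempered {d : ℕ} {u : L2 d} {C : ℝ} (hC : 0 ≤ C)
    (h : ∀ ψ : 𝓢(Rd d, ℂ), ‖(u : 𝓢'(Rd d, ℂ)) ψ‖ ≤ C * ‖ψ.toLp 2‖) : ‖u‖ ≤ C := by
  have key : ∀ φ : L2 d, ‖⟪star u, φ⟫_ℂ‖ ≤ C * ‖φ‖ := fun φ =>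
    (denseRange_schwartz d).induction_on (p := fun φ : L2 d => ‖⟪star u, φ⟫_ℂ‖ ≤ C * ‖φ‖) φ
      (isClosed_le (by fun_prop) (by fun_prop))
      fun ψ => by rw [← toTempered_apply_eq_inner]; exact h ψ
  have h1 := key (star u)
  rw [inner_self_eq_norm_sq_to_K, norm_star_L2] at h1
  norm_cast at h1
  rw [abs_of_nonneg (by positivity)] at h1
  by_contra! hlt
  have := hC.trans_lt hlt
  nlinarith

/-- A Schwartz function and its shifts by vectors of bounded length have a common `L²` bound. -/
lemma exists_shift_bound {d : ℕ} (ψ : 𝓢(Rd d, ℂ)) (r : ℝ) :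
    ∃ b : Rd d → ℝ, MemLp b 2 ∧ ∀ x a : Rd d, ‖a‖ ≤ r → ‖ψ (x - a)‖ ≤ b x := by
  obtain ⟨C, hC⟩ : ∃ C : ℝ, ∀ x, (1 + ‖x‖) ^ (d + 1) * ‖ψ x‖ ≤ C := by
    refine ⟨2 ^ (d + 1) * (Finset.Iic ((d + 1, 0) : ℕ × ℕ)).sup
      (fun m => SchwartzMap.seminorm ℂ m.1 m.2) ψ, fun x => ?_⟩
    have := SchwartzMap.one_add_le_sup_seminorm_apply (𝕜 := ℂ) (m := (d + 1, 0)) le_rfl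
      (le_refl 0) ψ x
    rwa [norm_iteratedFDeriv_zero] at this
  refine ⟨fun x => C * (1 + r) ^ (d + 1) * ((1 + ‖x‖) ^ (d + 1))⁻¹, ?_, fun x a ha => ?_⟩
  · refine MemLp.const_mul ?_ _
    have hm : AEStronglyMeasurable (fun x : Rd d => ((1 + ‖x‖) ^ (d + 1))⁻¹) volume := by
      apply Measurable.aestronglyMeasurable
      fun_prop
    rw [memLp_two_iff_integrable_sq hm]
    have h := integrable_one_add_norm (E := Rd d) (μ := volume) (r := ((2 * (d + 1) : ℕ) : ℝ))
      (by simp only [finrank_euclideanSpace, Fintype.card_fin]; norm_cast; omega)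
    refine h.congr (Eventually.of_forall fun x => ?_)
    simp only
    rw [Real.rpow_neg (by positivity), Real.rpow_natCast, inv_pow, ← pow_mul, mul_comm 2]
  · have hr : 0 ≤ r := (norm_nonneg a).trans ha
    have h1 : 1 + ‖x‖ ≤ (1 + r) * (1 + ‖x - a‖) := by
      have : ‖x‖ ≤ ‖x - a‖ + ‖a‖ := by simpa using norm_add_le (x - a) a
      nlinarith [mul_nonneg hr (norm_nonneg (x - a))]
    change _ ≤ _ * (_)⁻¹
    rw [← div_eq_mul_inv, le_div_iff₀ (by positivity)]
    calc ‖ψ (x - a)‖ * (1 + ‖x‖) ^ (d + 1)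
        ≤ ‖ψ (x - a)‖ * ((1 + r) * (1 + ‖x - a‖)) ^ (d + 1) := by gcongr
      _ = (1 + ‖x - a‖) ^ (d + 1) * ‖ψ (x - a)‖ * (1 + r) ^ (d + 1) := by rw [mul_pow]; ring
      _ ≤ C * (1 + r) ^ (d + 1) := by gcongr; exact hC _

/-- The pairing of `u ∈ L²` with the shifts of a Schwartz function is differentiable. -/
lemma hasDerivAt_toTempered_shift {d : ℕ} (u : L2 d) (ψ : 𝓢(Rd d, ℂ)) (e : Rd d) :
    HasDerivAt (fun t : ℝ => (u : 𝓢'(Rd d, ℂ)) (ψ.compSubConstCLM ℂ (t • e)))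
      ((u : 𝓢'(Rd d, ℂ)) (-∂_{e} ψ)) 0 := by
  obtain ⟨b, hb, hbb⟩ := exists_shift_bound (∂_{e} ψ) ‖e‖
  simp only [Lp.toTemperedDistribution_apply, SchwartzMap.compSubConstCLM_apply]
  have hm : ∀ (ψ : 𝓢(Rd d, ℂ)) (a : Rd d),
      AEStronglyMeasurable (fun x => ψ (x - a) • u x) volume := fun ψ a =>
    ((ψ.continuous.comp (continuous_id.sub continuous_const)).aestronglyMeasurable).smul
      (Lp.aestronglyMeasurable u)
  have := (hasDerivAt_integral_of_dominated_loc_of_deriv_le (𝕜 := ℝ) (μ := volume)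
    (F := fun (t : ℝ) x => ψ (x - t • e) • u x) (x₀ := 0)
    (F' := fun (t : ℝ) x => (-∂_{e} ψ (x - t • e)) • u x) (s := Metric.ball 0 1)
    (bound := fun x => b x * ‖u x‖)
    (Metric.ball_mem_nhds _ one_pos) (Eventually.of_forall fun t => hm ψ _) ?_ ?_ ?_ ?_ ?_).2
  · simpa using this
  · have h1 : Integrable (fun x => ψ x * u x) := (ψ.memLp 2).integrable_mul (Lp.memLp u)
    simpa using h1
  · simp only [neg_smul]
    exact (hm _ _).neg
  · refine Eventually.of_forall fun x t ht => ?_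
    rw [norm_smul, norm_neg]
    gcongr
    refine hbb _ _ ?_
    rw [norm_smul]
    refine mul_le_of_le_one_left (norm_nonneg _) ?_
    simpa using (mem_ball_zero_iff.1 ht).le
  · exact hb.integrable_mul (Lp.memLp u).norm
  · refine Eventually.of_forall fun x t ht => ?_
    have h1 : HasDerivAt (fun t : ℝ => x - t • e) (-e) t := by
      simpa using ((hasDerivAt_id t).smul_const e).const_sub x
    have h2 := (ψ.hasFDerivAt (x - t • e)).comp_hasDerivAt t h1
    have h3 := h2.smul_const (u x)
    simpa [SchwartzMap.lineDerivOp_apply_eq_fderiv] using h3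

/-- The translate `x ↦ u (x + h)` of `u ∈ L²`. -/
def translateL2 {d : ℕ} (h : Rd d) (u : L2 d) : L2 d :=
  Lp.compMeasurePreserving (· + h) (measurePreserving_add_right volume h) u

lemma coeFn_translateL2 {d : ℕ} (h : Rd d) (u : L2 d) :
    translateL2 h u =ᵐ[volume] fun x => u (x + h) :=
  Lp.coeFn_compMeasurePreserving u _

lemma translateL2_toTempered {d : ℕ} (h : Rd d) (u : L2 d) (ψ : 𝓢(Rd d, ℂ)) :
    (translateL2 h u : 𝓢'(Rd d, ℂ)) ψ = (u : 𝓢'(Rd d, ℂ)) (ψ.compSubConstCLM ℂ h) := by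
  simp only [Lp.toTemperedDistribution_apply, SchwartzMap.compSubConstCLM_apply]
  rw [← integral_add_right_eq_self (fun x => ψ (x - h) • u x) h]
  refine integral_congr_ae ?_
  filter_upwards [coeFn_translateL2 h u] with x hx
  simp [hx]

lemma toTempered_sub_apply {d : ℕ} (u v : L2 d) (ψ : 𝓢(Rd d, ℂ)) :
    ((u - v : L2 d) : 𝓢'(Rd d, ℂ)) ψ = (u : 𝓢'(Rd d, ℂ)) ψ - (v : 𝓢'(Rd d, ℂ)) ψ := by
  have := (Lp.toTemperedDistributionCLM ℂ (volume : Measure (Rd d)) 2).map_sub u v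
  exact congrArg (fun T : 𝓢'(Rd d, ℂ) => T ψ) this

lemma norm_toLp_shift {d : ℕ} (ψ : 𝓢(Rd d, ℂ)) (a : Rd d) :
    ‖(ψ.compSubConstCLM ℂ a).toLp 2‖ = ‖(ψ.toLp 2 : L2 d)‖ := by
  rw [SchwartzMap.norm_toLp, SchwartzMap.norm_toLp]
  congr 1
  exact eLpNorm_comp_measurePreserving (ψ.continuous.aestronglyMeasurable)
    (measurePreserving_sub_right volume a)

/-- If `∂_e u = g ∈ L²` then the translates of `u` along `e` are Lipschitz. -/
lemma norm_translateL2_sub_le {d : ℕ} {u g : L2 d} {e : Rd d}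
    (h : ∂_{e} (u : 𝓢'(Rd d, ℂ)) = (g : 𝓢'(Rd d, ℂ))) (t : ℝ) :
    ‖translateL2 (t • e) u - u‖ ≤ ‖g‖ * |t| := by
  refine norm_le_of_toTempered (by positivity) fun ψ => ?_
  have hd : ∀ s : ℝ, HasDerivAt (fun t : ℝ => (u : 𝓢'(Rd d, ℂ)) (ψ.compSubConstCLM ℂ (t • e)))
      ((g : 𝓢'(Rd d, ℂ)) (ψ.compSubConstCLM ℂ (s • e))) s := by
    intro s
    have h1 := hasDerivAt_toTempered_shift u (ψ.compSubConstCLM ℂ (s • e)) e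
    rw [← h, TemperedDistribution.lineDerivOp_apply_apply]
    rw [← sub_self s] at h1
    have h2 := h1.comp_sub_const s s
    refine h2.congr_of_eventuallyEq (Eventually.of_forall fun t => ?_)
    simp only [SchwartzMap.compSubConstCLM_comp, ← add_smul, add_sub_cancel]
  have h0 : (ψ.compSubConstCLM ℂ ((0 : ℝ) • e)) = ψ := by
    ext x; simp
  have hb := Convex.norm_image_sub_le_of_norm_hasDerivWithin_le (s := univ) (x := 0) (y := t)
    (fun s _ => (hd s).hasDerivWithinAt) (C := ‖g‖ * ‖ψ.toLp 2‖) (fun s _ => by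
      rw [← norm_toLp_shift ψ (s • e)]
      exact norm_toTempered_apply_le _ _) convex_univ (mem_univ _) (mem_univ _)
  rw [h0, ← translateL2_toTempered, ← toTempered_sub_apply, sub_zero, Real.norm_eq_abs] at hb
  linarith

/-- If the translates of `u` along `e` are Lipschitz then `∂_e u ∈ L²`. -/
lemma exists_lineDeriv_of_norm_translateL2_sub_le {d : ℕ} {u : L2 d} {e : Rd d} {C : ℝ}
    (hC : 0 ≤ C) (h : ∀ t : ℝ, ‖translateL2 (t • e) u - u‖ ≤ C * |t|) :
    ∃ g : L2 d, ∂_{e} (u : 𝓢'(Rd d, ℂ)) = (g : 𝓢'(Rd d, ℂ)) ∧ ‖g‖ ≤ C := by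
  have hbd : ∀ ψ : 𝓢(Rd d, ℂ), ‖(∂_{e} (u : 𝓢'(Rd d, ℂ))) ψ‖ ≤ C * ‖ψ.toLp 2‖ := by
    intro ψ
    rw [TemperedDistribution.lineDerivOp_apply_apply]
    refine (hasDerivAt_toTempered_shift u ψ e).le_of_lip' (by positivity)
      (Eventually.of_forall fun t => ?_)
    have h0 : (ψ.compSubConstCLM ℂ ((0 : ℝ) • e)) = ψ := by
      ext x; simp
    rw [h0, ← translateL2_toTempered, ← toTempered_sub_apply, sub_zero, Real.norm_eq_abs]
    refine (norm_toTempered_apply_le _ _).trans ?_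
    have := h t
    calc _ ≤ C * |t| * ‖ψ.toLp 2‖ := by gcongr
      _ = _ := by ring
  let e' : 𝓢(Rd d, ℂ) →ₗ[ℂ] L2 d :=
    (SchwartzMap.toLpCLM ℂ (E := Rd d) ℂ 2 volume : 𝓢(Rd d, ℂ) →L[ℂ] L2 d).toLinearMap
  let f : 𝓢(Rd d, ℂ) →ₗ[ℂ] ℂ :=
    { toFun := fun ψ => (∂_{e} (u : 𝓢'(Rd d, ℂ))) ψ
      map_add' := fun _ _ => map_add _ _ _
      map_smul' := fun _ _ => map_smul _ _ _ }
  let F : L2 d →L[ℂ] ℂ := f.extendOfNorm e'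
  have hF : ∀ ψ : 𝓢(Rd d, ℂ), F (ψ.toLp 2) = (∂_{e} (u : 𝓢'(Rd d, ℂ))) ψ :=
    fun ψ => LinearMap.extendOfNorm_eq (f := f) (e := e') (denseRange_schwartz d) ⟨C, hbd⟩ ψ
  let y : L2 d := (InnerProductSpace.toDual ℂ (L2 d)).symm F
  have hy : ∀ φ, ⟪y, φ⟫_ℂ = F φ := fun φ => InnerProductSpace.toDual_symm_apply
  refine ⟨star y, ?_, ?_⟩
  · ext ψ
    rw [toTempered_apply_eq_inner, star_star, hy, hF]
  · refine norm_le_of_toTempered hC fun ψ => ?_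
    rw [toTempered_apply_eq_inner, star_star, hy, hF]
    exact hbd ψ

/-! ### Normal contractions -/

namespace IsWeakGradient

variable {d : ℕ} {u v : L2 d} {g k : Fin d → L2 d}

lemma add (hu : IsWeakGradient u g) (hv : IsWeakGradient v k) :
    IsWeakGradient (u + v) (g + k) := fun i => by
  change ∂_{_} (Lp.toTemperedDistributionCLM ℂ volume 2 (u + v))
    = Lp.toTemperedDistributionCLM ℂ volume 2 (g i + k i)
  rw [map_add, map_add, LineDeriv.lineDerivOp_add]
  exact congrArg₂ _ (hu i) (hv i)

lemma smul (hu : IsWeakGradient u g) (c : ℂ) : IsWeakGradient (c • u) (c • g) := fun i => by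
  change ∂_{_} (Lp.toTemperedDistributionCLM ℂ volume 2 (c • u))
    = Lp.toTemperedDistributionCLM ℂ volume 2 (c • g i)
  rw [map_smul, map_smul, LineDeriv.lineDerivOp_smul]
  exact congrArg _ (hu i)

lemma sub (hu : IsWeakGradient u g) (hv : IsWeakGradient v k) :
    IsWeakGradient (u - v) (g - k) := by
  have := hu.add (hv.smul (-1))
  simpa [sub_eq_add_neg] using this

end IsWeakGradient

namespace MemH1

variable {d : ℕ} {u v : L2 d}

lemma isWeakGradient (hu : MemH1 u) : IsWeakGradient u (weakGradient u) := by
  obtain ⟨g, hg⟩ := hu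
  rwa [weakGradient_eq hg]

lemma add (hu : MemH1 u) (hv : MemH1 v) : MemH1 (u + v) :=
  ⟨_, hu.isWeakGradient.add hv.isWeakGradient⟩

lemma sub (hu : MemH1 u) (hv : MemH1 v) : MemH1 (u - v) :=
  ⟨_, hu.isWeakGradient.sub hv.isWeakGradient⟩

lemma weakGradient_add (hu : MemH1 u) (hv : MemH1 v) :
    weakGradient (u + v) = weakGradient u + weakGradient v :=
  weakGradient_eq (hu.isWeakGradient.add hv.isWeakGradient)

lemma weakGradient_sub (hu : MemH1 u) (hv : MemH1 v) :
    weakGradient (u - v) = weakGradient u - weakGradient v :=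
  weakGradient_eq (hu.isWeakGradient.sub hv.isWeakGradient)

end MemH1

/-- `z ↦ |z|` as a complex-valued function is a contraction. -/
lemma lipschitzWith_complex_norm : LipschitzWith 1 (fun z : ℂ => (‖z‖ : ℂ)) :=
  Complex.isometry_ofReal.lipschitz.comp lipschitzWith_one_norm |>.weaken (by simp)

/-- The absolute value `|u|` of `u ∈ L²`. -/
def absL2 {d : ℕ} (u : L2 d) : L2 d := lipschitzWith_complex_norm.compLp (by simp) u

lemma coeFn_absL2 {d : ℕ} (u : L2 d) : absL2 u =ᵐ[volume] fun x => (‖u x‖ : ℂ) :=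
  LipschitzWith.coeFn_compLp _ _ u

lemma continuous_absL2 {d : ℕ} : Continuous (absL2 (d := d)) :=
  lipschitzWith_complex_norm.continuous_compLp (by simp)

lemma norm_absL2 {d : ℕ} (u : L2 d) : ‖absL2 u‖ = ‖u‖ := by
  rw [Lp.norm_def, Lp.norm_def]
  congr 1
  refine eLpNorm_congr_norm_ae ?_
  filter_upwards [coeFn_absL2 u] with x h1
  simp [h1]

lemma translateL2_absL2 {d : ℕ} (h : Rd d) (u : L2 d) :
    translateL2 h (absL2 u) = absL2 (translateL2 h u) := by
  refine Lp.ext ?_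
  have h1 := (measurePreserving_add_right volume h).quasiMeasurePreserving.ae_eq_comp
    (coeFn_absL2 u)
  filter_upwards [coeFn_translateL2 h (absL2 u), coeFn_absL2 (translateL2 h u),
    coeFn_translateL2 h u, h1] with x h2 h3 h4 h5
  rw [h2, h3, h4]
  exact h5

lemma norm_absL2_sub_le {d : ℕ} (u v : L2 d) : ‖absL2 u - absL2 v‖ ≤ ‖u - v‖ := by
  have h := lipschitzWith_complex_norm.norm_compLp_sub_le (by simp) u v
  rwa [NNReal.coe_one, one_mul] at h

/-- If `u ∈ H¹` then `|u| ∈ H¹`, and the partial derivatives of `|u|` are no larger in norm. -/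
lemma MemH1.absL2_aux {d : ℕ} {u : L2 d} (hu : MemH1 u) :
    MemH1 (absL2 u) ∧ ∀ i, ‖weakGradient (absL2 u) i‖ ≤ ‖weakGradient u i‖ := by
  have h : ∀ i, ∃ g : L2 d, ∂_{(EuclideanSpace.single i (1 : ℝ) : Rd d)}
      (absL2 u : 𝓢'(Rd d, ℂ)) = (g : 𝓢'(Rd d, ℂ)) ∧ ‖g‖ ≤ ‖weakGradient u i‖ := fun i => by
    refine exists_lineDeriv_of_norm_translateL2_sub_le (norm_nonneg _) fun t => ?_
    rw [translateL2_absL2]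
    exact (norm_absL2_sub_le _ _).trans (norm_translateL2_sub_le (hu.isWeakGradient i) t)
  choose g hg hgn using h
  exact ⟨⟨g, hg⟩, fun i => by rw [weakGradient_eq hg]; exact hgn i⟩

lemma MemH1.absL2 {d : ℕ} {u : L2 d} (hu : MemH1 u) : MemH1 (absL2 u) := hu.absL2_aux.1

lemma MemH1.re_inner_weakGradient_absL2_le {d : ℕ} {u : L2 d} (hu : MemH1 u) (i : Fin d) :
    |(⟪weakGradient (_root_.absL2 u) i, weakGradient u i⟫_ℂ).re| ≤ ‖weakGradient u i‖ ^ 2 := by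
  refine (Complex.abs_re_le_norm _).trans ((norm_inner_le_norm _ _).trans ?_)
  rw [sq]
  gcongr
  exact hu.absL2_aux.2 i

namespace MemFormDomain

variable {d : ℕ} {U : Rd d → ℝ≥0∞} {u v : L2 d}

lemma add (hu : MemFormDomain U u) (hv : MemFormDomain U v) : MemFormDomain U (u + v) := by
  refine ⟨hu.1.add hv.1, (memLp_congr_ae ?_).2 (hu.2.add hv.2)⟩
  exact (withDensity_absolutelyContinuous volume U).ae_eq (Lp.coeFn_add u v)

lemma sub (hu : MemFormDomain U u) (hv : MemFormDomain U v) : MemFormDomain U (u - v) := by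
  refine ⟨hu.1.sub hv.1, (memLp_congr_ae ?_).2 (hu.2.sub hv.2)⟩
  exact (withDensity_absolutelyContinuous volume U).ae_eq (Lp.coeFn_sub u v)

/-- The form domain is solid: it contains every `v ∈ H¹` with `|v| ≤ |u|` if it contains `u`. -/
lemma of_le (hu : MemFormDomain U u) (hv : MemH1 v) (h : ∀ᵐ x, ‖v x‖ ≤ ‖u x‖) :
    MemFormDomain U v :=
  ⟨hv, hu.2.of_le ((Lp.aestronglyMeasurable v).mono_ac (withDensity_absolutelyContinuous volume U))
    ((withDensity_absolutelyContinuous volume U).ae_le h)⟩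

lemma absL2 (hu : MemFormDomain U u) : MemFormDomain U (absL2 u) :=
  hu.of_le hu.1.absL2 <| by
    filter_upwards [coeFn_absL2 u] with x hx
    simp [hx]

end MemFormDomain

lemma memFormDomain_zero_iff {d : ℕ} {u : L2 d} : MemFormDomain 0 u ↔ MemH1 u := by
  refine ⟨fun h => h.1, fun h => ⟨h, ?_⟩⟩
  rw [withDensity_zero]
  exact memLp_measure_zero

lemma schrodingerForm_zero {d : ℕ} (v u : L2 d) :
    schrodingerForm 0 v u = 2 * ∑ i, ⟪weakGradient v i, weakGradient u i⟫_ℂ := by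
  rw [schrodingerForm, withDensity_zero, integral_zero_measure, add_zero]

lemma re_inner_self {H : Type*} [NormedAddCommGroup H] [InnerProductSpace ℂ H] (u : H) :
    (⟪u, u⟫_ℂ).re = ‖u‖ ^ 2 := inner_self_eq_norm_sq (𝕜 := ℂ) u

lemma re_integral_nonneg {α : Type*} [MeasurableSpace α] {μ : Measure α} {f : α → ℂ}
    (hf : ∀ᵐ x ∂μ, 0 ≤ (f x).re) : 0 ≤ (∫ x, f x ∂μ).re := by
  by_cases hi : Integrable f μ
  · have h := integral_re (𝕜 := ℂ) hi
    simp only [RCLike.re_eq_complex_re] at h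
    rw [← h]
    exact integral_nonneg_of_ae hf
  · rw [integral_undef hi, Complex.zero_re]

/-! ### Positivity of the resolvents -/

/-- `u ∈ L²` is real and nonnegative almost everywhere. -/
def IsNonneg {d : ℕ} (u : L2 d) : Prop := ∀ᵐ x, 0 ≤ (u x).re ∧ (u x).im = 0

lemma isNonneg_iff {d : ℕ} {u : L2 d} : IsNonneg u ↔ absL2 u = u := by
  refine ⟨fun h => Lp.ext ?_, fun h => ?_⟩
  · filter_upwards [h, coeFn_absL2 u] with x hx h1
    rw [h1]
    refine Complex.ext ?_ ?_
    · rw [Complex.ofReal_re, ← Complex.abs_re_eq_norm.2 hx.2, abs_of_nonneg hx.1]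
    · rw [Complex.ofReal_im, hx.2]
  · have h1 := coeFn_absL2 u
    rw [h] at h1
    filter_upwards [h1] with x hx
    rw [hx]
    simp

/-- Weak maximum principle: a solution of `(H + l) u = φ` with `φ ≥ 0` is nonnegative. -/
lemma IsNonneg.of_isHamiltonian {d : ℕ} {U : Rd d → ℝ≥0∞} {u φ : L2 d} {l : ℝ} (hl : 0 < l)
    (hφ : IsNonneg φ) (hu : IsHamiltonian U u (φ - (l : ℂ) • u)) : IsNonneg u := by
  have hd := hu.memFormDomain
  -- Testing with `v = |u| - u`: both parts of the form are nonpositive there, `⟪v, φ⟫` is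
  -- nonnegative, and `Re ⟪v, u⟫ = -‖v‖² / 2` because `‖v + u‖ = ‖u‖`. Together these force `v = 0`.
  set v := absL2 u - u with hv
  have hvd : MemFormDomain U v := hd.absL2.sub hd
  have h1 := congrArg Complex.re (hu.form_eq hvd)
  have hform : (schrodingerForm U v u).re ≤ 0 := by
    rw [schrodingerForm, Complex.add_re]
    have ha : (2 * ∑ i, ⟪weakGradient v i, weakGradient u i⟫_ℂ).re ≤ 0 := by
      have : (2 : ℂ) = ((2 : ℝ) : ℂ) := by norm_num
      rw [this, Complex.re_ofReal_mul, Complex.re_sum]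
      refine mul_nonpos_of_nonneg_of_nonpos zero_le_two (Finset.sum_nonpos fun i _ => ?_)
      rw [hv, hd.1.absL2.weakGradient_sub hd.1, Pi.sub_apply, inner_sub_left, Complex.sub_re,
        re_inner_self]
      have := (le_abs_self _).trans (hd.1.re_inner_weakGradient_absL2_le i)
      linarith
    have hb : 0 ≤ (∫ x, -((starRingEnd ℂ) (v x) * u x) ∂(volume.withDensity U)).re := by
      refine re_integral_nonneg ?_
      have h2 : ∀ᵐ x, v x = (‖u x‖ : ℂ) - u x := by
        filter_upwards [Lp.coeFn_sub (absL2 u) u, coeFn_absL2 u] with x h1 h2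
        rw [hv, h1, Pi.sub_apply, h2]
      filter_upwards [(withDensity_absolutelyContinuous volume U).ae_le h2] with x hx
      rw [hx, map_sub, Complex.conj_ofReal, sub_mul, Complex.neg_re, Complex.sub_re,
        Complex.re_ofReal_mul, ← Complex.normSq_eq_conj_mul_self, Complex.ofReal_re,
        Complex.normSq_eq_norm_sq]
      nlinarith [Complex.re_le_norm (u x), norm_nonneg (u x)]
    rw [integral_neg, Complex.neg_re] at hb
    linarith
  have hvφ : 0 ≤ (⟪v, φ⟫_ℂ).re := by
    rw [L2.inner_def]
    refine re_integral_nonneg ?_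
    filter_upwards [hφ, Lp.coeFn_sub (absL2 u) u, coeFn_absL2 u] with x h1 h2 h3
    rw [hv, h2, Pi.sub_apply, h3]
    have := Complex.re_le_norm (u x)
    simp only [RCLike.inner_apply, map_sub, Complex.conj_ofReal, Complex.mul_re, Complex.sub_re,
      Complex.ofReal_re, Complex.conj_re, h1.2]
    have h4 := mul_nonneg h1.1 (sub_nonneg.2 this)
    linarith
  have hvu : (⟪v, u⟫_ℂ).re = -(‖v‖ ^ 2 / 2) := by
    have h := norm_add_sq (𝕜 := ℂ) v u
    have h2 : v + u = absL2 u := sub_add_cancel _ _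
    rw [h2, norm_absL2] at h
    simp only [RCLike.re_eq_complex_re] at h
    linarith
  rw [inner_sub_right, inner_smul_right, Complex.sub_re, Complex.re_ofReal_mul, hvu] at h1
  have h3 : ‖v‖ ^ 2 ≤ 0 := by nlinarith
  have h4 : v = 0 := by
    rw [← norm_eq_zero]
    exact pow_eq_zero_iff two_ne_zero |>.1 (le_antisymm h3 (sq_nonneg _))
  exact isNonneg_iff.2 (sub_eq_zero.1 h4)

/-- Adding the potential decreases the solution of `(H + l) u = φ` for `φ ≥ 0`. -/
lemma IsNonneg.sub_of_isHamiltonian {d : ℕ} {U : Rd d → ℝ≥0∞} {u u₀ φ : L2 d} {l : ℝ}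
    (hl : 0 < l) (hφ : IsNonneg φ) (hu : IsHamiltonian U u (φ - (l : ℂ) • u))
    (hu₀ : IsHamiltonian 0 u₀ (φ - (l : ℂ) • u₀)) : IsNonneg (u₀ - u) := by
  have hup := hφ.of_isHamiltonian hl hu
  have hup₀ := hφ.of_isHamiltonian hl hu₀
  have hd := hu.memFormDomain
  have hd₀ := hu₀.memFormDomain.1
  set z := u - u₀ with hz
  have hzH : MemH1 z := hd.1.sub hd₀
  -- The test function `w`, twice the positive part of `u - u₀`, satisfies `0 ≤ w ≤ 2 u`; so it lies
  -- in the form domain of `H`, although `u₀` need not.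
  set w := z + absL2 z with hw
  have hwH : MemH1 w := hzH.add hzH.absL2
  have hpt : ∀ᵐ x, 0 ≤ (w x).re ∧ (w x).im = 0 ∧ (w x).re ≤ 2 * (u x).re := by
    filter_upwards [hup, hup₀, Lp.coeFn_sub u u₀, Lp.coeFn_add z (absL2 z), coeFn_absL2 z]
      with x h1 h2 h3 h4 h5
    rw [← hz] at h3
    have h6 : z x = ((u x).re - (u₀ x).re : ℝ) := by
      rw [h3]
      refine Complex.ext ?_ ?_ <;> simp [h1.2, h2.2]
    rw [hw, h4, Pi.add_apply, h5, h6, Complex.norm_real, ← Complex.ofReal_add, Complex.ofReal_re,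
      Complex.ofReal_im, Real.norm_eq_abs]
    refine ⟨?_, rfl, ?_⟩
    · linarith [neg_abs_le ((u x).re - (u₀ x).re)]
    · have h7 := h1.1
      have h8 := h2.1
      rcases abs_cases ((u x).re - (u₀ x).re) with h | h <;> linarith
  have hwd : MemFormDomain U w := by
    refine (hd.add hd).of_le hwH ?_
    filter_upwards [hpt, Lp.coeFn_add u u, hup] with x h1 h2 h3
    rw [h2, Pi.add_apply, ← Complex.abs_re_eq_norm.2 h1.2.1, abs_of_nonneg h1.1]
    refine le_trans ?_ (Complex.re_le_norm _)
    rw [Complex.add_re]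
    linarith
  have h1 := congrArg Complex.re (hu.form_eq hwd)
  have h2 := congrArg Complex.re (hu₀.form_eq (memFormDomain_zero_iff.2 hwH))
  rw [schrodingerForm_zero] at h2
  have h3 : 0 ≤ (2 * ∑ i, ⟪weakGradient w i, weakGradient u i⟫_ℂ).re
      - (2 * ∑ i, ⟪weakGradient w i, weakGradient u₀ i⟫_ℂ).re := by
    have : (2 : ℂ) = ((2 : ℝ) : ℂ) := by norm_num
    rw [← Complex.sub_re, ← mul_sub, ← Finset.sum_sub_distrib, this, Complex.re_ofReal_mul,
      Complex.re_sum]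
    refine mul_nonneg zero_le_two (Finset.sum_nonneg fun i _ => ?_)
    rw [← inner_sub_right, ← Pi.sub_apply, ← hd.1.weakGradient_sub hd₀, ← hz, hw,
      hzH.weakGradient_add hzH.absL2, Pi.add_apply, inner_add_left, Complex.add_re,
      re_inner_self]
    have := (neg_abs_le _).trans' (neg_le_neg (hzH.re_inner_weakGradient_absL2_le i))
    linarith
  have h4 : 0 ≤ (∫ x, (starRingEnd ℂ) (w x) * u x ∂(volume.withDensity U)).re := by
    refine re_integral_nonneg ?_
    filter_upwards [(withDensity_absolutelyContinuous volume U).ae_le hpt,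
      (withDensity_absolutelyContinuous volume U).ae_le hup] with x k1 k2
    rw [Complex.mul_re, Complex.conj_re, k2.2, mul_zero, sub_zero]
    exact mul_nonneg k1.1 k2.1
  have h5 : (⟪w, z⟫_ℂ).re = ‖w‖ ^ 2 / 2 := by
    have h := norm_add_sq (𝕜 := ℂ) (absL2 z) z
    rw [add_comm, ← hw, norm_absL2] at h
    rw [hw, inner_add_left, Complex.add_re, re_inner_self, ← hw]
    simp only [RCLike.re_eq_complex_re] at h
    linarith
  rw [schrodingerForm, Complex.add_re] at h1
  rw [inner_sub_right, inner_smul_right, Complex.sub_re, Complex.re_ofReal_mul] at h1 h2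
  have h6 : (⟪w, z⟫_ℂ).re = (⟪w, u⟫_ℂ).re - (⟪w, u₀⟫_ℂ).re := by
    rw [hz, inner_sub_right, Complex.sub_re]
  have h7 : l * (‖w‖ ^ 2 / 2) ≤ 0 := by
    rw [← h5, h6]
    linarith
  have h8 : ‖w‖ ^ 2 ≤ 0 := by nlinarith
  have h9 : w = 0 := by
    rw [← norm_eq_zero]
    exact pow_eq_zero_iff two_ne_zero |>.1 (le_antisymm h8 (sq_nonneg _))
  filter_upwards [Lp.coeFn_sub u₀ u, Lp.coeFn_sub u u₀, coeFn_absL2 z, Lp.coeFn_add z (absL2 z),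
    Lp.coeFn_zero ℂ 2 (volume : Measure (Rd d))] with x k1 k2 k3 k4 k5
  rw [← hw, h9, k5, Pi.add_apply, k3, Pi.zero_apply] at k4
  have k6 : (u₀ - u : L2 d) x = (‖z x‖ : ℂ) := by
    rw [k1, Pi.sub_apply]
    rw [← hz, Pi.sub_apply] at k2
    rw [k2] at k4 ⊢
    linear_combination k4
  rw [k6]
  simp

/-! ### Positivity of the heat semigroup and of the heat difference -/

namespace IsNonneg

variable {d : ℕ} {u v : L2 d}

lemma add (hu : IsNonneg u) (hv : IsNonneg v) : IsNonneg (u + v) := by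
  filter_upwards [hu, hv, Lp.coeFn_add u v] with x h1 h2 h3
  rw [h3, Pi.add_apply, Complex.add_re, Complex.add_im, h1.2, h2.2]
  exact ⟨add_nonneg h1.1 h2.1, add_zero 0⟩

lemma smul (hu : IsNonneg u) {c : ℝ} (hc : 0 ≤ c) : IsNonneg ((c : ℂ) • u) := by
  filter_upwards [hu, Lp.coeFn_smul (c : ℂ) u] with x h1 h3
  rw [h3, Pi.smul_apply, smul_eq_mul, Complex.re_ofReal_mul, Complex.im_ofReal_mul, h1.2]
  exact ⟨mul_nonneg hc h1.1, mul_zero c⟩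

end IsNonneg

lemma isClosed_isNonneg (d : ℕ) : IsClosed {u : L2 d | IsNonneg u} := by
  simp only [isNonneg_iff]
  exact isClosed_eq continuous_absL2 continuous_id

/-- The operator `T` maps nonnegative functions to nonnegative functions. -/
def PreservesNonneg {d : ℕ} (T : L2 d →L[ℂ] L2 d) : Prop := ∀ u, IsNonneg u → IsNonneg (T u)

namespace PreservesNonneg

variable {d : ℕ} {S T : L2 d →L[ℂ] L2 d}

lemma one : PreservesNonneg (1 : L2 d →L[ℂ] L2 d) := fun _ hu => hu

lemma add (hS : PreservesNonneg S) (hT : PreservesNonneg T) : PreservesNonneg (S + T) :=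
  fun u hu => (hS u hu).add (hT u hu)

lemma mul (hS : PreservesNonneg S) (hT : PreservesNonneg T) : PreservesNonneg (S * T) :=
  fun u hu => hS _ (hT u hu)

lemma pow (hS : PreservesNonneg S) (n : ℕ) : PreservesNonneg (S ^ n) := by
  induction n with
  | zero => rw [pow_zero]; exact one
  | succ n ih => rw [pow_succ]; exact ih.mul hS

lemma pow_sub_pow (hS : PreservesNonneg S) (hT : PreservesNonneg (T - S)) (n : ℕ) :
    PreservesNonneg (T ^ n - S ^ n) := by
  have hT' : PreservesNonneg T := by simpa using hT.add hS
  induction n with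
  | zero =>
    simp only [pow_zero, sub_self]
    intro u _
    rw [isNonneg_iff]
    exact LipschitzWith.compLp_zero _ _
  | succ n ih =>
    have : T ^ (n + 1) - S ^ (n + 1) = T * (T ^ n - S ^ n) + (T - S) * S ^ n := by
      rw [mul_sub, sub_mul, pow_succ', pow_succ']
      abel
    rw [this]
    exact (hT'.mul ih).add (hT.mul (hS.pow n))

lemma of_tendsto {T' : ℕ → L2 d →L[ℂ] L2 d} (h : ∀ n, PreservesNonneg (T' n))
    (hT : Tendsto T' atTop (𝓝 T)) : PreservesNonneg T := fun u hu =>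
  (isClosed_isNonneg d).mem_of_tendsto
    (((ContinuousLinearMap.apply ℂ (L2 d) u).continuous.tendsto T).comp hT)
    (Eventually.of_forall fun n => h n u hu)

end PreservesNonneg

/-- The symbol of the normalized resolvent `(1 + H / l)⁻¹`. -/
lemma isSymbol_resolvent {l : ℝ} (hl : 0 < l) : IsSymbol (fun t => l * (l + t)⁻¹) 0 := by
  constructor
  · refine continuousOn_const.mul ((continuousOn_const.add continuousOn_id).inv₀ fun t ht => ?_)
    have : 0 ≤ t := ht
    exact (add_pos_of_pos_of_nonneg hl this).ne'
  · simpa using ((tendsto_atTop_add_const_left _ l tendsto_id).inv_tendsto_atTop).const_mul l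

lemma isHamiltonian_resolvent {d : ℕ} (U : Rd d → ℝ≥0∞) {l : ℝ} (hl : 0 < l) (φ : L2 d) :
    IsHamiltonian U (functionOfH (fun t => l * (l + t)⁻¹) 0 U φ)
      ((l : ℂ) • φ - (l : ℂ) • functionOfH (fun t => l * (l + t)⁻¹) 0 U φ) := by
  have h1 := isSymbol_resolvent hl
  have h2 := (IsSymbol.const l).sub ((IsSymbol.const l).mul h1)
  have h3 := isHamiltonian_functionOfH (U := U) h1 h2 (fun t ht => by
    have : l + t ≠ 0 := by positivity
    field_simp
    ring) φ
  rw [functionOfH_sub (.const l) ((IsSymbol.const l).mul h1), functionOfH_mul (.const l) h1,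
    functionOfH_const] at h3
  exact h3

lemma preservesNonneg_resolvent {d : ℕ} (U : Rd d → ℝ≥0∞) {l : ℝ} (hl : 0 < l) :
    PreservesNonneg (functionOfH (fun t => l * (l + t)⁻¹) 0 U) := fun _ hφ =>
  (hφ.smul hl.le).of_isHamiltonian hl (isHamiltonian_resolvent U hl _)

lemma preservesNonneg_resolvent_sub {d : ℕ} (U : Rd d → ℝ≥0∞) {l : ℝ} (hl : 0 < l) :
    PreservesNonneg (functionOfH (fun t => l * (l + t)⁻¹) 0 0
      - functionOfH (fun t => l * (l + t)⁻¹) 0 U) := fun _ hφ =>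
  (hφ.smul hl.le).sub_of_isHamiltonian hl (isHamiltonian_resolvent U hl _)
    (isHamiltonian_resolvent 0 hl _)

/-- Quantitative form of `(1 + s / n)⁻ⁿ → e^{-s}`, uniformly in `s ≥ 0`. -/
lemma abs_resolvent_pow_sub_exp_le {s : ℝ} (hs : 0 ≤ s) (m : ℕ) :
    |((1 + s / (2 * (m + 1)))⁻¹) ^ (2 * (m + 1)) - Real.exp (-s)| ≤ 2 / (m + 1) := by
  set x : ℝ := s / (2 * (m + 1)) with hx
  have hx0 : 0 ≤ x := by positivity
  have hxs : (2 * ((m : ℝ) + 1)) * x = s := by rw [hx]; field_simp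
  have hexp : Real.exp (-s) = Real.exp (-x) ^ (2 * (m + 1)) := by
    rw [← Real.exp_nat_mul]
    push_cast
    rw [← hxs]
    ring_nf
  have h1 : Real.exp (-x) ≤ (1 + x)⁻¹ := by
    rw [Real.exp_neg]
    exact inv_anti₀ (by positivity) (by linarith [Real.add_one_le_exp x])
  set a : ℝ := (1 + x) * Real.exp (-x) with ha
  have ha1 : 1 - x ^ 2 ≤ a := by
    have := Real.one_sub_le_exp_neg x
    nlinarith
  have ha0 : 0 ≤ a := by positivity
  have hexp' : Real.exp (-s) = ((1 + x)⁻¹) ^ (2 * (m + 1)) * a ^ (2 * (m + 1)) := by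
    rw [hexp, ← mul_pow, ha, inv_mul_cancel_left₀ (by positivity)]
  have hb := one_add_mul_le_pow (a := a - 1) (by linarith) (2 * (m + 1))
  rw [add_sub_cancel] at hb
  push_cast at hb
  -- `(1 + x)^{2(m+1)} ≥ (1 + s/2)² ≥ s²/4`
  have hq : s ^ 2 / 4 ≤ (1 + x) ^ (2 * (m + 1)) := by
    have h2 := one_add_mul_le_pow (a := x) (by linarith) (m + 1)
    push_cast at h2
    have h3 : s / 2 ≤ (1 + x) ^ (m + 1) := by nlinarith
    calc s ^ 2 / 4 = (s / 2) ^ 2 := by ring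
      _ ≤ ((1 + x) ^ (m + 1)) ^ 2 := by gcongr
      _ = _ := by rw [← pow_mul, mul_comm]
  have hP : 0 < (1 + x) ^ (2 * (m + 1)) := by positivity
  rw [abs_of_nonneg (by rw [hexp]; exact sub_nonneg.2 (by gcongr)), hexp']
  have h4 : 1 - a ^ (2 * (m + 1)) ≤ 2 * (m + 1) * x ^ 2 := by nlinarith
  calc ((1 + x)⁻¹) ^ (2 * (m + 1)) - ((1 + x)⁻¹) ^ (2 * (m + 1)) * a ^ (2 * (m + 1))
      = ((1 + x) ^ (2 * (m + 1)))⁻¹ * (1 - a ^ (2 * (m + 1))) := by rw [inv_pow]; ring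
    _ ≤ ((1 + x) ^ (2 * (m + 1)))⁻¹ * (2 * (m + 1) * x ^ 2) := by gcongr
    _ ≤ 2 / (m + 1) := by
      rw [inv_mul_le_iff₀ hP, mul_div_assoc', le_div_iff₀ (by positivity)]
      calc 2 * ((m : ℝ) + 1) * x ^ 2 * (m + 1) = (2 * ((m : ℝ) + 1) * x) ^ 2 / 2 := by ring
        _ = s ^ 2 / 4 * 2 := by rw [hxs]; ring
        _ ≤ _ := by gcongr

/-- The exponential formula `(1 + β H / n)⁻ⁿ → exp (-(β H))`, along even `n`. -/
lemma tendsto_resolvent_pow {d : ℕ} (U : Rd d → ℝ≥0∞) {β : ℝ} (hβ : 0 < β) :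
    Tendsto (fun m : ℕ =>
      functionOfH (fun t => 2 * (m + 1) / β * (2 * (m + 1) / β + t)⁻¹) 0 U ^ (2 * (m + 1)))
      atTop (𝓝 (heatSemigroup U β)) := by
  have hs : ∀ m : ℕ, IsSymbol (fun t => 2 * ((m : ℝ) + 1) / β * (2 * ((m : ℝ) + 1) / β + t)⁻¹) 0 :=
    fun m => isSymbol_resolvent (by positivity)
  have hz : ∀ m : ℕ, IsSymbol (fun t =>
      (2 * ((m : ℝ) + 1) / β * (2 * ((m : ℝ) + 1) / β + t)⁻¹) ^ (2 * (m + 1))) 0 := fun m =>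
    ⟨(hs m).1.pow _, by simpa using (hs m).2.pow (2 * (m + 1))⟩
  have heq : ∀ m : ℕ, functionOfH (fun t => 2 * ((m : ℝ) + 1) / β *
      (2 * ((m : ℝ) + 1) / β + t)⁻¹) 0 U ^ (2 * (m + 1)) = operatorFunction (symbolPullback
        (fun t => (2 * ((m : ℝ) + 1) / β * (2 * ((m : ℝ) + 1) / β + t)⁻¹) ^ (2 * (m + 1))) 0)
        (schrodingerResolvent U) := fun m => by
    rw [← functionOfH_pow (hs m), zero_pow (by positivity)]
    rfl
  simp only [heq]
  refine tendsto_operatorFunction ?_ fun m => (hz m).continuousOn_spectrum U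
  rw [Metric.tendstoUniformlyOn_iff]
  intro ε hε
  have h0 : Tendsto (fun m : ℕ => 2 / ((m : ℝ) + 1)) atTop (𝓝 0) := by
    simpa using (tendsto_one_div_add_atTop_nhds_zero_nat (𝕜 := ℝ)).const_mul 2 |>.congr
      fun m => by rw [mul_one_div]
  filter_upwards [h0.eventually_lt_const hε] with m hm r hr
  refine lt_of_le_of_lt ?_ hm
  have hr' := spectrum_schrodingerResolvent U hr
  by_cases h0 : r = 0
  · simp only [symbolPullback, h0, if_true, dist_self]
    positivity
  · have hr0 : 0 < r := lt_of_le_of_ne hr'.1 (Ne.symm h0)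
    have ht : 0 ≤ r⁻¹ - 1 := by simpa using (one_le_inv₀ hr0).2 hr'.2
    simp only [symbolPullback, h0, if_false]
    rw [dist_comm, Real.dist_eq]
    have := abs_resolvent_pow_sub_exp_le (mul_nonneg hβ.le ht) m
    have h1 : 2 * ((m : ℝ) + 1) / β + (r⁻¹ - 1) ≠ 0 := by positivity
    have h2 : 1 + β * (r⁻¹ - 1) / (2 * ((m : ℝ) + 1)) ≠ 0 := by positivity
    have h3 : 2 * ((m : ℝ) + 1) / β * (2 * ((m : ℝ) + 1) / β + (r⁻¹ - 1))⁻¹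
        = (1 + β * (r⁻¹ - 1) / (2 * ((m : ℝ) + 1)))⁻¹ := by
      rw [← div_eq_mul_inv, div_eq_iff h1, inv_mul_eq_div, eq_div_iff h2]
      field_simp
    rwa [h3]

lemma preservesNonneg_heatSemigroup {d : ℕ} (U : Rd d → ℝ≥0∞) {β : ℝ} (hβ : 0 < β) :
    PreservesNonneg (heatSemigroup U β) :=
  .of_tendsto (fun _ => (preservesNonneg_resolvent U (by positivity)).pow _)
    (tendsto_resolvent_pow U hβ)

/-- Adding the potential decreases the heat semigroup. -/
lemma preservesNonneg_heatDifference {d : ℕ} (U : Rd d → ℝ≥0∞) {β : ℝ} (hβ : 0 < β) :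
    PreservesNonneg (heatDifference U β) :=
  .of_tendsto (fun _ => (preservesNonneg_resolvent U (by positivity)).pow_sub_pow
    (preservesNonneg_resolvent_sub U (by positivity)) _)
    ((tendsto_resolvent_pow 0 hβ).sub (tendsto_resolvent_pow U hβ))

/-! ### Smoothing by the free heat semigroup -/

/-- The complex conjugate of a Schwartz function. -/
def conjSchwartz {d : ℕ} (ψ : 𝓢(Rd d, ℂ)) : 𝓢(Rd d, ℂ) :=
  ψ.postcompCLM (𝕜 := ℝ) (Complex.conjCLE : ℂ →L[ℝ] ℂ)

lemma conjSchwartz_apply {d : ℕ} (ψ : 𝓢(Rd d, ℂ)) (x : Rd d) :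
    conjSchwartz ψ x = (starRingEnd ℂ) (ψ x) := rfl

lemma lineDeriv_conjSchwartz {d : ℕ} (ψ : 𝓢(Rd d, ℂ)) (e : Rd d) :
    ∂_{e} (conjSchwartz ψ) = conjSchwartz (∂_{e} ψ) := by
  ext x
  rw [SchwartzMap.lineDerivOp_apply_eq_fderiv, conjSchwartz_apply,
    SchwartzMap.lineDerivOp_apply_eq_fderiv]
  have h := ((Complex.conjCLE : ℂ →L[ℝ] ℂ).hasFDerivAt.comp x (ψ.hasFDerivAt x)).fderiv
  have h2 : (conjSchwartz ψ : Rd d → ℂ) = (Complex.conjCLE : ℂ →L[ℝ] ℂ) ∘ ψ := rfl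
  rw [h2, h]
  rfl

lemma toTempered_apply_conjSchwartz {d : ℕ} (u : L2 d) (ψ : 𝓢(Rd d, ℂ)) :
    (u : 𝓢'(Rd d, ℂ)) (conjSchwartz ψ) = (starRingEnd ℂ) ⟪u, ψ.toLp 2⟫_ℂ := by
  rw [Lp.toTemperedDistribution_apply, L2.inner_def, ← integral_conj]
  refine integral_congr_ae ?_
  filter_upwards [ψ.coeFn_toLp 2] with x h2
  simp [h2, conjSchwartz_apply, mul_comm]

/-- Integration by parts against a Schwartz function. -/
lemma MemH1.inner_weakGradient {d : ℕ} {v : L2 d} (hv : MemH1 v) (i : Fin d) (ψ : 𝓢(Rd d, ℂ)) :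
    ⟪weakGradient v i, ψ.toLp 2⟫_ℂ
      = -⟪v, (∂_{(EuclideanSpace.single i (1 : ℝ) : Rd d)} ψ).toLp 2⟫_ℂ := by
  have h := congrArg (fun T : 𝓢'(Rd d, ℂ) => T (conjSchwartz ψ)) (hv.isWeakGradient i)
  simp only [TemperedDistribution.lineDerivOp_apply_apply] at h
  rw [map_neg, lineDeriv_conjSchwartz, toTempered_apply_conjSchwartz,
    toTempered_apply_conjSchwartz, ← map_neg] at h
  exact ((starRingEnd ℂ).injective h).symm

lemma isWeakGradient_schwartz {d : ℕ} (ψ : 𝓢(Rd d, ℂ)) :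
    IsWeakGradient (ψ.toLp 2)
      fun i => (∂_{(EuclideanSpace.single i (1 : ℝ) : Rd d)} ψ).toLp 2 := fun i => by
  rw [Lp.toTemperedDistribution_toLp_eq, Lp.toTemperedDistribution_toLp_eq,
    TemperedDistribution.lineDerivOp_toTemperedDistributionCLM_eq]

lemma laplacian_schwartz_eq_sum {d : ℕ} (ψ : 𝓢(Rd d, ℂ)) :
    Laplacian.laplacian ψ = ∑ i, ∂_{(EuclideanSpace.single i (1 : ℝ) : Rd d)}
      (∂_{(EuclideanSpace.single i (1 : ℝ) : Rd d)} ψ) := by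
  rw [SchwartzMap.laplacian_eq_sum (EuclideanSpace.basisFun (Fin d) ℝ)]
  simp

/-- Green's formula for `v ∈ H¹` and a Schwartz function `ψ`. -/
lemma MemH1.sum_inner_weakGradient {d : ℕ} {v : L2 d} (hv : MemH1 v) (ψ : 𝓢(Rd d, ℂ)) :
    ∑ i, ⟪weakGradient v i, weakGradient (ψ.toLp 2 : L2 d) i⟫_ℂ
      = -⟪v, (Laplacian.laplacian ψ).toLp 2⟫_ℂ := by
  have h : ((Laplacian.laplacian ψ).toLp 2 : L2 d)
      = ∑ i, (∂_{(EuclideanSpace.single i (1 : ℝ) : Rd d)}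
      (∂_{(EuclideanSpace.single i (1 : ℝ) : Rd d)} ψ)).toLp 2 := by
    rw [laplacian_schwartz_eq_sum]
    exact map_sum (SchwartzMap.toLpCLM ℂ (E := Rd d) ℂ 2 volume) _ _
  rw [h, inner_sum, ← Finset.sum_neg_distrib, weakGradient_eq (isWeakGradient_schwartz ψ)]
  exact Finset.sum_congr rfl fun i _ => hv.inner_weakGradient i _

/-- For the free Hamiltonian, `-2Δ u = ζ` in the sense of distributions. -/
lemma IsHamiltonian.laplacian_eq {d : ℕ} {u ζ : L2 d} (h : IsHamiltonian 0 u ζ) :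
    Laplacian.laplacian ((star u : L2 d) : 𝓢'(Rd d, ℂ))
      = -(1 / 2 : ℂ) • ((star ζ : L2 d) : 𝓢'(Rd d, ℂ)) := by
  ext ψ
  have hψ : MemH1 (ψ.toLp 2 : L2 d) := ⟨_, isWeakGradient_schwartz ψ⟩
  have h1 := h.form_eq (memFormDomain_zero_iff.2 hψ)
  rw [schrodingerForm_zero] at h1
  have h2 := congrArg (starRingEnd ℂ) h1
  rw [map_mul, map_sum, inner_conj_symm] at h2
  simp only [inner_conj_symm] at h2
  rw [h.memFormDomain.1.sum_inner_weakGradient, ← Complex.ofReal_ofNat, Complex.conj_ofReal] at h2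
  rw [TemperedDistribution.laplacian_apply_apply, toTempered_apply_eq_inner, star_star]
  change _ = -(1 / 2 : ℂ) • (((star ζ : L2 d) : 𝓢'(Rd d, ℂ)) ψ)
  rw [toTempered_apply_eq_inner, star_star, ← h2, smul_eq_mul]
  push_cast
  ring

open TemperedDistribution in
/-- Mathlib's Fourier transform carries the factor `2π` in the exponent, so the Bessel potential of
order `2` is `1 - (2π)⁻² Δ`. -/
lemma besselPotential_two_eq {d : ℕ} (f : 𝓢'(Rd d, ℂ)) :
    besselPotential (Rd d) ℂ 2 f
      = f + ((-((2 * Real.pi) ^ 2)⁻¹ : ℝ) : ℂ) • Laplacian.laplacian f := by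
  have h1 : (fun _ : Rd d => (1 : ℂ)).HasTemperateGrowth := by fun_prop
  have h2 : (fun x : Rd d => Complex.ofReal (‖x‖ ^ 2)).HasTemperateGrowth := by fun_prop
  have hb : besselPotential (Rd d) ℂ 2
      = fourierMultiplierCLM ℂ ((fun _ : Rd d => (1 : ℂ)) + fun x => Complex.ofReal (‖x‖ ^ 2)) := by
    rw [besselPotential]
    congr 1
    ext x
    simp
  have hpi : ((2 * Real.pi) ^ 2) ≠ 0 := by positivity
  rw [hb, laplacian_eq_fourierMultiplierCLM]
  have hadd : fourierMultiplierCLM ℂ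
        ((fun _ : Rd d => (1 : ℂ)) + fun x => Complex.ofReal (‖x‖ ^ 2)) f
      = fourierMultiplierCLM ℂ (fun _ : Rd d => (1 : ℂ)) f
        + fourierMultiplierCLM ℂ (fun x : Rd d => Complex.ofReal (‖x‖ ^ 2)) f := by
    simp only [fourierMultiplierCLM_apply, smulLeftCLM_add h1 h2]
    exact FourierTransform.fourierInv_add _ _
  rw [hadd, fourierMultiplierCLM_const, one_smul]
  generalize fourierMultiplierCLM ℂ (fun x : Rd d => Complex.ofReal (‖x‖ ^ 2)) f = T
  congr 1
  ext ψ
  change T ψ = (((-((2 * Real.pi) ^ 2)⁻¹ : ℝ)) : ℂ) * (-(2 * Real.pi) ^ 2 • T ψ)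
  rw [Complex.real_smul, ← mul_assoc, ← Complex.ofReal_mul, neg_mul_neg, inv_mul_cancel₀ hpi,
    Complex.ofReal_one, one_mul]

open TemperedDistribution in
/-- The free resolvent gains two derivatives. -/
lemma IsHamiltonian.memSobolev {d : ℕ} {u ζ : L2 d} (h : IsHamiltonian 0 u ζ) {s : ℝ}
    (hu : MemSobolev s 2 ((star u : L2 d) : 𝓢'(Rd d, ℂ)))
    (hζ : MemSobolev s 2 ((star ζ : L2 d) : 𝓢'(Rd d, ℂ))) :
    MemSobolev (2 + s) 2 ((star u : L2 d) : 𝓢'(Rd d, ℂ)) := by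
  rw [← memSobolev_besselPotential_iff, besselPotential_two_eq, h.laplacian_eq]
  exact hu.add ((hζ.smul _).smul _)

/-- A function in `L²` whose Fourier transform is in `L¹` is bounded. -/
lemma memLp_top_of_fourier_memL1 {d : ℕ} {w : L2 d} {v : Lp ℂ 1 (volume : Measure (Rd d))}
    (h : FourierTransform.fourier (w : 𝓢'(Rd d, ℂ)) = (v : 𝓢'(Rd d, ℂ))) :
    MemLp w ⊤ volume := by
  have hv : Integrable v := L1.integrable_coeFn v
  set W : Rd d → ℂ := fun x => FourierTransform.fourier (v : Rd d → ℂ) (-x) with hW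
  have hWc : Continuous W :=
    (VectorFourier.fourierIntegral_continuous Real.continuous_fourierChar
      (L := innerₗ (Rd d)) continuous_inner hv).comp continuous_neg
  have hWb : ∀ x, ‖W x‖ ≤ ∫ ξ, ‖v ξ‖ := fun x =>
    VectorFourier.norm_fourierIntegral_le_integral_norm Real.fourierChar volume
      (innerₗ (Rd d)) v (-x)
  have key : ∀ᵐ x, w x = W x := by
    refine ae_eq_of_integral_contDiff_smul_eq
      ((Lp.memLp w).locallyIntegrable (by norm_num)) hWc.locallyIntegrable fun g hg hgs => ?_
    have hg₁ : HasCompactSupport (Complex.ofRealCLM ∘ g) := hgs.comp_left rfl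
    have hg₂ : ContDiff ℝ (⊤ : ℕ∞) (Complex.ofRealCLM ∘ g) := by fun_prop
    set G : 𝓢(Rd d, ℂ) := hg₁.toSchwartzMap hg₂ with hG
    have hGg : ∀ x, G x = (g x : ℂ) := fun x => rfl
    have e1 : ∫ x, g x • w x = (w : 𝓢'(Rd d, ℂ)) G := by
      rw [Lp.toTemperedDistribution_apply]
      exact integral_congr_ae (Eventually.of_forall fun x => by simp [hGg])
    have e2 : (w : 𝓢'(Rd d, ℂ)) G = (v : 𝓢'(Rd d, ℂ)) (FourierTransformInv.fourierInv G) := by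
      rw [← h, TemperedDistribution.fourier_apply, FourierTransform.fourier_fourierInv_eq]
    have e3 : (v : 𝓢'(Rd d, ℂ)) (FourierTransformInv.fourierInv G)
        = ∫ ξ, FourierTransform.fourier (fun x => G (-x)) ξ • v ξ := by
      rw [Lp.toTemperedDistribution_apply]
      refine integral_congr_ae (Eventually.of_forall fun ξ => ?_)
      simp only
      rw [SchwartzMap.fourierInv_coe, Real.fourierInv_eq_fourier_comp_neg]
    have e4 : ∫ ξ, FourierTransform.fourier (fun x => G (-x)) ξ • v ξ
        = ∫ x, G (-x) • FourierTransform.fourier (v : Rd d → ℂ) x := by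
      simpa using! VectorFourier.integral_fourierIntegral_smul_eq_flip (L := innerₗ (Rd d))
        Real.continuous_fourierChar continuous_inner (G.integrable.comp_neg) hv
    rw [e1, e2, e3, e4, ← integral_neg_eq_self]
    exact integral_congr_ae (Eventually.of_forall fun x => by simp [hGg, hW])
  exact memLp_top_of_bound (Lp.aestronglyMeasurable w) (∫ ξ, ‖v ξ‖) <| by
    filter_upwards [key] with x hx
    rw [hx]
    exact hWb x

/-- Powers of the free resolvent map `L²` to Sobolev spaces. -/
lemma memSobolev_schrodingerResolvent_pow {d : ℕ} (k : ℕ) (φ : L2 d) :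
    TemperedDistribution.MemSobolev (2 * k : ℝ) 2
      ((star ((schrodingerResolvent (0 : Rd d → ℝ≥0∞) ^ k) φ) : L2 d) : 𝓢'(Rd d, ℂ)) := by
  induction k generalizing φ with
  | zero =>
    rw [Nat.cast_zero, mul_zero, TemperedDistribution.memSobolev_zero_iff]
    exact ⟨_, rfl⟩
  | succ k ih =>
    set R := schrodingerResolvent (0 : Rd d → ℝ≥0∞) with hR
    have h1 : (R ^ (k + 1)) φ = R ((R ^ k) φ) := by rw [pow_succ']; rfl
    have h2 : (R ^ (k + 1)) φ = (R ^ k) (R φ) := by rw [pow_succ]; rfl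
    have h : IsHamiltonian 0 ((R ^ (k + 1)) φ) ((R ^ k) φ - (R ^ (k + 1)) φ) := by
      rw [IsHamiltonian, add_sub_cancel, h1]
    have hu := ih (R φ)
    rw [← h2] at hu
    have hs : (star ((R ^ k) φ - (R ^ (k + 1)) φ) : L2 d)
        = star ((R ^ k) φ) - star ((R ^ (k + 1)) φ) := by
      refine Lp.ext ?_
      filter_upwards [Lp.coeFn_star ((R ^ k) φ - (R ^ (k + 1)) φ), Lp.coeFn_star ((R ^ k) φ),
        Lp.coeFn_star ((R ^ (k + 1)) φ), Lp.coeFn_sub ((R ^ k) φ) ((R ^ (k + 1)) φ),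
        Lp.coeFn_sub (star ((R ^ k) φ)) (star ((R ^ (k + 1)) φ))] with x h1 h2 h3 h4 h5
      simp only [h1, h5, Pi.star_apply, h4, Pi.sub_apply, h2, h3, star_sub]
    have := h.memSobolev hu (by
      rw [hs]
      have := (ih φ).sub hu
      convert this
      exact (Lp.toTemperedDistributionCLM ℂ (volume : Measure (Rd d)) 2).map_sub _ _)
    convert this using 1
    push_cast
    ring

/-- Each resolvent gains two derivatives, and `2 (d + 1) > d / 2` are enough for boundedness. -/
lemma memLp_top_schrodingerResolvent_pow {d : ℕ} (φ : L2 d) :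
    MemLp ((schrodingerResolvent (0 : Rd d → ℝ≥0∞) ^ (d + 1)) φ) ⊤ volume := by
  obtain ⟨v, hv⟩ := (memSobolev_schrodingerResolvent_pow (d + 1) φ).fourier_memL1 (by
    simp only [finrank_euclideanSpace, Fintype.card_fin]
    push_cast
    have : (0 : ℝ) ≤ d := d.cast_nonneg
    linarith)
  refine (memLp_top_of_fourier_memL1 hv).congr_norm (Lp.aestronglyMeasurable _) ?_
  filter_upwards [Lp.coeFn_star ((schrodingerResolvent (0 : Rd d → ℝ≥0∞) ^ (d + 1)) φ)] with x hx
  rw [hx, Pi.star_apply, norm_star]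

/-- The exponential beats every power, so `exp (-(β H₀))` factors through every power of the
resolvent. -/
lemma isSymbol_pow_mul_exp {β : ℝ} (hβ : 0 < β) (k : ℕ) :
    IsSymbol (fun t => (1 + t) ^ k * Real.exp (-(β * t))) 0 := by
  refine ⟨by fun_prop, ?_⟩
  have h := (isLittleO_pow_exp_pos_mul_atTop k hβ).tendsto_div_nhds_zero
  have h2 := (h.comp (tendsto_atTop_add_const_left atTop (1 : ℝ) tendsto_id)).const_mul
    (Real.exp β)
  rw [mul_zero] at h2
  refine h2.congr fun t => ?_
  simp only [Function.comp, id]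
  rw [mul_add, mul_one, Real.exp_add, Real.exp_neg]
  field_simp

lemma memLp_top_heatSemigroup_zero {d : ℕ} {β : ℝ} (hβ : 0 < β) (φ : L2 d) :
    MemLp (heatSemigroup 0 β φ) ⊤ volume := by
  have hi := IsSymbol.inv_one_add
  have hp : IsSymbol (fun t => (1 + t)⁻¹ ^ (d + 1)) (0 ^ (d + 1)) := ⟨hi.1.pow _, hi.2.pow _⟩
  have h : heatSemigroup (0 : Rd d → ℝ≥0∞) β = schrodingerResolvent 0 ^ (d + 1)
      * functionOfH (fun t => (1 + t) ^ (d + 1) * Real.exp (-(β * t))) 0 0 := by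
    rw [← functionOfH_inv_one_add, ← functionOfH_pow hi,
      ← functionOfH_mul hp (isSymbol_pow_mul_exp hβ _), mul_zero]
    refine functionOfH_congr fun t ht => ?_
    have : 1 + t ≠ 0 := by positivity
    rw [← mul_assoc, ← mul_pow, inv_mul_cancel₀ this, one_pow, one_mul]
  rw [h]
  exact memLp_top_schrodingerResolvent_pow _

/-- By the closed graph theorem, an operator on `L²` with range in `L^∞` is bounded into `L^∞`. -/
lemma exists_bound_of_memLp_top {d : ℕ} (T : L2 d →L[ℂ] L2 d)
    (hT : ∀ φ, MemLp (T φ) ⊤ volume) :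
    ∃ C, 0 ≤ C ∧ ∀ φ, ∀ᵐ x, ‖T φ x‖ ≤ C * ‖φ‖ := by
  let S : L2 d →ₗ[ℂ] Lp ℂ ⊤ (volume : Measure (Rd d)) :=
    { toFun := fun φ => (hT φ).toLp _
      map_add' := fun φ ψ => by
        rw [← MemLp.toLp_add]
        refine MemLp.toLp_congr _ _ ?_
        rw [map_add]
        exact Lp.coeFn_add _ _
      map_smul' := fun c φ => by
        rw [RingHom.id_apply, ← MemLp.toLp_const_smul]
        refine MemLp.toLp_congr _ _ ?_
        rw [map_smul]
        exact Lp.coeFn_smul _ _ }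
  have hS : Continuous S := by
    refine S.continuous_of_seq_closed_graph fun u x y hu hy => ?_
    have h1 : Tendsto (fun n => T (u n)) atTop (𝓝 (T x)) := (T.continuous.tendsto x).comp hu
    obtain ⟨ns, hns, hn⟩ := (tendstoInMeasure_of_tendsto_Lp h1).exists_seq_tendsto_ae
    obtain ⟨ms, hms, hm⟩ := (tendstoInMeasure_of_tendsto_Lp
      (hy.comp hns.tendsto_atTop)).exists_seq_tendsto_ae
    refine Lp.ext ?_
    have h2 : ∀ᵐ z, ∀ n, S (u n) z = T (u n) z :=
      ae_all_iff.2 fun n => (hT (u n)).coeFn_toLp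
    filter_upwards [hn, hm, h2, (hT x).coeFn_toLp] with z k1 k2 k3 k4
    refine (tendsto_nhds_unique k2 ?_).trans k4.symm
    refine (k1.comp hms.tendsto_atTop).congr fun n => ?_
    exact (k3 _).symm
  let S' : L2 d →L[ℂ] Lp ℂ ⊤ (volume : Measure (Rd d)) := ⟨S, hS⟩
  refine ⟨‖S'‖, norm_nonneg _, fun φ => ?_⟩
  have h1 := S'.le_opNorm φ
  filter_upwards [(hT φ).coeFn_toLp, ae_le_eLpNormEssSup (f := (S' φ : Rd d → ℂ)) (μ := volume)]
    with x k1 k2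
  have k3 : ‖S' φ x‖ ≤ ‖S' φ‖ := by
    rw [Lp.norm_def, eLpNorm_exponent_top]
    have := ENNReal.toReal_mono ?_ k2
    · simpa using this
    · rw [← eLpNorm_exponent_top]
      exact Lp.eLpNorm_ne_top _
  have k4 : S' φ x = T φ x := k1
  rw [← k4]
  exact k3.trans h1

/-! ### Integral kernels -/

instance separableSpace_L2 {d : ℕ} : TopologicalSpace.SeparableSpace (L2 d) :=
  have : Fact ((2 : ℝ≥0∞) ≠ ⊤) := ⟨by norm_num⟩
  inferInstance

/-- A strongly measurable family of elements of `L²` has a jointly measurable representative. -/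
lemma exists_measurable_uncurry {d : ℕ} {k : Rd d → L2 d} (hk : StronglyMeasurable k) :
    ∃ K : Rd d × Rd d → ℂ, Measurable K ∧ ∀ x, (fun y => K (x, y)) =ᵐ[volume] k x := by
  classical
  let u : ℕ → L2 d := TopologicalSpace.denseSeq (L2 d)
  have hex : ∀ (j : ℕ) (x : Rd d), ∃ i, dist (k x) (u i) < (1 / 2 : ℝ) ^ (j + 1) := fun j x =>
    (TopologicalSpace.denseRange_denseSeq (L2 d)).exists_dist_lt (k x) (by positivity)
  let n : ℕ → Rd d → ℕ := fun j x => Nat.find (hex j x)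
  have hn : ∀ j x, dist (k x) (u (n j x)) < (1 / 2 : ℝ) ^ (j + 1) := fun j x =>
    Nat.find_spec (hex j x)
  have hnm : ∀ j, Measurable (n j) := fun j => measurable_find (hex j) fun i =>
    measurableSet_lt (hk.dist stronglyMeasurable_const).measurable measurable_const
  let G : ℕ → Rd d × Rd d → ℂ := fun j p => u (n j p.1) p.2
  have hG : ∀ j, Measurable (G j) := fun j => by
    have h1 : Measurable fun q : ℕ × Rd d => u q.1 q.2 :=
      measurable_from_prod_countable_right fun i => (Lp.stronglyMeasurable (u i)).measurable
    exact h1.comp (((hnm j).comp measurable_fst).prodMk measurable_snd)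
  refine ⟨fun p => limUnder atTop fun j => G j p,
    (StronglyMeasurable.limUnder fun j => (hG j).stronglyMeasurable).measurable, fun x => ?_⟩
  have hpow : Summable fun j : ℕ => (1 / 2 : ℝ) ^ j := summable_geometric_two
  have h1 : ∀ᵐ y, ∃ l, Tendsto (fun j => u (n j x) y) atTop (𝓝 l) := by
    refine Lp.ae_tendsto_of_cauchy_eLpNorm (p := 2) (fun j => Lp.aestronglyMeasurable _)
      (by norm_num) (B := fun N => ENNReal.ofReal ((1 / 2 : ℝ) ^ N)) hpow.tsum_ofReal_ne_top ?_
    intro N a b ha hb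
    rw [← Lp.edist_def, edist_lt_ofReal]
    have e1 : (1 / 2 : ℝ) ^ (a + 1) ≤ (1 / 2) ^ (N + 1) :=
      pow_le_pow_of_le_one (by norm_num) (by norm_num) (by omega)
    have e2 : (1 / 2 : ℝ) ^ (b + 1) ≤ (1 / 2) ^ (N + 1) :=
      pow_le_pow_of_le_one (by norm_num) (by norm_num) (by omega)
    have e3 : (1 / 2 : ℝ) ^ (N + 1) = (1 / 2) ^ N * (1 / 2) := pow_succ _ _
    have := dist_triangle_left (u (n a x)) (u (n b x)) (k x)
    linarith [hn a x, hn b x]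
  have h2 : Tendsto (fun j => u (n j x)) atTop (𝓝 (k x)) := by
    rw [tendsto_iff_dist_tendsto_zero]
    refine squeeze_zero (fun _ => dist_nonneg) (fun j => ?_)
      ((tendsto_add_atTop_iff_nat 1).2 hpow.tendsto_atTop_zero)
    rw [dist_comm]
    exact (hn j x).le
  obtain ⟨ns, hns, h3⟩ := (tendstoInMeasure_of_tendsto_Lp h2).exists_seq_tendsto_ae
  filter_upwards [h1, h3] with y hy1 hy3
  obtain ⟨l, hl⟩ := hy1
  rw [← tendsto_nhds_unique (hl.comp hns.tendsto_atTop) hy3]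
  exact hl.limUnder_eq

lemma Orthonormal.countable_of_separable {H ι : Type*} [NormedAddCommGroup H]
    [InnerProductSpace ℂ H] [TopologicalSpace.SeparableSpace H] {e : ι → H}
    (he : Orthonormal ℂ e) : Countable ι := by
  refine Pairwise.countable_of_isOpen_disjoint (s := fun i => Metric.ball (e i) (1 / 2))
    (fun i j hij => Metric.ball_disjoint_ball ?_) (fun _ => Metric.isOpen_ball)
    (fun _ => Metric.nonempty_ball.2 (by norm_num))
  have h : ‖e i - e j‖ ^ 2 = 2 := by
    rw [@norm_sub_sq ℂ, he.2 hij, he.1 i, he.1 j]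
    simp
    norm_num
  rw [dist_eq_norm]
  nlinarith [norm_nonneg (e i - e j)]

/-- Bessel's inequality for the pointwise evaluations of an operator from `L²` to `L^∞`. -/
lemma ae_sum_sq_le_of_bound {d : ℕ} {T : L2 d →L[ℂ] L2 d} {C : ℝ}
    (hT : ∀ φ, ∀ᵐ x, ‖T φ x‖ ≤ C * ‖φ‖) {ι : Type*} {e : ι → L2 d} (he : Orthonormal ℂ e)
    (s : Finset ι) : ∀ᵐ x, ∑ j ∈ s, ‖T (e j) x‖ ^ 2 ≤ C ^ 2 := by
  -- The exceptional null set depends on the linear combination of the `e j`, so only a countable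
  -- dense set of coefficients is used at first, and continuity gives the rest.
  let a : ℕ → (s → ℂ) := TopologicalSpace.denseSeq (s → ℂ)
  have h1 : ∀ᵐ x, ∀ n, ‖∑ j, a n j * T (e j) x‖ ≤ C * ‖∑ j, a n j • e j‖ := by
    refine ae_all_iff.2 fun n => ?_
    have e1 : T (∑ j, a n j • e j) = ∑ j, a n j • T (e j) := by simp
    have h2 : ∀ᵐ x, ∀ j, (a n j • T (e j)) x = a n j * T (e j) x :=
      ae_all_iff.2 fun j => Lp.coeFn_smul (a n j) (T (e j))
    filter_upwards [hT (∑ j, a n j • e j), h2,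
      Lp.coeFn_finsetSum Finset.univ fun j => a n j • T (e j)] with x k1 k2 k3
    rw [e1, k3, Finset.sum_apply] at k1
    simpa only [k2] using k1
  filter_upwards [h1] with x hx
  have h2 : ∀ b : s → ℂ, ‖∑ j, b j * T (e j) x‖ ≤ C * ‖∑ j, b j • e j‖ := by
    have hcl : IsClosed {b : s → ℂ | ‖∑ j, b j * T (e j) x‖ ≤ C * ‖∑ j, b j • e j‖} :=
      isClosed_le (by fun_prop) (by fun_prop)
    exact fun b => hcl.closure_subset_iff.2 (Set.range_subset_iff.2 hx)
      (TopologicalSpace.denseRange_denseSeq (s → ℂ) b)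
  -- The extremal coefficients for the bound on `|∑ bⱼ T eⱼ x|`.
  have h3 := h2 fun j => (starRingEnd ℂ) (T (e j) x)
  set S : ℝ := ∑ j ∈ s, ‖T (e j) x‖ ^ 2 with hS
  have hS0 : 0 ≤ S := Finset.sum_nonneg fun _ _ => by positivity
  have e1 : ‖∑ j : s, (starRingEnd ℂ) (T (e j) x) * T (e j) x‖ = S := by
    simp only [← Complex.normSq_eq_conj_mul_self, Complex.normSq_eq_norm_sq]
    rw [Finset.sum_coe_sort s fun j => ((‖T (e j) x‖ ^ 2 : ℝ) : ℂ), ← Complex.ofReal_sum,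
      Complex.norm_real, Real.norm_of_nonneg hS0]
  have e2 : ‖∑ j : s, (starRingEnd ℂ) (T (e j) x) • e j‖ ^ 2 = S := by
    rw [Finset.sum_coe_sort s fun j => (starRingEnd ℂ) (T (e j) x) • e j,
      ← re_inner_self, he.inner_sum]
    simp only [Complex.conj_conj, mul_comm (T (e _) x), ← Complex.normSq_eq_conj_mul_self,
      Complex.normSq_eq_norm_sq]
    rw [← Complex.ofReal_sum, Complex.ofReal_re]
  rw [e1] at h3
  set r := ‖∑ j : s, (starRingEnd ℂ) (T (e j) x) • e j‖ with hr
  rw [← e2] at h3 ⊢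
  have hr0 : 0 ≤ r := norm_nonneg _
  rcases hr0.eq_or_lt with h | h
  · rw [← h, zero_pow two_ne_zero]
    positivity
  · have : r ≤ C := by nlinarith
    exact pow_le_pow_left₀ hr0 this 2

/-- An operator from `L²` to `L^∞` is given by pairing with a measurable family in `L²`. -/
lemma exists_stronglyMeasurable_inner {d : ℕ} {T : L2 d →L[ℂ] L2 d} {C : ℝ}
    (hT : ∀ φ, ∀ᵐ x, ‖T φ x‖ ≤ C * ‖φ‖) :
    ∃ k : Rd d → L2 d, StronglyMeasurable k ∧ ∀ φ, ∀ᵐ x, T φ x = ⟪k x, φ⟫_ℂ := by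
  obtain ⟨ι, e, -⟩ := exists_hilbertBasis ℂ (L2 d)
  have : Countable ι := e.orthonormal.countable_of_separable
  let F : Finset ι → Rd d → L2 d := fun s x => ∑ j ∈ s, (starRingEnd ℂ) (T (e j) x) • e j
  have hF : ∀ s, AEStronglyMeasurable (F s) volume := fun s =>
    Finset.aestronglyMeasurable_fun_sum s fun j _ =>
      (Complex.continuous_conj.comp_aestronglyMeasurable
        (Lp.aestronglyMeasurable (T (e j)))).smul_const (e j)
  have hb : ∀ᵐ x, ∀ s : Finset ι, ∑ j ∈ s, ‖T (e j) x‖ ^ 2 ≤ C ^ 2 :=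
    ae_all_iff.2 fun s => ae_sum_sq_le_of_bound hT e.orthonormal s
  have hlim : ∀ᵐ x, ∃ l, Tendsto (fun s => F s x) atTop (𝓝 l) := by
    filter_upwards [hb] with x hx
    have hm : Memℓp (fun j => (starRingEnd ℂ) (T (e j) x)) 2 := memℓp_gen' (C := C ^ 2) fun s => by
      simpa using hx s
    exact ⟨_, e.hasSum_repr_symm ⟨_, hm⟩⟩
  have hlim' : ∀ᵐ x, Tendsto (fun s => F s x) atTop (𝓝 (limUnder atTop fun s => F s x)) := by
    filter_upwards [hlim] with x hx using tendsto_nhds_limUnder hx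
  have hm := aestronglyMeasurable_of_tendsto_ae atTop hF hlim'
  refine ⟨hm.mk, hm.stronglyMeasurable_mk, fun φ => ?_⟩
  set k := hm.mk with hkd
  have hk : ∀ᵐ x, Tendsto (fun s => F s x) atTop (𝓝 (k x)) := by
    filter_upwards [hlim', hm.ae_eq_mk] with x hx h
    rwa [hkd, ← h]
  let P : Finset ι → L2 d := fun s => ∑ j ∈ s, ⟪e j, φ⟫_ℂ • e j
  have hP : Tendsto P atTop (𝓝 φ) := by
    have := e.hasSum_repr φ
    simp only [e.repr_apply_apply] at this
    exact this
  have h1 : ∀ᵐ x, ∀ s : Finset ι, T (P s) x = ⟪F s x, φ⟫_ℂ := by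
    refine ae_all_iff.2 fun s => ?_
    have e1 : T (P s) = ∑ j ∈ s, ⟪e j, φ⟫_ℂ • T (e j) := by simp [P]
    have h2 : ∀ᵐ x, ∀ j, (⟪e j, φ⟫_ℂ • T (e j)) x = ⟪e j, φ⟫_ℂ * T (e j) x :=
      ae_all_iff.2 fun j => Lp.coeFn_smul _ (T (e j))
    filter_upwards [h2, Lp.coeFn_finsetSum s fun j => ⟪e j, φ⟫_ℂ • T (e j)] with x k2 k3
    rw [e1, k3, Finset.sum_apply, sum_inner]
    refine Finset.sum_congr rfl fun j _ => ?_
    rw [k2, inner_smul_left, Complex.conj_conj, mul_comm]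
  have h2 : ∀ᵐ x, ∀ s : Finset ι, ‖T (P s) x - T φ x‖ ≤ C * ‖P s - φ‖ := by
    refine ae_all_iff.2 fun s => ?_
    filter_upwards [hT (P s - φ), Lp.coeFn_sub (T (P s)) (T φ)] with x k1 k2
    rwa [map_sub, k2] at k1
  filter_upwards [h1, h2, hk] with x k1 k2 k3
  have t1 : Tendsto (fun s => T (P s) x) atTop (𝓝 ⟪k x, φ⟫_ℂ) := by
    simp only [k1]
    exact k3.inner tendsto_const_nhds
  have t2 : Tendsto (fun s => T (P s) x) atTop (𝓝 (T φ x)) := by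
    rw [tendsto_iff_norm_sub_tendsto_zero]
    refine squeeze_zero (fun _ => norm_nonneg _) k2 ?_
    simpa using (tendsto_iff_norm_sub_tendsto_zero.1 hP).const_mul C
  exact tendsto_nhds_unique t2 t1

lemma exists_isNonneg_coeFn_eq {d : ℕ} (φ : L2 d) {g : ℂ → ℝ} (hg : Continuous g)
    (h0 : ∀ z, 0 ≤ g z) (h1 : ∀ z, g z ≤ ‖z‖) :
    ∃ a : L2 d, IsNonneg a ∧ ∀ᵐ x, a x = (g (φ x) : ℂ) := by
  have hm : MemLp (fun x => (g (φ x) : ℂ)) 2 volume := by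
    refine (Lp.memLp φ).of_le
      ((Complex.continuous_ofReal.comp hg).comp_aestronglyMeasurable (Lp.aestronglyMeasurable φ))
      (Eventually.of_forall fun x => ?_)
    rw [Complex.norm_real, Real.norm_of_nonneg (h0 _)]
    exact h1 _
  refine ⟨hm.toLp, ?_, hm.coeFn_toLp⟩
  filter_upwards [hm.coeFn_toLp] with x hx
  rw [hx]
  exact ⟨h0 _, rfl⟩

/-- Every function in `L²` is a combination of four nonnegative ones. -/
lemma exists_isNonneg_decomposition {d : ℕ} (φ : L2 d) :
    ∃ a b c e : L2 d, IsNonneg a ∧ IsNonneg b ∧ IsNonneg c ∧ IsNonneg e ∧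
      φ = (a - b) + Complex.I • (c - e) ∧ star φ = (a - b) + (-Complex.I) • (c - e) := by
  obtain ⟨a, ha, ha'⟩ := exists_isNonneg_coeFn_eq φ (g := fun z => max z.re 0) (by fun_prop)
    (fun _ => le_max_right _ _) fun z => max_le (Complex.re_le_norm z) (norm_nonneg z)
  obtain ⟨b, hb, hb'⟩ := exists_isNonneg_coeFn_eq φ (g := fun z => max (-z.re) 0) (by fun_prop)
    (fun _ => le_max_right _ _) fun z =>
      max_le ((neg_le_abs _).trans (Complex.abs_re_le_norm z)) (norm_nonneg z)
  obtain ⟨c, hc, hc'⟩ := exists_isNonneg_coeFn_eq φ (g := fun z => max z.im 0) (by fun_prop)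
    (fun _ => le_max_right _ _) fun z => max_le (Complex.im_le_norm z) (norm_nonneg z)
  obtain ⟨e, he, he'⟩ := exists_isNonneg_coeFn_eq φ (g := fun z => max (-z.im) 0) (by fun_prop)
    (fun _ => le_max_right _ _) fun z =>
      max_le ((neg_le_abs _).trans (Complex.abs_im_le_norm z)) (norm_nonneg z)
  have hmax : ∀ t : ℝ, max t 0 - max (-t) 0 = t := fun t => by
    rcases le_total t 0 with h | h
    · rw [max_eq_right h, max_eq_left (by linarith)]; ring
    · rw [max_eq_left h, max_eq_right (by linarith)]; ring
  refine ⟨a, b, c, e, ha, hb, hc, he, Lp.ext ?_, Lp.ext ?_⟩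
  · filter_upwards [ha', hb', hc', he', Lp.coeFn_add (a - b) (Complex.I • (c - e)),
      Lp.coeFn_sub a b, Lp.coeFn_smul Complex.I (c - e), Lp.coeFn_sub c e]
      with x h1 h2 h3 h4 h5 h6 h7 h8
    rw [h5, Pi.add_apply, h6, h7, Pi.smul_apply, Pi.sub_apply, h8, Pi.sub_apply, h1, h2, h3, h4,
      ← Complex.ofReal_sub, ← Complex.ofReal_sub, hmax, hmax, smul_eq_mul, mul_comm,
      Complex.re_add_im]
  · filter_upwards [ha', hb', hc', he', Lp.coeFn_add (a - b) ((-Complex.I) • (c - e)),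
      Lp.coeFn_sub a b, Lp.coeFn_smul (-Complex.I) (c - e), Lp.coeFn_sub c e, Lp.coeFn_star φ]
      with x h1 h2 h3 h4 h5 h6 h7 h8 h9
    rw [h9, h5, Pi.add_apply, h6, h7, Pi.smul_apply, Pi.sub_apply, h8, Pi.sub_apply, h1, h2, h3,
      h4,
      ← Complex.ofReal_sub, ← Complex.ofReal_sub, hmax, hmax, smul_eq_mul, Pi.star_apply]
    apply Complex.ext <;> simp

lemma IsNonneg.conj {d : ℕ} {u : L2 d} (hu : IsNonneg u) :
    ∀ᵐ x, (starRingEnd ℂ) (u x) = u x := by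
  filter_upwards [hu] with x hx
  exact Complex.conj_eq_iff_im.2 hx.2

/-- A positivity preserving operator commutes with complex conjugation. -/
lemma PreservesNonneg.map_star {d : ℕ} {T : L2 d →L[ℂ] L2 d} (hT : PreservesNonneg T) (φ : L2 d) :
    ∀ᵐ x, T (star φ) x = (starRingEnd ℂ) (T φ x) := by
  obtain ⟨a, b, c, e, ha, hb, hc, he, h1, h2⟩ := exists_isNonneg_decomposition φ
  rw [h2, h1, map_add, map_add, map_smul, map_smul, map_sub, map_sub]
  filter_upwards [(hT a ha).conj, (hT b hb).conj, (hT c hc).conj, (hT e he).conj,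
    Lp.coeFn_add (T a - T b) (Complex.I • (T c - T e)),
    Lp.coeFn_add (T a - T b) ((-Complex.I) • (T c - T e)),
    Lp.coeFn_sub (T a) (T b), Lp.coeFn_smul Complex.I (T c - T e),
    Lp.coeFn_smul (-Complex.I) (T c - T e), Lp.coeFn_sub (T c) (T e)]
    with x k1 k2 k3 k4 k5 k6 k7 k8 k9 k10
  simp only [k5, k6, Pi.add_apply, k7, k8, k9, Pi.smul_apply, k10, Pi.sub_apply, smul_eq_mul,
    map_add, map_mul, map_sub, k1, k2, k3, k4, Complex.conj_I]

lemma memLp_top_add {d : ℕ} {u v : L2 d} (hu : MemLp u ⊤ volume) (hv : MemLp v ⊤ volume) :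
    MemLp (u + v : L2 d) ⊤ volume := (memLp_congr_ae (Lp.coeFn_add u v)).2 (hu.add hv)

lemma memLp_top_sub {d : ℕ} {u v : L2 d} (hu : MemLp u ⊤ volume) (hv : MemLp v ⊤ volume) :
    MemLp (u - v : L2 d) ⊤ volume := (memLp_congr_ae (Lp.coeFn_sub u v)).2 (hu.sub hv)

lemma memLp_top_smul {d : ℕ} {u : L2 d} (hu : MemLp u ⊤ volume) (c : ℂ) :
    MemLp (c • u : L2 d) ⊤ volume := (memLp_congr_ae (Lp.coeFn_smul c u)).2 (hu.const_smul c)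

/-- For `u ≥ 0` the difference lies between `0` and `exp (-(β H₀)) u`; a general `φ` is a
combination of four nonnegative functions. -/
lemma memLp_top_heatDifference {d : ℕ} (U : Rd d → ℝ≥0∞) {β : ℝ} (hβ : 0 < β) (φ : L2 d) :
    MemLp (heatDifference U β φ) ⊤ volume := by
  have key : ∀ u : L2 d, IsNonneg u → MemLp (heatDifference U β u) ⊤ volume := fun u hu => by
    refine (memLp_top_heatSemigroup_zero hβ u).of_le (Lp.aestronglyMeasurable _) ?_
    have hD : heatDifference U β u = heatSemigroup 0 β u - heatSemigroup U β u := rfl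
    filter_upwards [preservesNonneg_heatDifference U hβ u hu,
      preservesNonneg_heatSemigroup U hβ u hu,
      preservesNonneg_heatSemigroup 0 hβ u hu,
      Lp.coeFn_sub (heatSemigroup 0 β u) (heatSemigroup U β u)] with x h1 h2 h3 h4
    rw [← hD] at h4
    have e : ∀ z : ℂ, 0 ≤ z.re ∧ z.im = 0 → ‖z‖ = z.re := fun z hz => by
      rw [Complex.norm_eq_sqrt_sq_add_sq, hz.2]
      simp [Real.sqrt_sq hz.1]
    rw [e _ h1, e _ h3, h4, Pi.sub_apply, Complex.sub_re]
    linarith [h2.1]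
  obtain ⟨a, b, c, e, ha, hb, hc, he, h1, -⟩ := exists_isNonneg_decomposition φ
  rw [h1, map_add, map_smul, map_sub, map_sub]
  exact memLp_top_add (memLp_top_sub (key a ha) (key b hb))
    (memLp_top_smul (memLp_top_sub (key c hc) (key e he)) _)

/-- A positivity preserving operator from `L²` to `L^∞` has a real integral kernel. -/
lemma exists_isIntegralKernel {d : ℕ} {T : L2 d →L[ℂ] L2 d} (hTp : PreservesNonneg T)
    (hT : ∀ φ, MemLp (T φ) ⊤ volume) : ∃ K, IsIntegralKernel T K := by
  obtain ⟨C, -, hTb⟩ := exists_bound_of_memLp_top T hT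
  obtain ⟨k, hkm, hk⟩ := exists_stronglyMeasurable_inner hTb
  obtain ⟨K, hKm, hK⟩ := exists_measurable_uncurry hkm
  -- Since `T` commutes with complex conjugation, both `K` and its conjugate represent `T`, and so
  -- does the real part.
  refine ⟨fun p => (K p).re, (Complex.measurable_re.comp hKm).aestronglyMeasurable, fun φ => ?_⟩
  filter_upwards [hk φ, hk (star φ), hTp.map_star φ] with x h1 h2 h3
  have i1 : Integrable (fun y => (starRingEnd ℂ) (K (x, y)) * φ y) := by
    refine (L2.integrable_inner (𝕜 := ℂ) (k x) φ).congr ?_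
    filter_upwards [hK x] with y hy
    rw [RCLike.inner_apply, hy, mul_comm]
  have i2 : Integrable (fun y => K (x, y) * φ y) := by
    refine ((L2.integrable_inner (𝕜 := ℂ) (star φ) (k x))).congr ?_
    filter_upwards [hK x, Lp.coeFn_star φ] with y hy hs
    rw [RCLike.inner_apply, hy, hs, Pi.star_apply, ← starRingEnd_apply, Complex.conj_conj]
  have e1 : T φ x = ∫ y, (starRingEnd ℂ) (K (x, y)) * φ y := by
    rw [h1, L2.inner_def]
    refine integral_congr_ae ?_
    filter_upwards [hK x] with y hy
    rw [RCLike.inner_apply, hy, mul_comm]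
  have e2 : T φ x = ∫ y, K (x, y) * φ y := by
    rw [← Complex.conj_conj (T φ x), ← h3, h2, inner_conj_symm, L2.inner_def]
    refine integral_congr_ae ?_
    filter_upwards [hK x, Lp.coeFn_star φ] with y hy hs
    rw [RCLike.inner_apply, hy, hs, Pi.star_apply, ← starRingEnd_apply, Complex.conj_conj]
  have e3 : (fun y => ((K (x, y)).re : ℂ) * φ y)
      = fun y => (1 / 2 : ℂ) * ((starRingEnd ℂ) (K (x, y)) * φ y + K (x, y) * φ y) := by
    funext y
    rw [Complex.re_eq_add_conj]
    ring
  rw [e3]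
  refine ⟨(i1.add i2).const_mul _, ?_⟩
  rw [integral_const_mul, integral_add i1 i2, ← e1, ← e2]
  ring

/-- An integrable function with nonnegative integral over each set of a dense family is
nonnegative. -/
lemma ae_nonneg_of_measureDense {X : Type*} [MeasurableSpace X] {ν : Measure X} [IsFiniteMeasure ν]
    {𝒜 : Set (Set X)} (h𝒜 : ν.MeasureDense 𝒜) {f : X → ℝ} (hf : Integrable f ν)
    (h : ∀ t ∈ 𝒜, 0 ≤ ∫ x in t, f x ∂ν) : 0 ≤ᵐ[ν] f := by
  refine ae_nonneg_of_forall_setIntegral_nonneg hf fun s hs _ => ?_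
  have hpos : ∀ n : ℕ, (0 : ℝ) < 1 / (n + 1) := fun n => Nat.one_div_pos_of_nat
  choose t ht hst using fun n : ℕ => h𝒜.approx s hs (measure_ne_top ν s) _ (hpos n)
  have hlim : Tendsto (fun n : ℕ => ENNReal.ofReal (1 / ((n : ℝ) + 1))) atTop (𝓝 0) := by
    simpa using! ENNReal.tendsto_ofReal tendsto_one_div_add_atTop_nhds_zero_nat
  have l1 : Tendsto (ν ∘ fun n => s \ t n) atTop (𝓝 0) :=
    tendsto_of_tendsto_of_tendsto_of_le_of_le tendsto_const_nhds hlim (fun _ => zero_le)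
      fun n => (measure_mono subset_union_left).trans (hst n).le
  have l2 : Tendsto (ν ∘ fun n => t n \ s) atTop (𝓝 0) :=
    tendsto_of_tendsto_of_tendsto_of_le_of_le tendsto_const_nhds hlim (fun _ => zero_le)
      fun n => (measure_mono subset_union_right).trans (hst n).le
  have l3 := (hf.tendsto_setIntegral_nhds_zero l1).sub (hf.tendsto_setIntegral_nhds_zero l2)
  have l4 : Tendsto (fun n => ∫ x in t n, f x ∂ν) atTop (𝓝 (∫ x in s, f x ∂ν)) := by
    have := (tendsto_const_nhds (x := ∫ x in s, f x ∂ν)).sub l3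
    rw [sub_zero, sub_zero] at this
    refine this.congr fun n => ?_
    have e1 := integral_inter_add_sdiff (h𝒜.measurable _ (ht n)) hf.integrableOn (s := s) (μ := ν)
    have e2 := integral_inter_add_sdiff hs hf.integrableOn (s := t n) (μ := ν)
    rw [inter_comm] at e2
    linarith
  exact ge_of_tendsto' l4 fun n => h _ (ht n)

/-- The kernel of a positivity preserving operator is nonnegative. -/
lemma IsIntegralKernel.nonneg {d : ℕ} {T : L2 d →L[ℂ] L2 d} (hT : PreservesNonneg T)
    {K : Rd d × Rd d → ℝ} (hK : IsIntegralKernel T K) :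
    ∀ᵐ p ∂(volume.prod volume), 0 ≤ K p := by
  have hb : ∀ n : ℕ, IsFiniteMeasure ((volume : Measure (Rd d)).restrict (Metric.ball 0 n)) :=
    fun n => isFiniteMeasure_restrict.2 measure_ball_lt_top.ne
  choose 𝒜 hc h𝒜 using fun n : ℕ =>
    exists_countable_measureDense ((volume : Measure (Rd d)).restrict (Metric.ball 0 n))
  -- Testing with indicators only gives a null set for each `s`; countable families which are dense
  -- in the measurable subsets of each ball make the null set independent of `s`.
  have key : ∀ s : Set (Rd d), MeasurableSet s → volume s ≠ ⊤ →
      ∀ᵐ x, IntegrableOn (fun y => K (x, y)) s ∧ 0 ≤ ∫ y in s, K (x, y) := by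
    intro s hs hs'
    have hn : IsNonneg (indicatorConstLp 2 hs hs' (1 : ℂ)) := by
      filter_upwards [indicatorConstLp_coeFn (p := 2) (hs := hs) (hμs := hs') (c := (1 : ℂ))]
        with x hx
      rw [hx]
      by_cases h : x ∈ s <;> simp [h]
    filter_upwards [hK.2 (indicatorConstLp 2 hs hs' (1 : ℂ)), hT _ hn] with x h1 h2
    have e : (fun y => (K (x, y) : ℂ) * indicatorConstLp 2 hs hs' (1 : ℂ) y) =ᵐ[volume]
        fun y => ((s.indicator (fun y => K (x, y)) y : ℝ) : ℂ) := by
      filter_upwards [indicatorConstLp_coeFn (p := 2) (hs := hs) (hμs := hs') (c := (1 : ℂ))]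
        with y hy
      rw [hy]
      by_cases h : y ∈ s <;> simp [h]
    have i1 := h1.1.congr e
    have i2 : Integrable (s.indicator fun y => K (x, y)) := by simpa using! i1.re
    refine ⟨(integrable_indicator_iff hs).1 i2, ?_⟩
    rw [h1.2, integral_congr_ae e, integral_complex_ofReal, integral_indicator hs,
      Complex.ofReal_re] at h2
    exact h2.1
  have h1 : ∀ᵐ x, ∀ n : ℕ, IntegrableOn (fun y => K (x, y)) (Metric.ball 0 n) := by
    refine ae_all_iff.2 fun n => ?_
    filter_upwards [key _ Metric.isOpen_ball.measurableSet measure_ball_lt_top.ne] with x hx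
    exact hx.1
  have h2 : ∀ᵐ x, ∀ n : ℕ, ∀ t ∈ 𝒜 n, 0 ≤ ∫ y in t ∩ Metric.ball 0 n, K (x, y) := by
    refine ae_all_iff.2 fun n => (ae_ball_iff (hc n)).2 fun t ht => ?_
    have hm := (h𝒜 n).measurable t ht
    filter_upwards [key (t ∩ Metric.ball 0 n) (hm.inter Metric.isOpen_ball.measurableSet)
      ((measure_mono inter_subset_right).trans_lt measure_ball_lt_top).ne] with x hx
    exact hx.2
  have h3 : ∀ᵐ x, ∀ᵐ y, 0 ≤ K (x, y) := by
    filter_upwards [h1, h2] with x k1 k2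
    have k3 : ∀ n : ℕ, ∀ᵐ y, y ∈ Metric.ball (0 : Rd d) n → 0 ≤ K (x, y) := fun n => by
      rw [← ae_restrict_iff' Metric.isOpen_ball.measurableSet]
      refine ae_nonneg_of_measureDense (h𝒜 n) (k1 n) fun t ht => ?_
      rw [Measure.restrict_restrict ((h𝒜 n).measurable t ht)]
      exact k2 n t ht
    filter_upwards [ae_all_iff.2 k3] with y hy
    obtain ⟨n, hn⟩ := exists_nat_gt ‖y‖
    exact hy n (mem_ball_zero_iff.2 hn)
  have h4 := hK.1.ae_eq_mk
  have h5 : ∀ᵐ p ∂(volume.prod volume), 0 ≤ hK.1.mk K p := by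
    rw [Measure.ae_prod_iff_ae_ae (measurableSet_le measurable_const
      hK.1.stronglyMeasurable_mk.measurable)]
    filter_upwards [h3, Measure.ae_ae_of_ae_prod h4] with x k1 k2
    filter_upwards [k1, k2] with y m1 m2
    rwa [← m2]
  filter_upwards [h4, h5] with p k1 k2
  rwa [k1]

/-! ### Schwartz functions under the Hamiltonian, and cutoffs -/

/-- The free Hamiltonian `-2Δ` on Schwartz functions. -/
def schwartzHamiltonian {d : ℕ} (ψ : 𝓢(Rd d, ℂ)) : 𝓢(Rd d, ℂ) :=
  (-2 : ℂ) • Laplacian.laplacian ψ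

lemma lineDeriv_apply_eq_zero {d : ℕ} {ψ : 𝓢(Rd d, ℂ)} {O : Set (Rd d)} (hO : IsOpen O) {c : ℂ}
    (h : ∀ x ∈ O, ψ x = c) (e : Rd d) {x : Rd d} (hx : x ∈ O) : (∂_{e} ψ) x = 0 := by
  have h1 : (ψ : Rd d → ℂ) =ᶠ[𝓝 x] fun _ => c := by
    filter_upwards [hO.mem_nhds hx] with y hy using h y hy
  rw [SchwartzMap.lineDerivOp_apply_eq_fderiv, h1.fderiv_eq]
  simp

/-- The Hamiltonian is local. -/
lemma schwartzHamiltonian_apply_eq_zero {d : ℕ} {ψ : 𝓢(Rd d, ℂ)} {O : Set (Rd d)} (hO : IsOpen O)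
    {c : ℂ} (h : ∀ x ∈ O, ψ x = c) {x : Rd d} (hx : x ∈ O) : schwartzHamiltonian ψ x = 0 := by
  rw [schwartzHamiltonian, laplacian_schwartz_eq_sum, smul_apply, sum_apply,
    Finset.sum_eq_zero, smul_zero]
  exact fun i _ => lineDeriv_apply_eq_zero hO (fun y hy => lineDeriv_apply_eq_zero hO h _ hy) _ hx

lemma iterate_schwartzHamiltonian_apply_eq_zero {d : ℕ} {ψ : 𝓢(Rd d, ℂ)} {O : Set (Rd d)}
    (hO : IsOpen O) (h : ∀ x ∈ O, ψ x = 0) (k : ℕ) {x : Rd d} (hx : x ∈ O) :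
    schwartzHamiltonian^[k] ψ x = 0 := by
  induction k generalizing x with
  | zero => exact h x hx
  | succ k ih =>
    rw [Function.iterate_succ_apply']
    exact schwartzHamiltonian_apply_eq_zero hO (fun y hy => ih hy) hx

lemma toLp_sub {d : ℕ} (ψ χ : 𝓢(Rd d, ℂ)) :
    ((ψ - χ).toLp 2 : L2 d) = ψ.toLp 2 volume - χ.toLp 2 volume :=
  map_sub (SchwartzMap.toLpCLM ℂ (E := Rd d) ℂ 2 volume) _ _

lemma toLp_smul {d : ℕ} (c : ℂ) (ψ : 𝓢(Rd d, ℂ)) :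
    ((c • ψ).toLp 2 : L2 d) = c • ψ.toLp 2 volume :=
  map_smul (SchwartzMap.toLpCLM ℂ (E := Rd d) ℂ 2 volume) _ _

lemma schwartzHamiltonian_sub {d : ℕ} (ψ χ : 𝓢(Rd d, ℂ)) :
    schwartzHamiltonian (ψ - χ) = schwartzHamiltonian ψ - schwartzHamiltonian χ := by
  rw [schwartzHamiltonian, schwartzHamiltonian, schwartzHamiltonian, ← smul_sub]
  congr 1
  simp only [← SchwartzMap.laplacianCLM_eq (𝕜 := ℂ), map_sub]

lemma memH1_schwartz {d : ℕ} (ψ : 𝓢(Rd d, ℂ)) : MemH1 (ψ.toLp 2 : L2 d) :=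
  ⟨_, isWeakGradient_schwartz ψ⟩

lemma two_mul_sum_inner_weakGradient {d : ℕ} {v : L2 d} (hv : MemH1 v) (ψ : 𝓢(Rd d, ℂ)) :
    2 * ∑ i, ⟪weakGradient v i, weakGradient (ψ.toLp 2 : L2 d) i⟫_ℂ
      = ⟪v, (schwartzHamiltonian ψ).toLp 2⟫_ℂ := by
  rw [hv.sum_inner_weakGradient, schwartzHamiltonian, toLp_smul, inner_smul_right]
  ring

/-- A Schwartz function which vanishes where the potential does not is in the operator domain. -/
lemma isHamiltonian_schwartz {d : ℕ} {U : Rd d → ℝ≥0∞} (hU : Measurable U) {ψ : 𝓢(Rd d, ℂ)}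
    (hψ : ∀ x, U x ≠ 0 → ψ x = 0) :
    IsHamiltonian U (ψ.toLp 2) ((schwartzHamiltonian ψ).toLp 2) := by
  have h0 : ((ψ.toLp 2 : L2 d) : Rd d → ℂ) =ᵐ[volume.withDensity U] 0 := by
    refine (ae_withDensity_iff hU).2 ?_
    filter_upwards [ψ.coeFn_toLp 2] with x hx hUx
    rw [hx, hψ x hUx, Pi.zero_apply]
  refine isHamiltonian_of_form ⟨memH1_schwartz ψ, (memLp_congr_ae h0).2 MemLp.zero⟩ fun v hv => ?_
  rw [schrodingerForm, two_mul_sum_inner_weakGradient hv.1, integral_eq_zero_of_ae, add_zero]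
  filter_upwards [h0] with x hx
  rw [hx, Pi.zero_apply, mul_zero]

/-- The dilated Schwartz function `x ↦ ψ (c x)`. -/
def dilate {d : ℕ} {c : ℝ} (hc : c ≠ 0) (ψ : 𝓢(Rd d, ℂ)) : 𝓢(Rd d, ℂ) :=
  SchwartzMap.compCLMOfContinuousLinearEquiv ℂ
    (ContinuousLinearEquiv.smulLeft (R₁ := ℝ) (M₁ := Rd d) (Units.mk0 c hc)) ψ

section dilate

variable {d : ℕ} {c : ℝ} (hc : c ≠ 0)

lemma dilate_apply (ψ : 𝓢(Rd d, ℂ)) (x : Rd d) : dilate hc ψ x = ψ (c • x) := rfl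

lemma lineDeriv_dilate (ψ : 𝓢(Rd d, ℂ)) (e : Rd d) :
    ∂_{e} (dilate hc ψ) = (c : ℂ) • dilate hc (∂_{e} ψ) := by
  ext x
  have h : HasFDerivAt (fun x : Rd d => ψ (c • x))
      ((fderiv ℝ ψ (c • x)).comp (c • ContinuousLinearMap.id ℝ (Rd d))) x :=
    (ψ.hasFDerivAt (c • x)).comp x ((hasFDerivAt_id x).const_smul c)
  rw [SchwartzMap.lineDerivOp_apply_eq_fderiv, smul_apply, dilate_apply,
    SchwartzMap.lineDerivOp_apply_eq_fderiv]
  have h2 : (dilate hc ψ : Rd d → ℂ) = fun x => ψ (c • x) := rfl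
  rw [h2, h.fderiv]
  simp

lemma schwartzHamiltonian_dilate (ψ : 𝓢(Rd d, ℂ)) :
    schwartzHamiltonian (dilate hc ψ) = ((c ^ 2 : ℝ) : ℂ) • dilate hc (schwartzHamiltonian ψ) := by
  ext x
  simp only [schwartzHamiltonian, laplacian_schwartz_eq_sum, lineDeriv_dilate,
    LineDeriv.lineDerivOp_smul, smul_apply, sum_apply, dilate_apply,
    smul_eq_mul, Finset.mul_sum]
  refine Finset.sum_congr rfl fun i _ => ?_
  push_cast
  ring

lemma schwartzHamiltonian_smul (a : ℂ) (ψ : 𝓢(Rd d, ℂ)) :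
    schwartzHamiltonian (a • ψ) = a • schwartzHamiltonian ψ := by
  rw [schwartzHamiltonian, schwartzHamiltonian, smul_comm a]
  congr 1
  simp only [← SchwartzMap.laplacianCLM_eq (𝕜 := ℂ), map_smul]

lemma iterate_schwartzHamiltonian_dilate (ψ : 𝓢(Rd d, ℂ)) (k : ℕ) :
    schwartzHamiltonian^[k] (dilate hc ψ)
      = ((c ^ (2 * k) : ℝ) : ℂ) • dilate hc (schwartzHamiltonian^[k] ψ) := by
  induction k with
  | zero => simp
  | succ k ih =>
    rw [Function.iterate_succ_apply', ih, schwartzHamiltonian_smul, schwartzHamiltonian_dilate,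
      smul_smul, ← Complex.ofReal_mul, ← pow_add, Function.iterate_succ_apply']
    rfl

lemma norm_toLp_sq (ψ : 𝓢(Rd d, ℂ)) : ‖(ψ.toLp 2 : L2 d)‖ ^ 2 = ∫ x, ‖ψ x‖ ^ 2 := by
  have h : ((∫ x, ‖ψ x‖ ^ 2 : ℝ) : ℂ) = ⟪(ψ.toLp 2 : L2 d), ψ.toLp 2⟫_ℂ := by
    rw [L2.inner_def, ← integral_complex_ofReal]
    refine integral_congr_ae ?_
    filter_upwards [ψ.coeFn_toLp 2] with x hx
    rw [hx, inner_self_eq_norm_sq_to_K]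
    norm_cast
  rw [← re_inner_self, ← h, Complex.ofReal_re]

lemma norm_toLp_dilate_sq (ψ : 𝓢(Rd d, ℂ)) (hc0 : 0 < c) :
    ‖((dilate hc ψ).toLp 2 : L2 d)‖ ^ 2 = (c ^ d)⁻¹ * ‖(ψ.toLp 2 : L2 d)‖ ^ 2 := by
  rw [norm_toLp_sq, norm_toLp_sq]
  simp only [dilate_apply]
  rw [Measure.integral_comp_smul_of_nonneg volume (fun x : Rd d => ‖ψ x‖ ^ 2) c (hR := hc0.le)]
  simp

end dilate

/-- A smooth bump function, equal to `1` on the unit ball and supported in the ball of radius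
`2`. -/
def unitBump (d : ℕ) : ContDiffBump (0 : Rd d) := ⟨1, 2, one_pos, one_lt_two⟩

/-- The smooth bump function as a Schwartz function. -/
def unitCutoff (d : ℕ) : 𝓢(Rd d, ℂ) :=
  HasCompactSupport.toSchwartzMap (f := fun x => (unitBump d x : ℂ))
    ((unitBump d).hasCompactSupport.comp_left Complex.ofReal_zero)
    (Complex.ofRealCLM.contDiff.comp (unitBump d).contDiff)

/-- The smooth cutoff equal to `1` on the ball of radius `n + 1` and supported in the ball of
radius `2 (n + 1)`. -/
def cutoff (d n : ℕ) : 𝓢(Rd d, ℂ) :=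
  dilate (c := ((n : ℝ) + 1)⁻¹) (by positivity) (unitCutoff d)

section cutoff

variable {d : ℕ} (n : ℕ)

lemma cutoff_apply (x : Rd d) :
    cutoff d n x = (unitBump d (((n : ℝ) + 1)⁻¹ • x) : ℂ) := rfl

lemma cutoff_eq_one {x : Rd d} (hx : ‖x‖ ≤ n + 1) : cutoff d n x = 1 := by
  have hn : (0 : ℝ) < n + 1 := by positivity
  rw [cutoff_apply, (unitBump d).one_of_mem_closedBall, Complex.ofReal_one]
  rw [mem_closedBall_zero_iff, norm_smul, Real.norm_of_nonneg (by positivity)]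
  change _ ≤ (1 : ℝ)
  rwa [inv_mul_le_iff₀ hn, mul_one]

lemma cutoff_eq_zero {x : Rd d} (hx : 2 * ((n : ℝ) + 1) ≤ ‖x‖) : cutoff d n x = 0 := by
  have hn : (0 : ℝ) < n + 1 := by positivity
  rw [cutoff_apply, (unitBump d).zero_of_le_dist, Complex.ofReal_zero]
  rw [dist_zero_right, norm_smul, Real.norm_of_nonneg (by positivity)]
  change (2 : ℝ) ≤ _
  rwa [le_inv_mul_iff₀ hn, mul_comm]

lemma schwartzHamiltonian_cutoff_eq_zero {x : Rd d} (hx : ‖x‖ < n + 1) :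
    schwartzHamiltonian (cutoff d n) x = 0 :=
  schwartzHamiltonian_apply_eq_zero (O := Metric.ball 0 (n + 1)) Metric.isOpen_ball
    (fun _ hy => cutoff_eq_one n (mem_ball_zero_iff.1 hy).le) (mem_ball_zero_iff.2 hx)

lemma schwartzHamiltonian_cutoff_eq_zero' {x : Rd d} (hx : 2 * ((n : ℝ) + 1) < ‖x‖) :
    schwartzHamiltonian (cutoff d n) x = 0 := by
  refine schwartzHamiltonian_apply_eq_zero (O := (Metric.closedBall 0 (2 * ((n : ℝ) + 1)))ᶜ)
    Metric.isClosed_closedBall.isOpen_compl (fun y hy => cutoff_eq_zero n ?_) ?_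
  · rw [Set.mem_compl_iff, mem_closedBall_zero_iff, not_le] at hy
    exact hy.le
  · rw [Set.mem_compl_iff, mem_closedBall_zero_iff, not_le]
    exact hx

lemma mul_inv_mul_sq_le {a b x y c : ℝ} {d k : ℕ} (hc : 0 < c) (hc1 : c ≤ 1) (ha : 0 ≤ a)
    (hb : 0 ≤ b) (h1 : x ^ 2 = (c ^ d)⁻¹ * a ^ 2)
    (h2 : y ^ 2 = (c ^ (2 * (d + k))) ^ 2 * ((c ^ d)⁻¹ * b ^ 2)) : x * y ≤ a * b * c ^ k := by
  refine abs_le_of_sq_le_sq' ?_ (by positivity) |>.2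
  have hcd : c ^ d ≠ 0 := by positivity
  have e : (c ^ d)⁻¹ * a ^ 2 * ((c ^ (2 * (d + k))) ^ 2 * ((c ^ d)⁻¹ * b ^ 2))
      = (a * b * c ^ k) ^ 2 * (c ^ d * c ^ k) ^ 2 := by
    have e1 : c ^ (2 * (d + k)) = (c ^ d * c ^ k) ^ 2 := by ring
    rw [e1]
    generalize c ^ d = p at *
    field_simp
  rw [mul_pow, h1, h2, e]
  refine mul_le_of_le_one_right (by positivity) (pow_le_one₀ (by positivity) ?_)
  exact mul_le_one₀ (pow_le_one₀ hc.le hc1) (by positivity) (pow_le_one₀ hc.le hc1)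

/-- The cutoffs grow like `n ^ (d / 2)` in `L²`, and each power of the Hamiltonian gains a factor
`n ^ (-2)`. The product is thus of order `n ^ (d - 2 (d + k))`, which is more than enough. -/
lemma norm_cutoff_mul_norm_le (d k : ℕ) : ∃ C : ℝ, ∀ n : ℕ,
    ‖((cutoff d n).toLp 2 : L2 d)‖ * ‖((schwartzHamiltonian^[d + k] (cutoff d n)).toLp 2 : L2 d)‖
      ≤ C * (((n : ℝ) + 1)⁻¹) ^ k := by
  refine ⟨‖((unitCutoff d).toLp 2 : L2 d)‖
    * ‖((schwartzHamiltonian^[d + k] (unitCutoff d)).toLp 2 : L2 d)‖, fun n => ?_⟩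
  have hc : 0 < ((n : ℝ) + 1)⁻¹ := by positivity
  have hc1 : ((n : ℝ) + 1)⁻¹ ≤ 1 :=
    inv_le_one_of_one_le₀ (by linarith [(n.cast_nonneg : (0 : ℝ) ≤ n)])
  refine mul_inv_mul_sq_le (d := d) hc hc1 (norm_nonneg _) (norm_nonneg _)
    (norm_toLp_dilate_sq hc.ne' _ hc) ?_
  rw [cutoff, iterate_schwartzHamiltonian_dilate, toLp_smul, norm_smul, mul_pow,
    norm_toLp_dilate_sq _ _ hc, Complex.norm_real, Real.norm_of_nonneg (pow_nonneg hc.le _)]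

lemma norm_iterate_schwartzHamiltonian_cutoff_le (d k : ℕ) : ∃ C : ℝ, ∀ n : ℕ,
    ‖((schwartzHamiltonian^[d + k] (cutoff d n)).toLp 2 : L2 d)‖
      ≤ C * (((n : ℝ) + 1)⁻¹) ^ k := by
  refine ⟨‖((schwartzHamiltonian^[d + k] (unitCutoff d)).toLp 2 : L2 d)‖, fun n => ?_⟩
  have hc : 0 < ((n : ℝ) + 1)⁻¹ := by positivity
  have hc1 : ((n : ℝ) + 1)⁻¹ ≤ 1 :=
    inv_le_one_of_one_le₀ (by linarith [(n.cast_nonneg : (0 : ℝ) ≤ n)])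
  rw [cutoff, iterate_schwartzHamiltonian_dilate, toLp_smul, norm_smul, Complex.norm_real,
    Real.norm_of_nonneg (pow_nonneg hc.le _)]
  have h := norm_toLp_dilate_sq hc.ne' (schwartzHamiltonian^[d + k] (unitCutoff d)) hc
  have h1 : 1 ≤ √((((n : ℝ) + 1)⁻¹ ^ d)⁻¹) := by
    rw [Real.one_le_sqrt]
    exact (one_le_inv₀ (by positivity)).2 (pow_le_one₀ hc.le hc1)
  have h2 := mul_inv_mul_sq_le (a := 1) (x := √((((n : ℝ) + 1)⁻¹ ^ d)⁻¹)) (d := d) (k := k)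
    (y := ((n : ℝ) + 1)⁻¹ ^ (2 * (d + k))
      * ‖((dilate hc.ne' (schwartzHamiltonian^[d + k] (unitCutoff d))).toLp 2 volume : L2 d)‖)
    (b := ‖((schwartzHamiltonian^[d + k] (unitCutoff d)).toLp 2 volume : L2 d)‖) hc hc1
    zero_le_one (norm_nonneg _)
    (by rw [Real.sq_sqrt (by positivity), one_pow, mul_one]) (by rw [mul_pow, h])
  rw [one_mul] at h2
  exact (le_mul_of_one_le_left (by positivity) h1).trans h2

end cutoff

/-! ### The energy functional and its minimum -/

/-- The function `P_k(H)` of the Hamiltonian, where `P_k` is the `k`-th slope of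
`t ↦ exp (-(β t))` at `0`. -/
def slopeOfH {d : ℕ} (U : Rd d → ℝ≥0∞) (β : ℝ) (k : ℕ) : L2 d →L[ℂ] L2 d :=
  functionOfH (expSlope β k) 0 U

section slopeOfH

variable {d : ℕ} {U : Rd d → ℝ≥0∞} {β : ℝ}

lemma heatSemigroup_eq_slopeOfH (U : Rd d → ℝ≥0∞) (β : ℝ) :
    heatSemigroup U β = slopeOfH U β 0 := rfl

lemma slopeOfH_inner (U : Rd d → ℝ≥0∞) (β : ℝ) (k : ℕ) (x y : L2 d) :
    ⟪slopeOfH U β k x, y⟫_ℂ = ⟪x, slopeOfH U β k y⟫_ℂ := functionOfH_inner _ _ _ _ _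

/-- On the domain of `H`, the relation `P_k t = P_k 0 - P_{k+1} t * t` holds for functions
of `H`. -/
lemma slopeOfH_apply (hβ : 0 < β) (k : ℕ) {κ ζ : L2 d} (h : IsHamiltonian U κ ζ) :
    slopeOfH U β k κ = (expSlope β k 0 : ℂ) • κ - slopeOfH U β (k + 1) ζ := by
  have hk := isSymbol_expSlope hβ (k + 1)
  have h0 : IsSymbol (fun t => 0 - expSlope β (k + 1) t) (0 - 0) := (IsSymbol.const 0).sub hk
  have h1 : functionOfH (fun t => 0 - expSlope β (k + 1) t) (0 - 0) U
      = -functionOfH (expSlope β (k + 1)) 0 U := by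
    rw [functionOfH_sub (IsSymbol.const 0) hk, functionOfH_const]
    simp
  rw [sub_zero] at h0 h1
  rw [slopeOfH, functionOfH_apply_of_isHamiltonian (isSymbol_expSlope hβ k) h0
    (fun t _ => by rw [zero_sub]; exact expSlope_succ β k t) h, h1, neg_apply, ← sub_eq_add_neg]
  rfl

lemma isHamiltonian_slopeOfH_one (hβ : 0 < β) (φ : L2 d) :
    IsHamiltonian U (slopeOfH U β 1 φ) (φ - slopeOfH U β 0 φ) := by
  have h0 := isSymbol_expSlope hβ 0
  have h := isHamiltonian_functionOfH (U := U) (isSymbol_expSlope hβ 1) ((IsSymbol.const 1).sub h0)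
    (fun t _ => (expSlope_one β t).symm) φ
  rw [functionOfH_sub (IsSymbol.const 1) h0, functionOfH_const, Complex.ofReal_one, one_smul] at h
  exact h

lemma isHamiltonian_slopeOfH_two (hβ : 0 < β) (φ : L2 d) :
    IsHamiltonian U (slopeOfH U β 2 φ) ((β : ℂ) • φ - slopeOfH U β 1 φ) := by
  have h0 := isSymbol_expSlope hβ 1
  have h := isHamiltonian_functionOfH (U := U) (isSymbol_expSlope hβ 2) ((IsSymbol.const β).sub h0)
    (fun t _ => (expSlope_two β t).symm) φ
  rw [functionOfH_sub (IsSymbol.const β) h0, functionOfH_const] at h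
  exact h

lemma fOperator_slopeOfH_two (hβ : 0 < β) (φ : L2 d) :
    fOperator U β (slopeOfH U β 2 φ) = (β : ℂ) • slopeOfH U β 1 φ := by
  have h : fOperator U β * slopeOfH U β 2 = (β : ℂ) • slopeOfH U β 1 := by
    rw [fOperator, slopeOfH, ← functionOfH_mul (isSymbol_fFun hβ) (isSymbol_expSlope hβ 2),
      slopeOfH, ← one_mul (functionOfH (expSlope β 1) 0 U), ← smul_mul_assoc, ← functionOfH_const,
      ← functionOfH_mul (IsSymbol.const β) (isSymbol_expSlope hβ 1), mul_zero, mul_zero]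
    exact functionOfH_congr fun t ht => fFun_mul_expSlope_two hβ ht
  exact congrArg (fun T : L2 d →L[ℂ] L2 d => T φ) h

lemma fOperator_sub_slopeOfH_one (hβ : 0 < β) (φ : L2 d) :
    fOperator U β ((β : ℂ) • φ - slopeOfH U β 1 φ) = (β : ℂ) • (φ - slopeOfH U β 0 φ) := by
  have h0 := isSymbol_expSlope hβ 0
  have h1 := isSymbol_expSlope hβ 1
  have hb := IsSymbol.const β
  have h : fOperator U β * ((β : ℂ) • 1 - slopeOfH U β 1)
      = ((β : ℂ) • 1) * (1 - slopeOfH U β 0) := by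
    have e1 : (1 : L2 d →L[ℂ] L2 d) = functionOfH (fun _ => 1) 1 U := by
      rw [functionOfH_const, Complex.ofReal_one, one_smul]
    have e2 : 1 - slopeOfH U β 0 = functionOfH (fun t => 1 - expSlope β 0 t) (1 - 0) U := by
      rw [functionOfH_sub (IsSymbol.const 1) h0, ← e1]
      rfl
    rw [e2, fOperator, slopeOfH, ← functionOfH_const, ← functionOfH_sub hb h1,
      ← functionOfH_mul (isSymbol_fFun hβ) (hb.sub h1),
      ← functionOfH_mul hb ((IsSymbol.const 1).sub h0)]
    simp only [sub_zero, one_mul, mul_one]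
    refine functionOfH_congr fun t ht => ?_
    rw [← expSlope_two, mul_left_comm, fFun_mul_expSlope_two hβ ht, mul_left_comm, expSlope_one]
    rfl
  exact congrArg (fun T : L2 d →L[ℂ] L2 d => T φ) h

lemma fOperator_nonneg (hβ : 0 < β) (φ : L2 d) : 0 ≤ (⟪φ, fOperator U β φ⟫_ℂ).re :=
  functionOfH_nonneg (fun _ ht => fFun_nonneg hβ ht) zero_le_one φ

end slopeOfH

section form

variable {d : ℕ} {U : Rd d → ℝ≥0∞} {u v w : L2 d}

lemma schrodingerForm_add_right (hw : MemFormDomain U w) (hu : MemFormDomain U u)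
    (hv : MemFormDomain U v) :
    schrodingerForm U w (u + v) = schrodingerForm U w u + schrodingerForm U w v := by
  obtain ⟨a, ha, rfl⟩ := formGraph_lift hu
  obtain ⟨b, hb, rfl⟩ := formGraph_lift hv
  obtain ⟨c, hc, rfl⟩ := formGraph_lift hw
  have h := formGraph_inner hc ((formGraph U).add_mem ha hb)
  rw [inner_add_right, formGraph_inner hc ha, formGraph_inner hc hb, WithLp.add_fst,
    inner_add_right] at h
  linear_combination -h

lemma schrodingerForm_conj (hu : MemFormDomain U u) (hv : MemFormDomain U v) :
    (starRingEnd ℂ) (schrodingerForm U u v) = schrodingerForm U v u := by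
  obtain ⟨a, ha, rfl⟩ := formGraph_lift hu
  obtain ⟨b, hb, rfl⟩ := formGraph_lift hv
  have h := inner_conj_symm (𝕜 := ℂ) b a
  rw [formGraph_inner ha hb, formGraph_inner hb ha, map_add, inner_conj_symm] at h
  exact add_right_cancel h

lemma eLpNorm_two_sq {X : Type*} [MeasurableSpace X] {ν : Measure X} (f : X → ℂ) :
    eLpNorm f 2 ν ^ 2 = ∫⁻ x, ‖f x‖ₑ ^ 2 ∂ν := by
  have h := eLpNorm_nnreal_pow_eq_lintegral (f := f) (μ := ν) (p := 2) two_ne_zero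
  simpa only [NNReal.coe_ofNat, ENNReal.rpow_ofNat, ENNReal.coe_ofNat] using h

lemma lintegral_enorm_sq {X : Type*} [MeasurableSpace X] {ν : Measure X} (f : Lp ℂ 2 ν) :
    ∫⁻ x, ‖f x‖ₑ ^ 2 ∂ν = ENNReal.ofReal (‖f‖ ^ 2) := by
  rw [ENNReal.ofReal_pow (norm_nonneg f), ofReal_norm, Lp.enorm_def, eLpNorm_two_sq]

lemma re_integral_conj_mul_self {X : Type*} [MeasurableSpace X] {ν : Measure X} {f : X → ℂ}
    (hf : MemLp f 2 ν) :
    (∫ x, (starRingEnd ℂ) (f x) * f x ∂ν).re = ‖hf.toLp‖ ^ 2 := by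
  have h : ∫ x, (starRingEnd ℂ) (f x) * f x ∂ν = ⟪hf.toLp, hf.toLp⟫_ℂ := by
    rw [L2.inner_def]
    refine integral_congr_ae ?_
    filter_upwards [hf.coeFn_toLp] with x hx
    rw [hx, RCLike.inner_apply, mul_comm]
  rw [h, re_inner_self]

lemma re_two_mul_sum_inner_weakGradient (u : L2 d) :
    (2 * ∑ i, ⟪weakGradient u i, weakGradient u i⟫_ℂ).re = 2 * ∑ i, ‖weakGradient u i‖ ^ 2 := by
  rw [← Complex.ofReal_ofNat, Complex.re_ofReal_mul, Complex.re_sum]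
  simp only [re_inner_self]

lemma re_schrodingerForm_self (hu : MemFormDomain U u) :
    (schrodingerForm U u u).re = 2 * ∑ i, ‖weakGradient u i‖ ^ 2 + ‖hu.2.toLp‖ ^ 2 := by
  rw [schrodingerForm, Complex.add_re, re_two_mul_sum_inner_weakGradient,
    re_integral_conj_mul_self hu.2]

lemma re_schrodingerForm_self_nonneg (hu : MemFormDomain U u) :
    0 ≤ (schrodingerForm U u u).re := by
  rw [re_schrodingerForm_self hu]
  positivity

end form

section energy

variable {d : ℕ} {U : Rd d → ℝ≥0∞} {β : ℝ} {χ : 𝓢(Rd d, ℂ)}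

lemma lintegral_kinetic (ψ : L2 d) :
    ∫⁻ x, 2 * ∑ i, ‖weakGradient ψ i x‖ₑ ^ 2
      = ENNReal.ofReal (2 * ∑ i, ‖weakGradient ψ i‖ ^ 2) := by
  have hm : ∀ i, Measurable fun x => ‖weakGradient ψ i x‖ₑ ^ 2 := fun i =>
    ((Lp.stronglyMeasurable (weakGradient ψ i)).enorm).pow_const 2
  rw [lintegral_const_mul _ (Finset.measurable_fun_sum _ fun i _ => hm i),
    lintegral_finsetSum _ fun i _ => hm i, ENNReal.ofReal_mul zero_le_two,
    ENNReal.ofReal_sum_of_nonneg fun i _ => by positivity]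
  simp only [lintegral_enorm_sq]
  norm_num

lemma energy_eq (U : Rd d → ℝ≥0∞) (β : ℝ) (ψ : L2 d) :
    energy U β ψ = ENNReal.ofReal (2 * ∑ i, ‖weakGradient ψ i‖ ^ 2)
      + (∫⁻ x, U x * ‖1 - ψ x‖ₑ ^ 2) + ENNReal.ofReal (1 / β * (⟪ψ, fOperator U β ψ⟫_ℂ).re) := by
  rw [energy, ← lintegral_kinetic, lintegral_add_left]
  refine Measurable.const_mul (Finset.measurable_fun_sum _ fun i _ => ?_) _
  exact ((Lp.stronglyMeasurable (weakGradient ψ i)).enorm).pow_const 2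

/-- The potential energy of `ψ` depends only on `ψ - χ`, where `χ = 1` on the support of `U`. -/
lemma lintegral_potential (hU : Measurable U) (hχ : ∀ x, U x ≠ 0 → χ x = 1) (u : L2 d) :
    ∫⁻ x, U x * ‖1 - (χ.toLp 2 volume + u : L2 d) x‖ₑ ^ 2
      = ∫⁻ x, ‖u x‖ₑ ^ 2 ∂(volume.withDensity U) := by
  rw [lintegral_withDensity_eq_lintegral_mul _ hU
    (((Lp.stronglyMeasurable u).enorm).pow_const 2)]
  refine lintegral_congr_ae ?_
  filter_upwards [Lp.coeFn_add (χ.toLp 2 volume : L2 d) u, χ.coeFn_toLp 2] with x h1 h2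
  by_cases h : U x = 0
  · simp [h]
  · rw [Pi.mul_apply, h1, Pi.add_apply, h2, hχ x h, sub_add_cancel_left, enorm_neg]

/-- The energy as a quadratic functional of `u = ψ - χ` in the form domain. -/
lemma energy_add (hU : Measurable U) (hβ : 0 < β) (hχ : ∀ x, U x ≠ 0 → χ x = 1) {u : L2 d}
    (hu : MemFormDomain U u) :
    energy U β (χ.toLp 2 volume + u) = ENNReal.ofReal
      ((⟪(χ.toLp 2 volume : L2 d), (schwartzHamiltonian χ).toLp 2 volume⟫_ℂ).re
        + 2 * (⟪u, (schwartzHamiltonian χ).toLp 2 volume⟫_ℂ).re + (schrodingerForm U u u).re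
        + 1 / β * (⟪χ.toLp 2 volume + u, fOperator U β (χ.toLp 2 volume + u)⟫_ℂ).re) := by
  have hf := fOperator_nonneg (U := U) hβ (χ.toLp 2 volume + u)
  have hkin : 2 * ∑ i, ‖weakGradient (χ.toLp 2 volume + u) i‖ ^ 2
      = (⟪(χ.toLp 2 volume : L2 d), (schwartzHamiltonian χ).toLp 2 volume⟫_ℂ).re
        + 2 * (⟪u, (schwartzHamiltonian χ).toLp 2 volume⟫_ℂ).re
        + 2 * ∑ i, ‖weakGradient u i‖ ^ 2 := by
    have e1 := two_mul_sum_inner_weakGradient (memH1_schwartz χ) χ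
    have e2 := two_mul_sum_inner_weakGradient hu.1 χ
    have e3 := congrArg (starRingEnd ℂ) e2
    rw [map_mul, map_sum, ← Complex.ofReal_ofNat, Complex.conj_ofReal] at e3
    simp only [inner_conj_symm (weakGradient (χ.toLp 2 volume : L2 d) _)] at e3
    rw [← re_two_mul_sum_inner_weakGradient, (memH1_schwartz χ).weakGradient_add hu.1]
    simp only [Pi.add_apply, inner_add_left, inner_add_right, Finset.sum_add_distrib, mul_add]
    push_cast at e3
    rw [e1, e2, e3, Complex.add_re, Complex.add_re, Complex.add_re, Complex.conj_re,
      re_two_mul_sum_inner_weakGradient]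
    ring
  have hkin0 : 0 ≤ 2 * ∑ i, ‖weakGradient (χ.toLp 2 volume + u) i‖ ^ 2 := by positivity
  have hpot : ∫⁻ x, ‖u x‖ₑ ^ 2 ∂(volume.withDensity U) = ENNReal.ofReal (‖hu.2.toLp‖ ^ 2) := by
    rw [← lintegral_enorm_sq]
    refine lintegral_congr_ae ?_
    filter_upwards [hu.2.coeFn_toLp] with x hx
    rw [hx]
  rw [energy_eq, lintegral_potential hU hχ, hpot, ← ENNReal.ofReal_add hkin0 (by positivity),
    ← ENNReal.ofReal_add (by positivity) (by positivity), hkin, re_schrodingerForm_self hu]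
  congr 1
  ring

/-- A function of finite energy differs from `χ` by an element of the form domain. -/
lemma memFormDomain_of_energy_ne_top (hU : Measurable U) (hχ : ∀ x, U x ≠ 0 → χ x = 1) {ψ : L2 d}
    (hψ : MemH1 ψ) (h : energy U β ψ ≠ ⊤) : MemFormDomain U (ψ - χ.toLp 2 volume) := by
  refine ⟨hψ.sub (memH1_schwartz χ), ?_⟩
  have h1 : ∫⁻ x, U x * ‖1 - ψ x‖ₑ ^ 2 ≠ ⊤ := by
    rw [energy_eq] at h
    exact (ENNReal.add_ne_top.1 (ENNReal.add_ne_top.1 h).1).2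
  have h2 := lintegral_potential hU hχ (ψ - χ.toLp 2 volume)
  rw [add_sub_cancel] at h2
  rw [h2] at h1
  refine ⟨(Lp.stronglyMeasurable _).aestronglyMeasurable, ?_⟩
  rw [← eLpNorm_two_sq] at h1
  exact lt_top_iff_ne_top.2 fun h4 => h1 (by rw [h4]; rfl)

/-- The image `f(βH) ψ` of the minimizer `ψ` of the energy. -/
def minimizerImage {d : ℕ} (U : Rd d → ℝ≥0∞) (β : ℝ) (χ : 𝓢(Rd d, ℂ)) : L2 d :=
  χ.toLp 2 volume - slopeOfH U β 0 (χ.toLp 2 volume)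
    - slopeOfH U β 1 ((schwartzHamiltonian χ).toLp 2 volume)

/-- The difference `ψ - χ`, for the minimizer `ψ` of the energy. -/
def minimizerRemainder {d : ℕ} (U : Rd d → ℝ≥0∞) (β : ℝ) (χ : 𝓢(Rd d, ℂ)) : L2 d :=
  (β : ℂ)⁻¹ • (-slopeOfH U β 1 (χ.toLp 2 volume)
    - slopeOfH U β 2 ((schwartzHamiltonian χ).toLp 2 volume))

/-- The minimum of the energy, which is its value at `ψ = χ + minimizerRemainder U β χ`. -/
def minEnergy {d : ℕ} (U : Rd d → ℝ≥0∞) (β : ℝ) (χ : 𝓢(Rd d, ℂ)) : ℝ :=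
  (⟪(χ.toLp 2 volume : L2 d), (schwartzHamiltonian χ).toLp 2 volume⟫_ℂ
    + ⟪minimizerRemainder U β χ, (schwartzHamiltonian χ).toLp 2 volume⟫_ℂ
    + (β : ℂ)⁻¹ * ⟪(χ.toLp 2 volume : L2 d), minimizerImage U β χ⟫_ℂ).re

/-- The Euler-Lagrange equation `H (ψ - χ) = -Hχ - β⁻¹ f(βH) ψ`, with `-2Δχ` for `Hχ`. -/
lemma isHamiltonian_minimizerRemainder (hβ : 0 < β) :
    IsHamiltonian U (minimizerRemainder U β χ)
      (-(schwartzHamiltonian χ).toLp 2 volume - (β : ℂ)⁻¹ • minimizerImage U β χ) := by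
  have h := (((isHamiltonian_slopeOfH_one (U := U) hβ (χ.toLp 2 volume)).smul (-1)).add
    ((isHamiltonian_slopeOfH_two (U := U) hβ ((schwartzHamiltonian χ).toLp 2 volume)).smul
    (-1))).smul (β : ℂ)⁻¹
  have hb : (β : ℂ) ≠ 0 := by exact_mod_cast hβ.ne'
  convert h using 1
  · rw [minimizerRemainder, neg_one_smul, neg_one_smul, sub_eq_add_neg]
  · rw [minimizerImage]
    generalize slopeOfH U β 0 (χ.toLp 2 volume) = a
    generalize slopeOfH U β 1 ((schwartzHamiltonian χ).toLp 2 volume) = b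
    generalize ((schwartzHamiltonian χ).toLp 2 volume : L2 d) = w
    match_scalars <;> field_simp

lemma fOperator_minimizer (hβ : 0 < β) :
    fOperator U β (χ.toLp 2 volume + minimizerRemainder U β χ) = minimizerImage U β χ := by
  have hb : (β : ℂ) ≠ 0 := by exact_mod_cast hβ.ne'
  have e : (χ.toLp 2 volume + minimizerRemainder U β χ : L2 d)
      = (β : ℂ)⁻¹ • (((β : ℂ) • χ.toLp 2 volume - slopeOfH U β 1 (χ.toLp 2 volume))
        - slopeOfH U β 2 ((schwartzHamiltonian χ).toLp 2 volume)) := by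
    rw [minimizerRemainder]
    generalize slopeOfH U β 1 (χ.toLp 2 volume) = a
    generalize slopeOfH U β 2 ((schwartzHamiltonian χ).toLp 2 volume) = b
    match_scalars <;> field_simp
  rw [e, map_smul, map_sub, fOperator_sub_slopeOfH_one hβ, fOperator_slopeOfH_two hβ, ← smul_sub,
    smul_smul, inv_mul_cancel₀ hb, one_smul]
  rfl

/-- Completing the square: the energy around its minimizer. -/
lemma energy_minimizer_add (hU : Measurable U) (hβ : 0 < β) (hχ : ∀ x, U x ≠ 0 → χ x = 1) {v : L2 d}
    (hv : MemFormDomain U v) :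
    energy U β (χ.toLp 2 volume + (minimizerRemainder U β χ + v)) = ENNReal.ofReal
      (minEnergy U β χ + (schrodingerForm U v v).re + 1 / β * (⟪v, fOperator U β v⟫_ℂ).re) := by
  have hη := isHamiltonian_minimizerRemainder (U := U) (χ := χ) hβ
  have hF := fOperator_minimizer (U := U) (χ := χ) hβ
  have hηd := hη.memFormDomain
  rw [energy_add hU hβ hχ (hηd.add hv), schrodingerForm_add_right (hηd.add hv) hηd hv,
    hη.form_eq (hηd.add hv), ← schrodingerForm_conj hv (hηd.add hv),
    schrodingerForm_add_right hv hηd hv, hη.form_eq hv, ← add_assoc, map_add,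
    map_add (fOperator U β) _ v, hF, minEnergy]
  have h1 : ⟪(χ.toLp 2 volume + minimizerRemainder U β χ : L2 d), fOperator U β v⟫_ℂ
      = (starRingEnd ℂ) ⟪v, minimizerImage U β χ⟫_ℂ := by
    rw [← hF, inner_conj_symm]
    exact (functionOfH_inner _ _ _ _ _).symm
  rw [inner_add_right _ (minimizerImage U β χ),
    inner_add_left (χ.toLp 2 volume + minimizerRemainder U β χ) v (fOperator U β v), h1]
  simp only [inner_add_left, inner_sub_right, inner_neg_right, inner_smul_right,
    ← Complex.ofReal_inv, Complex.add_re, Complex.sub_re, Complex.neg_re, Complex.re_ofReal_mul,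
    Complex.conj_re, one_div]
  congr 1
  ring

/-- The minimum of the energy over `H¹`. -/
theorem iInf_energy (hU : Measurable U) (hβ : 0 < β) (hχ : ∀ x, U x ≠ 0 → χ x = 1) :
    ⨅ (ψ : L2 d) (_ : MemH1 ψ), energy U β ψ = ENNReal.ofReal (minEnergy U β χ) := by
  have hη := (isHamiltonian_minimizerRemainder (U := U) (χ := χ) hβ).memFormDomain
  apply le_antisymm
  · have h0 := hη.sub hη
    rw [sub_self] at h0
    have h := energy_minimizer_add hU hβ hχ h0
    have e : (schrodingerForm U 0 (0 : L2 d)).re = 0 := by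
      have := schrodingerForm_add_right h0 h0 h0
      rw [add_zero, left_eq_add] at this
      rw [this, Complex.zero_re]
    rw [add_zero, e, inner_zero_left, Complex.zero_re, mul_zero, add_zero, add_zero] at h
    rw [← h]
    exact iInf₂_le _ ((memH1_schwartz χ).add hη.1)
  · refine le_iInf₂ fun ψ hψ => ?_
    by_cases ht : energy U β ψ = ⊤
    · rw [ht]; exact le_top
    · have hu := memFormDomain_of_energy_ne_top hU hχ hψ ht
      have hv := hu.sub hη
      have h := energy_minimizer_add hU hβ hχ hv
      rw [add_sub_cancel, add_sub_cancel] at h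
      rw [h]
      refine ENNReal.ofReal_le_ofReal ?_
      have h1 := re_schrodingerForm_self_nonneg hv
      have h2 := fOperator_nonneg (U := U) hβ (ψ - χ.toLp 2 volume - minimizerRemainder U β χ)
      have h3 : 0 ≤ 1 / β * (⟪ψ - χ.toLp 2 volume - minimizerRemainder U β χ,
        fOperator U β (ψ - χ.toLp 2 volume - minimizerRemainder U β χ)⟫_ℂ).re := by positivity
      linarith

end energy

/-! ### The integral of the kernel -/

section limit

variable {d : ℕ} {U : Rd d → ℝ≥0∞} {β : ℝ}

lemma isHamiltonian_zero_schwartz (ψ : 𝓢(Rd d, ℂ)) :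
    IsHamiltonian 0 (ψ.toLp 2 volume) ((schwartzHamiltonian ψ).toLp 2 volume) :=
  isHamiltonian_schwartz measurable_zero fun _ h => absurd rfl h

/-- The Hamiltonian is symmetric. -/
lemma IsHamiltonian.inner_comm {κ ζ κ' ζ' : L2 d} (h : IsHamiltonian U κ ζ)
    (h' : IsHamiltonian U κ' ζ') : ⟪κ, ζ'⟫_ℂ = ⟪ζ, κ'⟫_ℂ := by
  rw [← h'.form_eq h.memFormDomain, ← schrodingerForm_conj h'.memFormDomain h.memFormDomain,
    h.form_eq h'.memFormDomain, inner_conj_symm]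

/-- For a function supported away from the potential, each power of the Hamiltonian trades a
slope for the next one, both for `H` and for the free Hamiltonian. -/
lemma slopeOfH_sub_slopeOfH_zero (hβ : 0 < β) (hU : Measurable U) {O : Set (Rd d)} (hO : IsOpen O)
    (hUO : ∀ x, U x ≠ 0 → x ∈ O) {ψ : 𝓢(Rd d, ℂ)} (hψ : ∀ x ∈ O, ψ x = 0) (j k : ℕ) :
    slopeOfH U β j (ψ.toLp 2 volume) - slopeOfH 0 β j (ψ.toLp 2 volume)
      = (-1 : ℂ) ^ k • (slopeOfH U β (j + k) ((schwartzHamiltonian^[k] ψ).toLp 2 volume)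
        - slopeOfH 0 β (j + k) ((schwartzHamiltonian^[k] ψ).toLp 2 volume)) := by
  induction k with
  | zero => simp
  | succ k ih =>
    have h1 : IsHamiltonian U ((schwartzHamiltonian^[k] ψ).toLp 2 volume)
        ((schwartzHamiltonian^[k + 1] ψ).toLp 2 volume) := by
      rw [Function.iterate_succ_apply']
      exact isHamiltonian_schwartz hU fun x hx =>
        iterate_schwartzHamiltonian_apply_eq_zero hO hψ k (hUO x hx)
    have h2 : IsHamiltonian 0 ((schwartzHamiltonian^[k] ψ).toLp 2 volume)
        ((schwartzHamiltonian^[k + 1] ψ).toLp 2 volume) := by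
      rw [Function.iterate_succ_apply']
      exact isHamiltonian_zero_schwartz _
    rw [ih, slopeOfH_apply hβ _ h1, slopeOfH_apply hβ _ h2, sub_sub_sub_cancel_left, pow_succ,
      mul_neg_one, neg_smul, ← smul_neg, neg_sub, add_assoc]

lemma inner_toLp_eq_zero {O : Set (Rd d)} {ψ χ : 𝓢(Rd d, ℂ)} (hψ : ∀ x ∈ O, ψ x = 0)
    (hχ : ∀ x, x ∉ O → χ x = 0) : ⟪(ψ.toLp 2 volume : L2 d), χ.toLp 2 volume⟫_ℂ = 0 := by
  rw [L2.inner_def]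
  refine integral_eq_zero_of_ae ?_
  filter_upwards [ψ.coeFn_toLp 2, χ.coeFn_toLp 2] with x h1 h2
  rw [h1, h2, Pi.zero_apply]
  by_cases hx : x ∈ O
  · rw [hψ x hx, inner_zero_left]
  · rw [hχ x hx, inner_zero_right]

/-- The same iteration for one matrix element: when `χ` vanishes off `O`, the terms `P_j(0) ⟪ψ, χ⟫`
drop out. -/
lemma inner_slopeOfH (hβ : 0 < β) (hU : Measurable U) {O : Set (Rd d)} (hO : IsOpen O)
    (hUO : ∀ x, U x ≠ 0 → x ∈ O) {ψ χ : 𝓢(Rd d, ℂ)} (hψ : ∀ x ∈ O, ψ x = 0)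
    (hχ : ∀ x, x ∉ O → χ x = 0) (j k : ℕ) :
    ⟪slopeOfH U β j (ψ.toLp 2 volume), (χ.toLp 2 volume : L2 d)⟫_ℂ
      = (-1 : ℂ) ^ k * ⟪slopeOfH U β (j + k) ((schwartzHamiltonian^[k] ψ).toLp 2 volume),
        (χ.toLp 2 volume : L2 d)⟫_ℂ := by
  induction k with
  | zero => simp
  | succ k ih =>
    have hk := fun x hx => iterate_schwartzHamiltonian_apply_eq_zero hO hψ k (x := x) hx
    have h1 : IsHamiltonian U ((schwartzHamiltonian^[k] ψ).toLp 2 volume)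
        ((schwartzHamiltonian^[k + 1] ψ).toLp 2 volume) := by
      rw [Function.iterate_succ_apply']
      exact isHamiltonian_schwartz hU fun x hx => hk x (hUO x hx)
    rw [ih, slopeOfH_apply hβ _ h1, inner_sub_left, inner_smul_left, inner_toLp_eq_zero hk hχ,
      mul_zero, zero_sub, pow_succ, mul_neg_one, neg_mul, mul_neg, add_assoc]

lemma tendsto_of_norm_le_mul_inv {E : Type*} [SeminormedAddCommGroup E] {f : ℕ → E} {C : ℝ}
    (h : ∀ᶠ n : ℕ in atTop, ‖f n‖ ≤ C * ((n : ℝ) + 1)⁻¹) : Tendsto f atTop (𝓝 0) := by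
  refine squeeze_zero_norm' h ?_
  have := tendsto_one_div_add_atTop_nhds_zero_nat (𝕜 := ℝ)
  simp only [one_div] at this
  simpa using this.const_mul C

lemma tendsto_inner_slopeOfH_sub (hβ : 0 < β) (hU : Measurable U) {N : ℕ}
    (hN : ∀ x, U x ≠ 0 → ‖x‖ ≤ N) :
    Tendsto (fun n => ⟪((cutoff d n).toLp 2 volume : L2 d),
      slopeOfH U β 1 ((schwartzHamiltonian (cutoff d n)).toLp 2 volume)
        - slopeOfH 0 β 1 ((schwartzHamiltonian (cutoff d n)).toLp 2 volume)⟫_ℂ) atTop (𝓝 0) := by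
  obtain ⟨C, hC⟩ := norm_cutoff_mul_norm_le d 1
  set T : L2 d →L[ℂ] L2 d := slopeOfH U β (1 + d) - slopeOfH 0 β (1 + d) with hT
  -- After `d` more powers of the Hamiltonian, the decay beats the growth of the cutoff.
  refine tendsto_of_norm_le_mul_inv (C := ‖T‖ * C) ?_
  filter_upwards [eventually_ge_atTop N] with n hn
  have hn' : (N : ℝ) ≤ n := by exact_mod_cast hn
  have h := slopeOfH_sub_slopeOfH_zero hβ hU (O := Metric.ball 0 ((n : ℝ) + 1)) Metric.isOpen_ball
    (fun x hx => mem_ball_zero_iff.2 (by linarith [hN x hx]))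
    (ψ := schwartzHamiltonian (cutoff d n))
    (fun x hx => schwartzHamiltonian_cutoff_eq_zero n (mem_ball_zero_iff.1 hx)) 1 d
  rw [h, ← Function.iterate_succ_apply, inner_smul_right, norm_mul, norm_pow, norm_neg, norm_one,
    one_pow, one_mul]
  change ‖⟪_, T _⟫_ℂ‖ ≤ _
  calc _ ≤ ‖((cutoff d n).toLp 2 volume : L2 d)‖
        * (‖T‖ * ‖((schwartzHamiltonian^[d + 1] (cutoff d n)).toLp 2 volume : L2 d)‖) :=
        (norm_inner_le_norm _ _).trans (by gcongr; exact T.le_opNorm _)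
    _ = ‖T‖ * (‖((cutoff d n).toLp 2 volume : L2 d)‖
        * ‖((schwartzHamiltonian^[d + 1] (cutoff d n)).toLp 2 volume : L2 d)‖) := by ring
    _ ≤ ‖T‖ * (C * (((n : ℝ) + 1)⁻¹) ^ 1) := mul_le_mul_of_nonneg_left (hC n) (norm_nonneg _)
    _ = ‖T‖ * C * ((n : ℝ) + 1)⁻¹ := by ring

lemma tendsto_inner_slopeOfH (hβ : 0 < β) (hU : Measurable U) {N : ℕ}
    (hN : ∀ x, U x ≠ 0 → ‖x‖ ≤ N) {χ : 𝓢(Rd d, ℂ)} (hχ : ∀ x, 2 * ((N : ℝ) + 1) < ‖x‖ → χ x = 0)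
    (j : ℕ) :
    Tendsto (fun n => ⟪slopeOfH U β j ((schwartzHamiltonian (cutoff d n)).toLp 2 volume),
      (χ.toLp 2 volume : L2 d)⟫_ℂ) atTop (𝓝 0) := by
  obtain ⟨C, hC⟩ := norm_iterate_schwartzHamiltonian_cutoff_le d 1
  set T : L2 d →L[ℂ] L2 d := slopeOfH U β (j + d) with hT
  refine tendsto_of_norm_le_mul_inv (C := ‖T‖ * C * ‖(χ.toLp 2 volume : L2 d)‖) ?_
  filter_upwards [eventually_ge_atTop (2 * (N + 1))] with n hn
  have hn' : 2 * ((N : ℝ) + 1) ≤ n := by exact_mod_cast hn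
  have hN0 : (0 : ℝ) ≤ N := N.cast_nonneg
  have h := inner_slopeOfH hβ hU (O := Metric.ball 0 ((n : ℝ) + 1)) Metric.isOpen_ball
    (fun x hx => mem_ball_zero_iff.2 (by linarith [hN x hx]))
    (ψ := schwartzHamiltonian (cutoff d n))
    (fun x hx => schwartzHamiltonian_cutoff_eq_zero n (mem_ball_zero_iff.1 hx))
    (χ := χ) (fun x hx => hχ x (by
      rw [mem_ball_zero_iff, not_lt] at hx
      linarith)) j d
  rw [h, ← Function.iterate_succ_apply, norm_mul, norm_pow, norm_neg, norm_one, one_pow, one_mul]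
  calc _ ≤ (‖T‖ * ‖((schwartzHamiltonian^[d + 1] (cutoff d n)).toLp 2 volume : L2 d)‖)
        * ‖(χ.toLp 2 volume : L2 d)‖ :=
        (norm_inner_le_norm _ _).trans (by gcongr; exact T.le_opNorm _)
    _ ≤ (‖T‖ * (C * (((n : ℝ) + 1)⁻¹) ^ 1)) * ‖(χ.toLp 2 volume : L2 d)‖ := by gcongr; exact hC n
    _ = _ := by ring

lemma isHamiltonian_cutoff_sub (hU : Measurable U) {N : ℕ} (hN : ∀ x, U x ≠ 0 → ‖x‖ ≤ N) {n : ℕ}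
    (hn : N ≤ n) :
    IsHamiltonian U ((cutoff d n).toLp 2 volume - (cutoff d N).toLp 2 volume)
      ((schwartzHamiltonian (cutoff d n)).toLp 2 volume
        - (schwartzHamiltonian (cutoff d N)).toLp 2 volume) := by
  have hn' : (N : ℝ) ≤ n := by exact_mod_cast hn
  rw [← toLp_sub, ← toLp_sub, ← schwartzHamiltonian_sub]
  refine isHamiltonian_schwartz hU fun x hx => ?_
  have := hN x hx
  rw [sub_apply, cutoff_eq_one n (by linarith), cutoff_eq_one N (by linarith), sub_self]

/-- The heat difference applied to a cutoff is the image of the minimizer, up to a boundary term. -/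
lemma heatDifference_cutoff (hβ : 0 < β) (hU : Measurable U) {N : ℕ}
    (hN : ∀ x, U x ≠ 0 → ‖x‖ ≤ N) {n : ℕ} (hn : N ≤ n) :
    heatDifference U β ((cutoff d n).toLp 2 volume)
      = minimizerImage U β (cutoff d N)
        + (slopeOfH U β 1 ((schwartzHamiltonian (cutoff d n)).toLp 2 volume)
        - slopeOfH 0 β 1 ((schwartzHamiltonian (cutoff d n)).toLp 2 volume)) := by
  have h1 := slopeOfH_apply hβ 0 (isHamiltonian_cutoff_sub (d := d) hU hN hn)
  have h2 := slopeOfH_apply hβ 0 (isHamiltonian_zero_schwartz (cutoff d n))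
  rw [expSlope_zero_zero, Complex.ofReal_one, one_smul, zero_add] at h1 h2
  rw [map_sub, map_sub, sub_eq_iff_eq_add] at h1
  rw [heatDifference, heatSemigroup_eq_slopeOfH, heatSemigroup_eq_slopeOfH, sub_apply, h1, h2,
    minimizerImage]
  abel

/-- The heat difference has quadratic form converging, along the cutoffs, to `β` times the minimum
of the energy. -/
lemma tendsto_inner_heatDifference (hβ : 0 < β) (hU : Measurable U) {N : ℕ}
    (hN : ∀ x, U x ≠ 0 → ‖x‖ ≤ N) :
    Tendsto (fun n => (⟪((cutoff d n).toLp 2 volume : L2 d),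
      heatDifference U β ((cutoff d n).toLp 2 volume)⟫_ℂ).re) atTop
      (𝓝 (β * minEnergy U β (cutoff d N))) := by
  set χ : L2 d := (cutoff d N).toLp 2 volume with hχ
  set w : L2 d := (schwartzHamiltonian (cutoff d N)).toLp 2 volume with hw
  set M : L2 d := minimizerImage U β (cutoff d N) with hM
  have t1 := tendsto_inner_slopeOfH_sub (d := d) hβ hU hN
  have t2 := tendsto_inner_slopeOfH (d := d) hβ hU hN (χ := cutoff d N)
    (fun x hx => cutoff_eq_zero N hx.le) 1
  have t3 := tendsto_inner_slopeOfH (d := d) hβ hU hN (χ := schwartzHamiltonian (cutoff d N))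
    (fun x hx => schwartzHamiltonian_cutoff_eq_zero' N hx) 2
  have t := (Complex.continuous_re.tendsto _).comp ((t1.add (t2.add t3)).const_add
    (⟪χ, M⟫_ℂ - ⟪slopeOfH U β 1 w, χ⟫_ℂ - ⟪slopeOfH U β 2 w, w⟫_ℂ + β * ⟪χ, w⟫_ℂ))
  have hE : (⟪χ, M⟫_ℂ - ⟪slopeOfH U β 1 w, χ⟫_ℂ - ⟪slopeOfH U β 2 w, w⟫_ℂ + β * ⟪χ, w⟫_ℂ
      + (0 + (0 + 0))).re = β * minEnergy U β (cutoff d N) := by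
    have e1 : (⟪slopeOfH U β 1 w, χ⟫_ℂ).re = (⟪slopeOfH U β 1 χ, w⟫_ℂ).re := by
      rw [slopeOfH_inner, ← inner_conj_symm, Complex.conj_re]
    rw [minEnergy, minimizerRemainder, ← hχ, ← hw, ← hM, inner_smul_left, inner_sub_left,
      inner_neg_left, ← Complex.ofReal_inv, Complex.conj_ofReal]
    simp only [Complex.add_re, Complex.sub_re, Complex.neg_re, Complex.re_ofReal_mul,
      Complex.zero_re, e1]
    field_simp
    ring
  rw [hE] at t
  refine t.congr' ?_
  filter_upwards [eventually_ge_atTop (2 * (N + 1))] with n hn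
  have hn' : 2 * ((N : ℝ) + 1) ≤ n := by exact_mod_cast hn
  set φ : L2 d := (cutoff d n).toLp 2 volume with hφ
  set z : L2 d := (schwartzHamiltonian (cutoff d n)).toLp 2 volume with hz
  have hκ := isHamiltonian_cutoff_sub (d := d) hU hN (n := n) (by omega)
  rw [← hχ, ← hw, ← hφ, ← hz] at hκ
  have s0 := slopeOfH_apply hβ 0 hκ
  have s1 := slopeOfH_apply hβ 1 hκ
  rw [expSlope_zero_zero, Complex.ofReal_one, one_smul, zero_add] at s0
  rw [expSlope_one_zero] at s1
  have hφw : ⟪φ, w⟫_ℂ = 0 := by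
    rw [(isHamiltonian_zero_schwartz (cutoff d n)).inner_comm
      (isHamiltonian_zero_schwartz (cutoff d N))]
    refine inner_toLp_eq_zero (O := Metric.ball 0 ((n : ℝ) + 1))
      (fun x hx => schwartzHamiltonian_cutoff_eq_zero n (mem_ball_zero_iff.1 hx)) fun x hx => ?_
    rw [mem_ball_zero_iff, not_lt] at hx
    exact cutoff_eq_zero N (by linarith)
  -- Moving functions of `H` onto `φ - χ`, which is in the domain of `H`, leaves only terms in
  -- `H (φ - χ) = z - w` with decaying matrix elements of `z`.
  have h1 : ⟪φ - χ, χ - slopeOfH U β 0 χ⟫_ℂ = ⟪slopeOfH U β 1 (z - w), χ⟫_ℂ := by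
    rw [inner_sub_right, ← slopeOfH_inner, s0, inner_sub_left (φ - χ), sub_sub_cancel]
  have h2 : ⟪φ - χ, slopeOfH U β 1 w⟫_ℂ
      = β * ⟪φ - χ, w⟫_ℂ - ⟪slopeOfH U β 2 (z - w), w⟫_ℂ := by
    rw [← slopeOfH_inner, s1, inner_sub_left, inner_smul_left, Complex.conj_ofReal]
  have h3 : ⟪φ, M⟫_ℂ = ⟪χ, M⟫_ℂ - ⟪slopeOfH U β 1 w, χ⟫_ℂ - ⟪slopeOfH U β 2 w, w⟫_ℂ + β * ⟪χ, w⟫_ℂ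
      + (⟪slopeOfH U β 1 z, χ⟫_ℂ + ⟪slopeOfH U β 2 z, w⟫_ℂ) := by
    have h4 : ⟪φ - χ, M⟫_ℂ = ⟪φ - χ, χ - slopeOfH U β 0 χ⟫_ℂ - ⟪φ - χ, slopeOfH U β 1 w⟫_ℂ := by
      rw [← inner_sub_right]
      rfl
    rw [h1, h2, map_sub, map_sub, inner_sub_left, inner_sub_left, inner_sub_left, inner_sub_left,
      hφw] at h4
    linear_combination h4
  simp only [Function.comp]
  rw [heatDifference_cutoff hβ hU hN (by omega), inner_add_right, h3]
  congr 1
  ring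

end limit

section kernel

variable {d : ℕ} {T : L2 d →L[ℂ] L2 d} {K : Rd d × Rd d → ℝ}

lemma IsNonneg.cutoff (d n : ℕ) : IsNonneg ((cutoff d n).toLp 2 volume : L2 d) := by
  filter_upwards [(_root_.cutoff d n).coeFn_toLp 2] with x hx
  rw [hx, cutoff_apply]
  exact ⟨(unitBump d).nonneg, rfl⟩

lemma ofReal_inner_cutoff_eq_lintegral (hT : PreservesNonneg T) (hK : IsIntegralKernel T K)
    (n : ℕ) :
    ENNReal.ofReal (⟪((cutoff d n).toLp 2 volume : L2 d), T ((cutoff d n).toLp 2 volume)⟫_ℂ).re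
      = ∫⁻ p, ENNReal.ofReal ((cutoff d n p.1).re * (K p * (cutoff d n p.2).re))
        ∂(volume.prod volume) := by
  have hb : ∀ x, 0 ≤ (cutoff d n x).re := fun x => (unitBump d).nonneg
  have hbm : Measurable fun x => (cutoff d n x).re :=
    Complex.measurable_re.comp (cutoff d n).continuous.measurable
  have hre : ∀ x, cutoff d n x = ((cutoff d n x).re : ℂ) := fun x => rfl
  set φ : L2 d := (cutoff d n).toLp 2 volume with hφ
  have hφc : ∀ᵐ x, φ x = ((cutoff d n x).re : ℂ) := by
    filter_upwards [(cutoff d n).coeFn_toLp 2] with x hx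
    rw [← hre, ← hx]
  have hTn := hT φ (IsNonneg.cutoff d n)
  have h1 : (⟪φ, T φ⟫_ℂ).re = ∫ x, (⟪φ x, T φ x⟫_ℂ).re := by
    rw [L2.inner_def]
    exact (integral_re (L2.integrable_inner (𝕜 := ℂ) φ (T φ))).symm
  have h2 : ∀ᵐ x, (⟪φ x, T φ x⟫_ℂ).re = (cutoff d n x).re * (T φ x).re := by
    filter_upwards [hφc] with x hx
    rw [hx, RCLike.inner_apply, Complex.conj_ofReal, mul_comm, Complex.re_ofReal_mul]
  have hint : Integrable fun x => (⟪φ x, T φ x⟫_ℂ).re :=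
    (L2.integrable_inner (𝕜 := ℂ) φ (T φ)).re
  rw [h1, ofReal_integral_eq_lintegral_ofReal hint (by
    filter_upwards [h2, hTn] with x h3 h4
    rw [h3]
    exact mul_nonneg (hb x) h4.1), lintegral_prod]
  · refine lintegral_congr_ae ?_
    filter_upwards [h2, hK.2 φ, Measure.ae_ae_of_ae_prod (hK.nonneg hT)] with x k2 k3 k4
    have e : (fun y => (K (x, y) : ℂ) * φ y)
        =ᵐ[volume] fun y => ((K (x, y) * (cutoff d n y).re : ℝ) : ℂ) := by
      filter_upwards [hφc] with y hy
      rw [hy, Complex.ofReal_mul]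
    have i1 : Integrable fun y => K (x, y) * (cutoff d n y).re := by
      simpa using! (k3.1.congr e).re
    rw [k2, k3.2, integral_congr_ae e, integral_complex_ofReal, Complex.ofReal_re,
      ENNReal.ofReal_mul (hb x), ofReal_integral_eq_lintegral_ofReal i1 (by
        filter_upwards [k4] with y hy using mul_nonneg hy (hb y)),
      ← lintegral_const_mul'' _ i1.aestronglyMeasurable.aemeasurable.ennreal_ofReal]
    refine lintegral_congr fun y => ?_
    rw [ENNReal.ofReal_mul (hb x)]
  · exact ((hbm.comp measurable_fst).aemeasurable.mul
      (hK.1.aemeasurable.mul (hbm.comp measurable_snd).aemeasurable)).ennreal_ofReal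

/-- By Fatou's lemma, the integral of the kernel of a positivity preserving operator is the limit of
its quadratic form along the cutoffs. -/
lemma lintegral_kernel_eq (hT : PreservesNonneg T) (hK : IsIntegralKernel T K) {L : ℝ}
    (hL : Tendsto (fun n => (⟪((cutoff d n).toLp 2 volume : L2 d),
      T ((cutoff d n).toLp 2 volume)⟫_ℂ).re) atTop (𝓝 L)) :
    ∫⁻ p, ENNReal.ofReal (K p) ∂(volume.prod volume) = ENNReal.ofReal L := by
  have hb : ∀ n x, 0 ≤ (cutoff d n x).re := fun n x => (unitBump d).nonneg
  have hb1 : ∀ n x, (cutoff d n x).re ≤ 1 := fun n x => (unitBump d).le_one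
  have hbm : ∀ n, Measurable fun x => (cutoff d n x).re := fun n =>
    Complex.measurable_re.comp (cutoff d n).continuous.measurable
  have hL' := ENNReal.tendsto_ofReal hL
  simp only [ofReal_inner_cutoff_eq_lintegral hT hK] at hL'
  apply le_antisymm
  · have hF := lintegral_liminf_le' (u := atTop) (μ := (volume : Measure (Rd d)).prod volume)
      (f := fun n p => ENNReal.ofReal ((cutoff d n p.1).re * (K p * (cutoff d n p.2).re)))
      fun n => (((hbm n).comp measurable_fst).aemeasurable.mul
        (hK.1.aemeasurable.mul ((hbm n).comp measurable_snd).aemeasurable)).ennreal_ofReal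
    rw [hL'.liminf_eq] at hF
    refine le_trans (le_of_eq (lintegral_congr fun p => ?_)) hF
    refine (Tendsto.liminf_eq ?_).symm
    refine tendsto_const_nhds.congr' ?_
    obtain ⟨m, hm⟩ := exists_nat_gt (max ‖p.1‖ ‖p.2‖)
    filter_upwards [eventually_ge_atTop m] with n hn
    have hn' : (m : ℝ) ≤ n := by exact_mod_cast hn
    have h1 := (le_max_left _ _).trans hm.le
    have h2 := (le_max_right _ _).trans hm.le
    rw [cutoff_eq_one n (by linarith), cutoff_eq_one n (by linarith), Complex.one_re, one_mul,
      mul_one]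
  · refine le_of_tendsto' hL' fun n => lintegral_mono_ae ?_
    filter_upwards [hK.nonneg hT] with p hp
    refine ENNReal.ofReal_le_ofReal ?_
    exact (mul_le_of_le_one_left (mul_nonneg hp (hb n _)) (hb1 n _)).trans
      (mul_le_of_le_one_right hp (hb1 n _))

end kernel

end

theorem lemma3 (d : ℕ) (hd : 1 ≤ d) (U : Rd d → ℝ≥0∞) (hU : Measurable U)
    (hU_radial : ∀ x y, ‖x‖ = ‖y‖ → U x = U y)
    (R₀ : ℝ) (hU_range : ∀ x, R₀ < ‖x‖ → U x = 0)
    (β : ℝ) (hβ : 0 < β) :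
    (∃ K : Rd d × Rd d → ℝ, IsIntegralKernel (heatDifference U β) K) ∧
    ∀ K : Rd d × Rd d → ℝ, IsIntegralKernel (heatDifference U β) K →
      (∀ᵐ p ∂(volume.prod volume), 0 ≤ K p) ∧
      Integrable K (volume.prod volume) ∧
      ENNReal.ofReal (aBeta β K) =
        ENNReal.ofReal (1 / (8 * Real.pi)) *
          ⨅ (ψ : L2 d) (_ : MemH1 ψ), energy U β ψ := by
  have hpos := preservesNonneg_heatDifference U hβ
  refine ⟨exists_isIntegralKernel hpos (memLp_top_heatDifference U hβ), fun K hK => ?_⟩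
  obtain ⟨N, hN'⟩ := exists_nat_gt R₀
  have hN : ∀ x, U x ≠ 0 → ‖x‖ ≤ N := fun x hx => by
    by_contra h
    exact hx (hU_range x (by linarith))
  have hχ : ∀ x, U x ≠ 0 → cutoff d N x = 1 := fun x hx =>
    cutoff_eq_one N (by linarith [hN x hx])
  have hK0 := hK.nonneg hpos
  have hlim := lintegral_kernel_eq hpos hK (tendsto_inner_heatDifference hβ hU hN)
  have hKi : Integrable K (volume.prod volume) := by
    refine (lintegral_ofReal_ne_top_iff_integrable hK.1 hK0).1 ?_
    rw [hlim]
    exact ENNReal.ofReal_ne_top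
  refine ⟨hK0, hKi, ?_⟩
  rw [aBeta, iInf_energy hU hβ hχ, ENNReal.ofReal_mul (by positivity),
    ofReal_integral_eq_lintegral_ofReal hKi hK0, hlim, ← ENNReal.ofReal_mul (by positivity),
    ← ENNReal.ofReal_mul (by positivity)]
  congr 1
  have := Real.pi_pos.ne'
  field_simp
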